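/- **Harnack inequality.** Let $n\ge 3$ and let $\lambda>0$, $\Lambda\in\mathbb R$, $\Gamma\ge0$. There is a constant $C>0$, depending only on $n,\lambda,\Lambda,\Gamma$, with the following property. Let $\Omega\subset\mathbb R^n$ be open and let $A=a+b$ be a real $n\times n$ matrix function on $\Omega$ such that: (i) $a=(a_{ij})$ is measurable, symmetric, $\|a_{ij}\|_{L^\infty(\Omega)}\le\Lambda$ for all $i,j$, and $(a(x)\xi)\cdot\xi\ge\lambda|\xi|^2$ for a.e. $x\in\Omega$ and all $\xi\in\mathbb R^n$; (ii) $b=(b_{ij})$ is anti-symmetric and $b_{ij}\in BMO(\Omega)$ with $\|b_{ij}\|_{BMO(\Omega)}\le\Gamma$ for all $i,j$, that is, $b_{ij}\in L^1_{loc}(\Omega)$ and $\frac1{|Q|}\int_Q|b_{ij}-(b_{ij})_Q|\,dx\le\Gamma$ for every closed cube $Q\subset\Omega$ with sides parallel to the axes, where $(f)_Q=\frac1{|Q|}\int_Q f\,dx$. Let $u\in W^{1,2}_{loc}(\Omega)$, $u\ge0$ a.e. in $\Omega$, be a weak solution of $Lu=-\operatorname{div}(A\nabla u)=0$ in $\Omega$,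 that is, $$\int_\Omega a\nabla u\cdot\nabla\varphi\,dx+\int_\Omega b\nabla u\cdot\nabla\varphi\,dx=0$$ for all $\varphi\in W^{1,2}(\Omega)$ whose support is a compact subset of $\Omega$. Here $\int_\Omega b\nabla u\cdot\nabla\varphi\,dx$ means $\frac12\int_\Omega\sum_{i,j}b_{ij}(u_{x_j}\varphi_{x_i}-u_{x_i}\varphi_{x_j})\,dx$, the integral being understood as the $BMO$–$H^1$ duality pairing, i.e. as the limit as $N\to\infty$ of the integrals with $b_{ij}$ replaced by its truncation $\max(-N,\min(N,b_{ij}))$; this is the Lebesgue integral whenever each product $b_{ij}(u_{x_j}\varphi_{x_i}-u_{x_i}\varphi_{x_j})$ is integrable. Then, for every ball $B_R=B_R(x_0)$ with $R>0$ and $\overline{B_{2R}(x_0)}\subset\Omega$, $$\operatorname*{ess\,sup}_{B_R}u\le C\,\operatorname*{ess\,inf}_{B_R}u ,$$ and in particular $u$ is essentially bounded on $B_R$. -/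

import Mathlib

open MeasureTheory Filter Topology
open scoped ENNReal ContDiff

namespace BMOElliptic

/-- Real Euclidean space of dimension `n`. -/
abbrev Eu (n : ℕ) : Type := EuclideanSpace ℝ (Fin n)

/-- The closed cube with sides parallel to the axes, lower corner `c` and side length `l`. -/
def cube {n : ℕ} (c : Eu n) (l : ℝ) : Set (Eu n) :=
  {x | ∀ i, x i ∈ Set.Icc (c i) (c i + l)}

/-- The `BMO(Ω)` seminorm: the supremum, over the closed cubes `Q ⊆ Ω` with sides parallel to
the axes, of the mean over `Q` of `|f - (f)_Q|`. -/
noncomputable def bmoSeminorm {n : ℕ} (Ω : Set (Eu n)) (f : Eu n → ℝ) : ℝ≥0∞ :=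
  ⨆ (c : Eu n) (l : ℝ) (_ : 0 < l) (_ : cube c l ⊆ Ω),
    ⨍⁻ x in cube c l, ‖f x - ⨍ y in cube c l, f y ∂volume‖ₑ ∂volume

/-- `g` is the weak (distributional) gradient of `u` in `Ω`. -/
def IsWeakGradient {n : ℕ} (Ω : Set (Eu n)) (u : Eu n → ℝ) (g : Eu n → Eu n) : Prop :=
  LocallyIntegrableOn u Ω ∧ LocallyIntegrableOn g Ω ∧
    ∀ (i : Fin n) (φ : Eu n → ℝ), ContDiff ℝ ∞ φ → HasCompactSupport φ → tsupport φ ⊆ Ω →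
      ∫ x in Ω, u x * fderiv ℝ φ x (EuclideanSpace.single i 1) = -∫ x in Ω, g x i * φ x

/-- `u` belongs to `W^{1,2}(Ω)`, with weak gradient `g`. -/
def MemW12 {n : ℕ} (Ω : Set (Eu n)) (u : Eu n → ℝ) (g : Eu n → Eu n) : Prop :=
  IsWeakGradient Ω u g ∧ MemLp u 2 (volume.restrict Ω) ∧ MemLp g 2 (volume.restrict Ω)

/-- `u` belongs to `W^{1,2}_loc(Ω)`, with weak gradient `g`. -/
def MemW12loc {n : ℕ} (Ω : Set (Eu n)) (u : Eu n → ℝ) (g : Eu n → Eu n) : Prop :=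
  IsWeakGradient Ω u g ∧
    ∀ K : Set (Eu n), IsCompact K → K ⊆ Ω →
      MemLp u 2 (volume.restrict K) ∧ MemLp g 2 (volume.restrict K)

/-- The (essential) support of `φ` is a compact subset of `Ω`. -/
def CompactlySupportedIn {n : ℕ} (Ω : Set (Eu n)) (φ : Eu n → ℝ) : Prop :=
  ∃ K : Set (Eu n), IsCompact K ∧ K ⊆ Ω ∧ ∀ᵐ x ∂(volume.restrict Ω), x ∉ K → φ x = 0

/-- `(M p) · q`. -/
def matForm {n : ℕ} (M : Matrix (Fin n) (Fin n) ℝ) (p q : Eu n) : ℝ :=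
  ∑ i, ∑ j, M i j * p j * q i

/-- The skew-symmetrised form `½ ∑ M_ij (p_j q_i - p_i q_j)`. -/
noncomputable def skewForm {n : ℕ} (M : Matrix (Fin n) (Fin n) ℝ) (p q : Eu n) : ℝ :=
  (1 / 2) * ∑ i, ∑ j, M i j * (p j * q i - p i * q j)

/-- Truncation of the entries of a matrix at heights `-N` and `N`. -/
noncomputable def truncMat {n : ℕ} (N : ℕ) (M : Matrix (Fin n) (Fin n) ℝ) :
    Matrix (Fin n) (Fin n) ℝ :=
  fun i j => max (-(N : ℝ)) (min (N : ℝ) (M i j))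

/-- `ℓ` is the value of `∫_Ω b∇u·∇φ = ½ ∫_Ω b_ij (u_{x_j} φ_{x_i} - u_{x_i} φ_{x_j})`,
where `p = ∇u`, `q = ∇φ`. For `b` in `BMO` the integrand need not be absolutely integrable, and
the integral is the duality pairing of `b` in `BMO` with `u_{x_j} φ_{x_i} - u_{x_i} φ_{x_j}` in
the Hardy space `H¹`; its value is the limit of the (absolutely convergent) integrals with
truncated coefficients, which is the Lebesgue integral whenever each product
`b_ij (u_{x_j} φ_{x_i} - u_{x_i} φ_{x_j})` is absolutely integrable. -/
def HasSkewIntegral {n : ℕ} (Ω : Set (Eu n)) (b : Eu n → Matrix (Fin n) (Fin n) ℝ)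
    (p q : Eu n → Eu n) (ℓ : ℝ) : Prop :=
  Tendsto (fun N : ℕ => ∫ x in Ω, skewForm (truncMat N (b x)) (p x) (q x)) atTop (𝓝 ℓ)

/-- The coefficients `A = a + b` on `Ω`: `a` symmetric, measurable, bounded by `Lam` and
elliptic with constant `lam`; `b` anti-symmetric with entries in `BMO(Ω)`, of seminorm at
most `Gam`. -/
structure IsCoefficient {n : ℕ} (Ω : Set (Eu n)) (lam Lam Gam : ℝ)
    (a b : Eu n → Matrix (Fin n) (Fin n) ℝ) : Prop where
  a_meas : ∀ i j, AEMeasurable (fun x => a x i j) (volume.restrict Ω)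
  a_symm : ∀ᵐ x ∂(volume.restrict Ω), ∀ i j, a x j i = a x i j
  a_bound : ∀ i j, ∀ᵐ x ∂(volume.restrict Ω), |a x i j| ≤ Lam
  a_elliptic : ∀ᵐ x ∂(volume.restrict Ω), ∀ ξ : Eu n, lam * ‖ξ‖ ^ 2 ≤ matForm (a x) ξ ξ
  b_skew : ∀ᵐ x ∂(volume.restrict Ω), ∀ i j, b x j i = -b x i j
  b_loc : ∀ i j, LocallyIntegrableOn (fun x => b x i j) Ω
  b_bmo : ∀ i j, bmoSeminorm Ω (fun x => b x i j) ≤ ENNReal.ofReal Gam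

/-- `u` in `W^{1,2}_loc(Ω)` is a weak solution of `-div((a + b)∇u) = 0` in `Ω`:
`∫ a∇u·∇φ + ∫ b∇u·∇φ = 0` for every `φ` in `W^{1,2}(Ω)` with compact support in `Ω`. -/
def IsWeakSolution {n : ℕ} (Ω : Set (Eu n)) (a b : Eu n → Matrix (Fin n) (Fin n) ℝ)
    (u : Eu n → ℝ) : Prop :=
  ∃ Du : Eu n → Eu n, MemW12loc Ω u Du ∧
    ∀ (φ : Eu n → ℝ) (Dφ : Eu n → Eu n), MemW12 Ω φ Dφ → CompactlySupportedIn Ω φ →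
      ∃ ℓ : ℝ, HasSkewIntegral Ω b Du Dφ ℓ ∧
        (∫ x in Ω, matForm (a x) (Du x) (Dφ x)) + ℓ = 0

end BMOElliptic

/-! The proof is Moser's, arranged so that the unbounded part `b` enters only as a weight lying in
every `L^p`. The equation is tested with `φ = η² G(u)`, where `η` is a cutoff and `G' = h²`. Then
`∇φ = η² h(u)² ∇u + G(u) ∇(η²)`. The first term pairs to zero with `∇u` in the skew form, and
ellipticity of `a` makes it control `‖η h(u) ∇u‖²`. In the second term any constant matrix `c` may
be subtracted from `b`, because `∇u` and `∇φ` are curl-free and the pairing with constant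
coefficients vanishes. Truncation is 1-Lipschitz, so the bound by `|b - c| |∇u| |G(u) ∇(η²)|` is
uniform in the truncation height and passes to the limit defining the duality pairing. This is
`enorm_skewIntegral_le`, and it leads to `IsCoefficient.caccioppoli`: the right side carries the
weight `oscWeight`, a constant plus the entries of `|b - c|`.

With `c` the mean of `b` over a cube, John–Nirenberg (`CubeBMO.lintegral_exp_le`) puts the weight in
every `L^p` with a norm depending only on `Γ`, `Λ`, `n`, `p` and the volume of the cube. Hölder with
exponent `2n` therefore replaces `L²` on the right by `L^{2n/(n-1)}`, which is still below the
Sobolev exponent `2n/(n-2)`. For `h` a multiple of `(t+ε)^(γ-1)` this is a reverse Hölder inequality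
for `(u+ε)^γ`, valid for both signs of `γ` as long as `γ ≠ 0` and `γ ≠ 1/2`. Iterating it
(`exists_moser_const`, `exists_local_bound`) bounds small positive and negative powers of `u+ε` on a
ball by their averages on a larger one.

The two families of averages are linked by the logarithm. For `h = 1/(t+ε)` the factor `(u+ε) h(u)`
is `1`, so Caccioppoli bounds `∇ log(u+ε)` without reference to `u`; Poincaré turns this into a
bound on mean oscillations, and a second use of John–Nirenberg bounds the averages of `(u+ε)^p` and
`(u+ε)^(-p)` by `3 e^{pm}` and `3 e^{-pm}` with the same `m`. In the product `m` cancels, and `ε →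
0` gives Harnack on balls small compared with the distance to the boundary (`exists_local_harnack`).
Overlapping balls along segments carry the inequality to `B_R`. -/

namespace BMOElliptic

/-! ### The John–Nirenberg inequality on cubes. -/

/-- The half-open cube with lower corner `c` and side length `l`. -/
def icoCube {n : ℕ} (c : Fin n → ℝ) (l : ℝ) : Set (Fin n → ℝ) :=
  Set.pi Set.univ fun i => Set.Ico (c i) (c i + l)

/-- The lower corners of the `2 ^ n` dyadic children of a cube. -/
noncomputable def childCorner {n : ℕ} (c : Fin n → ℝ) (l : ℝ) (e : Fin n → Bool) : Fin n → ℝ :=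
  fun i => c i + if e i then l / 2 else 0

theorem measurableSet_icoCube {n : ℕ} (c : Fin n → ℝ) (l : ℝ) : MeasurableSet (icoCube c l) :=
  MeasurableSet.univ_pi fun _ => measurableSet_Ico

theorem volume_icoCube {n : ℕ} (c : Fin n → ℝ) {l : ℝ} (hl : 0 ≤ l) :
    volume (icoCube c l) = ENNReal.ofReal (l ^ n) := by
  rw [icoCube, Real.volume_pi_Ico]
  simp [ENNReal.ofReal_pow hl]

theorem volume_real_icoCube {n : ℕ} (c : Fin n → ℝ) {l : ℝ} (hl : 0 ≤ l) :
    volume.real (icoCube c l) = l ^ n := by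
  rw [measureReal_def, volume_icoCube c hl, ENNReal.toReal_ofReal (by positivity)]

theorem icoCube_child_subset {n : ℕ} (c : Fin n → ℝ) {l : ℝ} (hl : 0 < l) (e : Fin n → Bool) :
    icoCube (childCorner c l e) (l / 2) ⊆ icoCube c l := by
  intro x hx i hi
  have := hx i hi
  simp only [childCorner, Set.mem_Ico] at this ⊢
  split_ifs at this <;> constructor <;> linarith

theorem iUnion_icoCube_child {n : ℕ} (c : Fin n → ℝ) {l : ℝ} (hl : 0 < l) :
    ⋃ e, icoCube (childCorner c l e) (l / 2) = icoCube c l := by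
  apply Set.Subset.antisymm (Set.iUnion_subset fun e => icoCube_child_subset c hl e)
  intro x hx
  refine Set.mem_iUnion.2 ⟨fun i => decide (c i + l / 2 ≤ x i), fun i hi => ?_⟩
  have := hx i hi
  simp only [childCorner, Set.mem_Ico, decide_eq_true_eq] at this ⊢
  split_ifs with h <;> constructor <;> linarith

theorem pairwise_disjoint_icoCube_child {n : ℕ} (c : Fin n → ℝ) (l : ℝ) :
    Pairwise (Function.onFun Disjoint fun e => icoCube (childCorner c l e) (l / 2)) := by
  intro e e' hne
  rw [Function.onFun, Set.disjoint_left]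
  intro x hx hx'
  apply hne
  ext1 i
  have h1 := hx i trivial
  have h2 := hx' i trivial
  simp only [childCorner, Set.mem_Ico] at h1 h2
  cases h : e i <;> cases h' : e' i <;> simp_all <;> linarith

theorem integral_icoCube_eq_sum {n : ℕ} (c : Fin n → ℝ) {l : ℝ} (hl : 0 < l)
    {g : (Fin n → ℝ) → ℝ} (hg : IntegrableOn g (icoCube c l)) :
    ∫ x in icoCube c l, g x = ∑ e, ∫ x in icoCube (childCorner c l e) (l / 2), g x := by
  rw [← iUnion_icoCube_child c hl]
  exact integral_iUnion_fintype (fun e => measurableSet_icoCube _ _)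
    (pairwise_disjoint_icoCube_child c l)
    fun e => hg.mono_set (icoCube_child_subset c hl e)

theorem lintegral_icoCube_eq_sum {n : ℕ} (c : Fin n → ℝ) {l : ℝ} (hl : 0 < l)
    (g : (Fin n → ℝ) → ℝ≥0∞) :
    ∫⁻ x in icoCube c l, g x = ∑ e, ∫⁻ x in icoCube (childCorner c l e) (l / 2), g x := by
  rw [← iUnion_icoCube_child c hl, lintegral_iUnion (fun e => measurableSet_icoCube _ _)
    (pairwise_disjoint_icoCube_child c l), tsum_fintype]

theorem sum_child_volume (n : ℕ) (l : ℝ) :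
    ∑ _e : Fin n → Bool, (l / 2) ^ n = l ^ n := by
  simp [div_pow]
  field_simp

/-- The mean of `f` over a half-open cube. -/
noncomputable def cubeMean {n : ℕ} (f : (Fin n → ℝ) → ℝ) (c : Fin n → ℝ) (l : ℝ) : ℝ :=
  ⨍ x in icoCube c l, f x

/-- Jensen's inequality, kept in product form because it also serves as Chebyshev: a cube whose mean
is far from `a` has volume controlled by the integral of `|f - a|` over it. -/
theorem abs_cubeMean_sub_mul_le {n : ℕ} {f : (Fin n → ℝ) → ℝ} {c : Fin n → ℝ} {l : ℝ} (hl : 0 < l)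
    (hf : IntegrableOn f (icoCube c l)) (a : ℝ) :
    |cubeMean f c l - a| * l ^ n ≤ ∫ x in icoCube c l, |f x - a| := by
  have hc : IntegrableOn (fun _ => a) (icoCube c l) := by
    refine integrableOn_const ?_ enorm_ne_top
    rw [volume_icoCube c hl.le]; exact ENNReal.ofReal_ne_top
  have h1 : (cubeMean f c l - a) * l ^ n = ∫ x in icoCube c l, (f x - a) := by
    rw [integral_sub hf hc, cubeMean, setAverage_eq, setIntegral_const,
      volume_real_icoCube c hl.le]
    simp only [smul_eq_mul]
    field_simp
  have h2 : |cubeMean f c l - a| * l ^ n = |(cubeMean f c l - a) * l ^ n| := by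
    rw [abs_mul, abs_of_pos (pow_pos hl n)]
  rw [h2, h1]
  exact abs_integral_le_integral_abs

/-- The integral over a cube of `exp (θ |E - a|)`, `E` the dyadic conditional expectation of `f`
at depth `k`. -/
noncomputable def dyadicExp {n : ℕ} (f : (Fin n → ℝ) → ℝ) (θ : ℝ) :
    ℕ → (Fin n → ℝ) → ℝ → ℝ → ℝ
  | 0, c, l, a => Real.exp (θ * |cubeMean f c l - a|) * l ^ n
  | k + 1, c, l, a => ∑ e, dyadicExp f θ k (childCorner c l e) (l / 2) a

theorem dyadicExp_le_mul {n : ℕ} (f : (Fin n → ℝ) → ℝ) {θ : ℝ} (hθ : 0 ≤ θ) (a b : ℝ) (k : ℕ) :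
    ∀ (c : Fin n → ℝ) (l : ℝ), 0 < l →
      dyadicExp f θ k c l a ≤ Real.exp (θ * |b - a|) * dyadicExp f θ k c l b := by
  induction k with
  | zero =>
    intro c l hl
    simp only [dyadicExp]
    rw [← mul_assoc, ← Real.exp_add, ← mul_add]
    gcongr
    rw [add_comm]
    exact abs_sub_le _ _ _
  | succ k ih =>
    intro c l hl
    simp only [dyadicExp]
    rw [Finset.mul_sum]
    exact Finset.sum_le_sum fun e _ => ih _ _ (by linarith)

/-- `f` has mean oscillation at most `A` on all half-open subcubes of `Q`. -/
def CubeBMO {n : ℕ} (f : (Fin n → ℝ) → ℝ) (Q : Set (Fin n → ℝ)) (A : ℝ) : Prop :=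
  ∀ (c : Fin n → ℝ) (l : ℝ), 0 < l → icoCube c l ⊆ Q →
    ∫ x in icoCube c l, |f x - cubeMean f c l| ≤ A * l ^ n

theorem integrableOn_abs_sub {n : ℕ} {f : (Fin n → ℝ) → ℝ} {c : Fin n → ℝ} {l : ℝ} (hl : 0 < l)
    (hf : IntegrableOn f (icoCube c l)) (a : ℝ) :
    IntegrableOn (fun x => |f x - a|) (icoCube c l) := by
  have hc : IntegrableOn (fun _ => a) (icoCube c l) := by
    refine integrableOn_const ?_ enorm_ne_top
    rw [volume_icoCube c hl.le]; exact ENNReal.ofReal_ne_top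
  exact (Integrable.sub hf hc).abs

/-- A child has the fraction `2^{-n}` of the volume of its parent, so passing to it can enlarge the
mean oscillation about the parent mean by at most `2 ^ n`. -/
theorem CubeBMO.abs_child_mean_sub_le {n : ℕ} {f : (Fin n → ℝ) → ℝ} {Q : Set (Fin n → ℝ)} {A : ℝ}
    (h : CubeBMO f Q A) (hf : IntegrableOn f Q) {c : Fin n → ℝ} {l : ℝ} (hl : 0 < l)
    (hc : icoCube c l ⊆ Q) (e : Fin n → Bool) :
    |cubeMean f (childCorner c l e) (l / 2) - cubeMean f c l| ≤ 2 ^ n * A := by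
  have hsub := icoCube_child_subset c hl e
  have h1 := abs_cubeMean_sub_mul_le (half_pos hl) (hf.mono_set (hsub.trans hc)) (cubeMean f c l)
  have h2 : ∫ x in icoCube (childCorner c l e) (l / 2), |f x - cubeMean f c l| ≤
      ∫ x in icoCube c l, |f x - cubeMean f c l| :=
    setIntegral_mono_set (integrableOn_abs_sub hl (hf.mono_set hc) _)
      (Eventually.of_forall fun x => abs_nonneg _) hsub.eventuallyLE
  have h3 := (h1.trans h2).trans (h c l hl hc)
  have h4 : A * l ^ n = 2 ^ n * A * (l / 2) ^ n := by
    rw [div_pow]; field_simp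
  rw [h4] at h3
  exact le_of_mul_le_mul_right h3 (by positivity)

/-- A stopping-time argument written as a recursion. One descends as long as the means stay within
`lam` of `a`. At the first child that leaves this range the mean has jumped by at most `2 ^ n * A`,
so recentring there costs a bounded factor, and `hK` bounds what lies below. The stopped cubes are
disjoint, with total volume at most `1 / lam` times the integral of `|f - a|`. Both terms of the
bound are additive over children, which closes the induction without listing the stopped cubes. -/
theorem CubeBMO.dyadicExp_le_aux {n : ℕ} {f : (Fin n → ℝ) → ℝ} {Q : Set (Fin n → ℝ)} {A : ℝ}
    (h : CubeBMO f Q A) (hf : IntegrableOn f Q) {θ lam : ℝ} (hθ : 0 ≤ θ) (hlam : 0 < lam) (K : ℕ)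
    (hK : ∀ j < K, ∀ (c : Fin n → ℝ) (l : ℝ), 0 < l → icoCube c l ⊆ Q →
      dyadicExp f θ j c l (cubeMean f c l) ≤ 3 * l ^ n) (k : ℕ) (hk : k ≤ K) :
    ∀ (c : Fin n → ℝ) (l a : ℝ), 0 < l → icoCube c l ⊆ Q → |cubeMean f c l - a| ≤ lam →
      dyadicExp f θ k c l a ≤ Real.exp (θ * lam) * l ^ n +
        3 * Real.exp (θ * (lam + 2 ^ n * A)) / lam * ∫ x in icoCube c l, |f x - a| := by
  induction k with
  | zero =>
    intro c l a hl hc ha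
    have h0 : 0 ≤ ∫ x in icoCube c l, |f x - a| := integral_nonneg fun x => abs_nonneg _
    have h1 : Real.exp (θ * |cubeMean f c l - a|) * l ^ n ≤ Real.exp (θ * lam) * l ^ n := by
      gcongr
    simp only [dyadicExp]
    have : 0 ≤ 3 * Real.exp (θ * (lam + 2 ^ n * A)) / lam * ∫ x in icoCube c l, |f x - a| := by
      positivity
    linarith
  | succ k ih =>
    intro c l a hl hc ha
    have hint := integrableOn_abs_sub hl (hf.mono_set hc) a
    rw [integral_icoCube_eq_sum c hl hint, ← sum_child_volume n l, Finset.mul_sum, Finset.mul_sum,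
      ← Finset.sum_add_distrib]
    simp only [dyadicExp]
    refine Finset.sum_le_sum fun e _ => ?_
    have hc' := (icoCube_child_subset c hl e).trans hc
    have hl' := half_pos hl
    by_cases hcase : |cubeMean f (childCorner c l e) (l / 2) - a| ≤ lam
    · exact ih (by omega) _ _ _ hl' hc' hcase
    · push Not at hcase
      set m' := cubeMean f (childCorner c l e) (l / 2)
      have h1 : |m' - a| ≤ lam + 2 ^ n * A := by
        have := h.abs_child_mean_sub_le hf hl hc e
        have := abs_sub_le m' (cubeMean f c l) a
        linarith
      have h2 := dyadicExp_le_mul f hθ a m' k (childCorner c l e) (l / 2) hl'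
      have h3 := hK k (by omega) _ _ hl' hc'
      have h4 := abs_cubeMean_sub_mul_le hl' (hf.mono_set hc') a
      -- Chebyshev: a stopped cube pays for its own volume.
      have h5 : (l / 2) ^ n ≤ (∫ x in icoCube (childCorner c l e) (l / 2), |f x - a|) / lam := by
        rw [le_div_iff₀ hlam, mul_comm]
        exact le_trans (by gcongr) h4
      calc dyadicExp f θ k (childCorner c l e) (l / 2) a
          ≤ Real.exp (θ * (lam + 2 ^ n * A)) * (3 * ((∫ x in icoCube (childCorner c l e) (l / 2),
              |f x - a|) / lam)) := by
            refine h2.trans (mul_le_mul (by gcongr) (h3.trans (by gcongr)) ?_ (by positivity))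
            have : 0 ≤ Real.exp (θ * |m' - a|) * dyadicExp f θ k (childCorner c l e) (l / 2) m' := by
              refine le_trans ?_ h2
              clear * - hl'
              generalize childCorner c l e = c at *
              generalize l / 2 = l at *
              induction k generalizing c l with
              | zero => simp only [dyadicExp]; positivity
              | succ k ih => exact Finset.sum_nonneg fun e _ => ih _ _ (by linarith)
            exact nonneg_of_mul_nonneg_right this (Real.exp_pos _)
        _ ≤ _ := by
            have : 0 ≤ Real.exp (θ * lam) * (l / 2) ^ n := by positivity
            have h6 : Real.exp (θ * (lam + 2 ^ n * A)) * (3 * ((∫ x in icoCube (childCorner c l e)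
              (l / 2), |f x - a|) / lam)) = 3 * Real.exp (θ * (lam + 2 ^ n * A)) / lam *
              ∫ x in icoCube (childCorner c l e) (l / 2), |f x - a| := by ring
            linarith

/-- The exponent of the John–Nirenberg inequality. -/
noncomputable def jnExponent (n : ℕ) (A : ℝ) : ℝ := 1 / (3 * (4 + 2 ^ n) * A)

theorem jnExponent_pos (n : ℕ) {A : ℝ} (hA : 0 < A) : 0 < jnExponent n A := by
  unfold jnExponent; positivity

/-- Strong induction on the depth works because a stopped cube restarts the same problem at a
strictly smaller depth. The bound is uniform in `k`, so no a priori integrability of the exponential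
is needed. -/
theorem CubeBMO.dyadicExp_le {n : ℕ} {f : (Fin n → ℝ) → ℝ} {Q : Set (Fin n → ℝ)} {A : ℝ}
    (h : CubeBMO f Q A) (hA : 0 < A) (hf : IntegrableOn f Q) (k : ℕ) :
    ∀ (c : Fin n → ℝ) (l : ℝ), 0 < l → icoCube c l ⊆ Q →
      dyadicExp f (jnExponent n A) k c l (cubeMean f c l) ≤ 3 * l ^ n := by
  induction k using Nat.strong_induction_on with
  | _ k ih =>
    intro c l hl hc
    have hexp : Real.exp (1 / 3) ≤ 3 / 2 := by
      have h1 : Real.exp (1 / 3) ^ 3 ≤ (3 / 2) ^ 3 := by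
        rw [← Real.exp_nat_mul]
        norm_num
        have := Real.exp_one_lt_d9
        linarith
      exact le_of_pow_le_pow_left₀ (by norm_num) (by norm_num) h1
    have he2 : jnExponent n A * (4 * A + 2 ^ n * A) = 1 / 3 := by
      unfold jnExponent
      have : (4 + 2 ^ n : ℝ) ≠ 0 := by positivity
      field_simp
    have he1 : jnExponent n A * (4 * A) ≤ 1 / 3 := by
      rw [← he2]
      have := jnExponent_pos n hA
      gcongr
      have : 0 ≤ 2 ^ n * A := by positivity
      linarith
    -- Stopping at height `4 * A` makes the stopped volume at most a quarter of the cube. With both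
    -- exponentials at most `3 / 2` the total is `3 / 2 + 9 / 8 ≤ 3`, so the constant `3` reproduces
    -- itself.
    have := h.dyadicExp_le_aux hf (jnExponent_pos n hA).le (lam := 4 * A) (by positivity) k ih k
      le_rfl c l (cubeMean f c l) hl hc (by simp; positivity)
    refine this.trans ?_
    rw [he2]
    have hosc := h c l hl hc
    have h1 : Real.exp (jnExponent n A * (4 * A)) ≤ 3 / 2 := (Real.exp_le_exp.2 he1).trans hexp
    have hln : 0 < l ^ n := by positivity
    have h0 : 0 ≤ ∫ x in icoCube c l, |f x - cubeMean f c l| := integral_nonneg fun x => abs_nonneg _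
    calc _ ≤ 3 / 2 * l ^ n + 3 * (3 / 2) / (4 * A) * (A * l ^ n) := by gcongr
      _ ≤ 3 * l ^ n := by
        have : 3 * (3 / 2) / (4 * A) * (A * l ^ n) = 9 / 8 * l ^ n := by field_simp; norm_num
        rw [this]; linarith

/-- The dyadic conditional expectation of `f` on a cube at depth `k`. -/
noncomputable def dyadicMean {n : ℕ} (f : (Fin n → ℝ) → ℝ) :
    ℕ → (Fin n → ℝ) → ℝ → (Fin n → ℝ) → ℝ
  | 0, c, l, _ => cubeMean f c l
  | k + 1, c, l, x => ∑ e, (icoCube (childCorner c l e) (l / 2)).indicator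
      (dyadicMean f k (childCorner c l e) (l / 2)) x

theorem measurable_dyadicMean {n : ℕ} (f : (Fin n → ℝ) → ℝ) (k : ℕ) :
    ∀ (c : Fin n → ℝ) (l : ℝ), Measurable (dyadicMean f k c l) := by
  induction k with
  | zero => intro c l; exact measurable_const
  | succ k ih =>
    intro c l
    exact Finset.measurable_fun_sum _ fun e _ => (ih _ _).indicator (measurableSet_icoCube _ _)

theorem dyadicMean_succ_of_mem {n : ℕ} (f : (Fin n → ℝ) → ℝ) (k : ℕ) {c : Fin n → ℝ} {l : ℝ}
    {e : Fin n → Bool} {x : Fin n → ℝ} (hx : x ∈ icoCube (childCorner c l e) (l / 2)) :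
    dyadicMean f (k + 1) c l x = dyadicMean f k (childCorner c l e) (l / 2) x := by
  simp only [dyadicMean]
  rw [Finset.sum_eq_single e]
  · rw [Set.indicator_of_mem hx]
  · intro e' _ hne
    exact Set.indicator_of_notMem
      (Set.disjoint_left.1 (pairwise_disjoint_icoCube_child c l hne.symm) hx) _
  · simp

theorem lintegral_exp_dyadicMean {n : ℕ} (f : (Fin n → ℝ) → ℝ) (θ a : ℝ) (k : ℕ) :
    ∀ (c : Fin n → ℝ) (l : ℝ), 0 < l →
      ∫⁻ x in icoCube c l, ENNReal.ofReal (Real.exp (θ * |dyadicMean f k c l x - a|)) =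
        ENNReal.ofReal (dyadicExp f θ k c l a) := by
  induction k with
  | zero =>
    intro c l hl
    simp only [dyadicMean, dyadicExp]
    rw [setLIntegral_const, volume_icoCube c hl.le, ← ENNReal.ofReal_mul (Real.exp_pos _).le]
  | succ k ih =>
    intro c l hl
    have hnn : ∀ k c l, 0 < l → 0 ≤ dyadicExp f θ k c l a := by
      intro k
      induction k with
      | zero => intro c l hl; simp only [dyadicExp]; positivity
      | succ k ih => intro c l hl; exact Finset.sum_nonneg fun e _ => ih _ _ (by linarith)
    rw [lintegral_icoCube_eq_sum c hl]
    simp only [dyadicExp]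
    rw [ENNReal.ofReal_sum_of_nonneg fun e _ => hnn _ _ _ (half_pos hl)]
    refine Finset.sum_congr rfl fun e _ => ?_
    rw [← ih _ _ (half_pos hl)]
    refine setLIntegral_congr_fun (measurableSet_icoCube _ _) fun x hx => ?_
    simp only [dyadicMean_succ_of_mem f k hx]

theorem exists_dyadicMean_eq {n : ℕ} (f : (Fin n → ℝ) → ℝ) (k : ℕ) :
    ∀ (c : Fin n → ℝ) (l : ℝ) (x : Fin n → ℝ), 0 < l → x ∈ icoCube c l →
      ∃ c', x ∈ icoCube c' (l / 2 ^ k) ∧ dyadicMean f k c l x = cubeMean f c' (l / 2 ^ k) := by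
  induction k with
  | zero => intro c l x hl hx; exact ⟨c, by simpa using hx, by simp [dyadicMean]⟩
  | succ k ih =>
    intro c l x hl hx
    rw [← iUnion_icoCube_child c hl] at hx
    obtain ⟨e, he⟩ := Set.mem_iUnion.1 hx
    obtain ⟨c', h1, h2⟩ := ih _ _ x (half_pos hl) he
    refine ⟨c', ?_, ?_⟩
    · rwa [div_div, ← pow_succ'] at h1
    · rw [dyadicMean_succ_of_mem f k he, h2, div_div, ← pow_succ']

theorem icoCube_ae_eq_closedBall {n : ℕ} (c : Fin n → ℝ) {l : ℝ} (hl : 0 ≤ l) :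
    icoCube c l =ᵐ[volume] Metric.closedBall (fun i => c i + l / 2) (l / 2) := by
  have h : Metric.closedBall (fun i => c i + l / 2) (l / 2) = Set.Icc c (fun i => c i + l) := by
    rw [closedBall_pi _ (by positivity), ← Set.pi_univ_Icc]
    congr 1
    ext1 i
    rw [Real.closedBall_eq_Icc]
    congr 1 <;> ring
  rw [h]
  exact Measure.univ_pi_Ico_ae_eq_Icc

/-- In the sup norm of `Fin n → ℝ` the dyadic cubes containing `x` are, up to null sets, closed
balls of radius tending to zero, so Lebesgue differentiation for doubling measures applies even
though `x` is not their centre. -/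
theorem ae_tendsto_dyadicMean {n : ℕ} {f : (Fin n → ℝ) → ℝ} {c : Fin n → ℝ} {l : ℝ} (hl : 0 < l)
    (hf : LocallyIntegrable f) :
    ∀ᵐ x ∂(volume.restrict (icoCube c l)),
      Tendsto (fun k => dyadicMean f k c l x) atTop (𝓝 (f x)) := by
  rw [ae_restrict_iff' (measurableSet_icoCube _ _)]
  filter_upwards [IsUnifLocDoublingMeasure.ae_tendsto_average volume hf 1] with x hx hxc
  choose w hw1 hw2 using fun k => exists_dyadicMean_eq f k c l x hl hxc
  have hpos : ∀ k : ℕ, 0 < l / 2 ^ k := fun k => by positivity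
  have hlim : Tendsto (fun k : ℕ => l / 2 ^ k / 2) atTop (𝓝[>] 0) := by
    rw [tendsto_nhdsWithin_iff]
    refine ⟨?_, Eventually.of_forall fun k => half_pos (hpos k)⟩
    have : Tendsto (fun k : ℕ => l / 2 * (1 / 2 : ℝ) ^ k) atTop (𝓝 (l / 2 * 0)) :=
      (tendsto_pow_atTop_nhds_zero_of_lt_one (by norm_num) (by norm_num)).const_mul _
    rw [mul_zero] at this
    refine this.congr fun k => ?_
    rw [one_div, inv_pow]; ring
  have := hx (fun k i => w k i + l / 2 ^ k / 2) (fun k => l / 2 ^ k / 2) hlim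
    (Eventually.of_forall fun k => by
      rw [one_mul, closedBall_pi _ (half_pos (hpos k)).le]
      intro i hi
      have := hw1 k i hi
      simp only [Real.closedBall_eq_Icc]
      constructor <;> linarith [this.1, this.2])
  refine this.congr fun k => ?_
  rw [hw2 k, cubeMean, setAverage_congr (icoCube_ae_eq_closedBall (w k) (hpos k).le)]

/-- The **John–Nirenberg inequality** on a half-open cube. -/
theorem CubeBMO.lintegral_exp_le {n : ℕ} {f : (Fin n → ℝ) → ℝ} {c : Fin n → ℝ} {l A : ℝ}
    (hl : 0 < l) (h : CubeBMO f (icoCube c l) A) (hA : 0 < A)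
    (hf : IntegrableOn f (icoCube c l)) :
    ∫⁻ x in icoCube c l, ENNReal.ofReal (Real.exp (jnExponent n A * |f x - cubeMean f c l|)) ≤
      ENNReal.ofReal (3 * l ^ n) := by
  set θ := jnExponent n A
  set a := cubeMean f c l
  -- Lebesgue differentiation asks for local integrability on the whole space, hence the extension
  -- by zero; the dyadic means inside the cube do not change. Fatou then passes from finite depth to
  -- `f`.
  set F : (Fin n → ℝ) → ℝ := (icoCube c l).indicator f
  have hF : LocallyIntegrable F :=
    ((integrable_indicator_iff (measurableSet_icoCube c l)).2 hf).locallyIntegrable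
  have hcong : ∀ k, ∀ x ∈ icoCube c l, dyadicMean F k c l x = dyadicMean f k c l x := by
    have key : ∀ k c' l', 0 < l' → icoCube c' l' ⊆ icoCube c l →
        dyadicMean F k c' l' = dyadicMean f k c' l' := by
      intro k
      induction k with
      | zero =>
        intro c' l' hl' hs
        ext x
        simp only [dyadicMean, cubeMean]
        exact setAverage_congr_fun (measurableSet_icoCube _ _)
          (Eventually.of_forall fun y hy => Set.indicator_of_mem (hs hy) f)
      | succ k ih =>
        intro c' l' hl' hs
        ext x
        simp only [dyadicMean]
        refine Finset.sum_congr rfl fun e _ => ?_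
        rw [ih _ _ (half_pos hl') ((icoCube_child_subset _ hl' e).trans hs)]
    intro k x _
    rw [key k c l hl subset_rfl]
  have hlim : ∀ᵐ x ∂(volume.restrict (icoCube c l)),
      ENNReal.ofReal (Real.exp (θ * |f x - a|)) =
        liminf (fun k => ENNReal.ofReal (Real.exp (θ * |dyadicMean f k c l x - a|))) atTop := by
    filter_upwards [ae_tendsto_dyadicMean hl hF, ae_restrict_mem (measurableSet_icoCube c l)]
      with x hx hxc
    have hx' : Tendsto (fun k => dyadicMean f k c l x) atTop (𝓝 (f x)) := by
      have : F x = f x := Set.indicator_of_mem hxc f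
      rw [this] at hx
      exact hx.congr fun k => hcong k x hxc
    refine (Tendsto.liminf_eq ?_).symm
    refine ENNReal.tendsto_ofReal ?_
    exact (Real.continuous_exp.tendsto _).comp (((hx'.sub_const a).abs).const_mul θ)
  rw [lintegral_congr_ae hlim]
  refine (lintegral_liminf_le fun k => ?_).trans ?_
  · have := measurable_dyadicMean f k c l
    fun_prop
  · refine (liminf_le_liminf (v := fun _ => ENNReal.ofReal (3 * l ^ n))
      (Eventually.of_forall fun k => ?_)).trans (by simp)
    rw [lintegral_exp_dyadicMean f θ a k c l hl]
    exact ENNReal.ofReal_le_ofReal (h.dyadicExp_le hA hf k c l hl subset_rfl)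

theorem cube_eq_preimage {n : ℕ} (c : Eu n) (l : ℝ) :
    cube c l = (@WithLp.ofLp 2 (Fin n → ℝ)) ⁻¹' Set.Icc c.ofLp (fun i => c i + l) := by
  ext x
  simp [cube, Pi.le_def, forall_and]

theorem measurableSet_cube {n : ℕ} (c : Eu n) (l : ℝ) : MeasurableSet (cube c l) := by
  rw [cube_eq_preimage]
  exact (PiLp.volume_preserving_ofLp (Fin n)).measurable measurableSet_Icc

theorem cube_ae_eq {n : ℕ} (c : Eu n) (l : ℝ) :
    cube c l =ᵐ[volume] (@WithLp.ofLp 2 (Fin n → ℝ)) ⁻¹' icoCube c.ofLp l := by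
  rw [cube_eq_preimage]
  exact (PiLp.volume_preserving_ofLp (Fin n)).quasiMeasurePreserving.preimage_ae_eq
    Measure.univ_pi_Ico_ae_eq_Icc.symm

theorem volume_cube {n : ℕ} (c : Eu n) {l : ℝ} (hl : 0 ≤ l) :
    volume (cube c l) = ENNReal.ofReal (l ^ n) := by
  rw [measure_congr (cube_ae_eq c l), (PiLp.volume_preserving_ofLp (Fin n)).measure_preimage
    (measurableSet_icoCube _ _).nullMeasurableSet, volume_icoCube _ hl]

theorem volume_real_cube {n : ℕ} (c : Eu n) {l : ℝ} (hl : 0 ≤ l) :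
    volume.real (cube c l) = l ^ n := by
  rw [measureReal_def, volume_cube c hl, ENNReal.toReal_ofReal (by positivity)]

theorem measurableEmbedding_ofLp (n : ℕ) :
    MeasurableEmbedding (@WithLp.ofLp 2 (Fin n → ℝ)) :=
  (MeasurableEquiv.toLp 2 (Fin n → ℝ)).symm.measurableEmbedding

theorem setIntegral_cube {n : ℕ} (c : Eu n) (l : ℝ) (g : Eu n → ℝ) :
    ∫ x in cube c l, g x = ∫ y in icoCube c.ofLp l, g (WithLp.toLp 2 y) := by
  rw [setIntegral_congr_set (cube_ae_eq c l)]
  exact (PiLp.volume_preserving_ofLp (Fin n)).setIntegral_preimage_emb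
    (measurableEmbedding_ofLp n) (fun y => g (WithLp.toLp 2 y)) _

theorem setLIntegral_cube {n : ℕ} (c : Eu n) (l : ℝ) (g : Eu n → ℝ≥0∞) :
    ∫⁻ x in cube c l, g x = ∫⁻ y in icoCube c.ofLp l, g (WithLp.toLp 2 y) := by
  rw [setLIntegral_congr (cube_ae_eq c l)]
  exact (PiLp.volume_preserving_ofLp (Fin n)).setLIntegral_comp_preimage_emb
    (measurableEmbedding_ofLp n) (fun y => g (WithLp.toLp 2 y)) _

theorem setAverage_cube {n : ℕ} (c : Eu n) {l : ℝ} (hl : 0 ≤ l) (g : Eu n → ℝ) :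
    ⨍ x in cube c l, g x = cubeMean (fun y => g (WithLp.toLp 2 y)) c.ofLp l := by
  rw [cubeMean, setAverage_eq, setAverage_eq, volume_real_cube c hl, volume_real_icoCube _ hl,
    setIntegral_cube]

theorem integrableOn_cube_iff {n : ℕ} (c : Eu n) (l : ℝ) (g : Eu n → ℝ) :
    IntegrableOn g (cube c l) ↔
      IntegrableOn (fun y => g (WithLp.toLp 2 y)) (icoCube c.ofLp l) := by
  rw [integrableOn_congr_set_ae (cube_ae_eq c l)]
  exact (PiLp.volume_preserving_ofLp (Fin n)).integrableOn_comp_preimage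
    (measurableEmbedding_ofLp n) (f := fun y => g (WithLp.toLp 2 y))

/-- Only the diagonal points `c' + t (1, …, 1)` with `0 ≤ t < l'` are used; letting `t` approach
`l'` gives the closed inequality. -/
theorem cube_subset_of_icoCube_subset {n : ℕ} {c c' : Fin n → ℝ} {l l' : ℝ} (hl' : 0 < l')
    (h : icoCube c' l' ⊆ icoCube c l) :
    cube (WithLp.toLp 2 c' : Eu n) l' ⊆ cube (WithLp.toLp 2 c : Eu n) l := by
  have key : ∀ t, 0 ≤ t → t < l' → ∀ i, c i ≤ c' i + t ∧ c' i + t < c i + l := fun t h0 h1 i =>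
    h (show (fun i => c' i + t) ∈ icoCube c' l' from
      fun j _ => ⟨by simp [h0], by simpa using h1⟩) i trivial
  intro x hx i
  have hxi := hx i
  simp only [Set.mem_Icc] at hxi ⊢
  refine ⟨by linarith [(key 0 le_rfl hl' i).1], ?_⟩
  have : c' i + l' ≤ c i + l := by
    by_contra! hcon
    have h2 := (key (max 0 (c i + l - c' i)) (le_max_left _ _)
      (max_lt hl' (by linarith)) i).2
    linarith [le_max_right 0 (c i + l - c' i)]
  linarith

/-- The **John–Nirenberg inequality** on a closed cube of Euclidean space. -/
theorem lintegral_exp_mul_abs_sub_le {n : ℕ} {f : Eu n → ℝ} {c : Eu n} {l A : ℝ} (hl : 0 < l)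
    (hA : 0 < A) (hf : IntegrableOn f (cube c l))
    (h : ∀ (c' : Eu n) (l' : ℝ), 0 < l' → cube c' l' ⊆ cube c l →
      ∫ x in cube c' l', |f x - ⨍ y in cube c' l', f y| ≤ A * l' ^ n) :
    ∫⁻ x in cube c l, ENNReal.ofReal (Real.exp (jnExponent n A * |f x - ⨍ y in cube c l, f y|)) ≤
      ENNReal.ofReal (3 * l ^ n) := by
  rw [setLIntegral_cube, setAverage_cube c hl.le]
  refine CubeBMO.lintegral_exp_le hl (fun c' l' hl' hs => ?_) hA ((integrableOn_cube_iff c l f).1 hf)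
  have := h (WithLp.toLp 2 c') l' hl' (cube_subset_of_icoCube_subset hl' hs)
  rwa [setIntegral_cube, setAverage_cube _ hl'.le] at this

end BMOElliptic

/-! ### Mollification and smooth approximation. -/

namespace BMOElliptic

open scoped Convolution

/-- A sequence of bump functions shrinking to the origin. -/
noncomputable def mollBump (n k : ℕ) : ContDiffBump (0 : Eu n) where
  rIn := 1 / (k + 1) / 2
  rOut := 1 / (k + 1)
  rIn_pos := by positivity
  rIn_lt_rOut := half_lt_self (by positivity)

/-- Mollification at scale `1 / (k + 1)`. -/
noncomputable def moll {n : ℕ} {F : Type*} [NormedAddCommGroup F] [NormedSpace ℝ F] (k : ℕ)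
    (f : Eu n → F) : Eu n → F :=
  (mollBump n k).normed volume ⋆[ContinuousLinearMap.lsmul ℝ ℝ, volume] f

variable {n : ℕ} {F : Type*} [NormedAddCommGroup F] [InnerProductSpace ℝ F]

theorem moll_apply (k : ℕ) (f : Eu n → F) (x : Eu n) :
    moll k f x = ∫ t, (mollBump n k).normed volume t • f (x - t) := rfl

theorem tendsto_rOut_mollBump (n : ℕ) : Tendsto (fun k => (mollBump n k).rOut) atTop (𝓝 0) :=
  tendsto_one_div_add_atTop_nhds_zero_nat

theorem ae_tendsto_moll [CompleteSpace F] {f : Eu n → F} (hf : LocallyIntegrable f) :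
    ∀ᵐ x, Tendsto (fun k => moll k f x) atTop (𝓝 (f x)) :=
  ContDiffBump.ae_convolution_tendsto_right_of_locallyIntegrable (K := 2)
    (tendsto_rOut_mollBump n)
    (Eventually.of_forall fun k => by simp only [mollBump]; linarith) hf

theorem lintegral_enorm_mollBump (n k : ℕ) :
    ∫⁻ t, ‖(mollBump n k).normed volume t‖ₑ = 1 := by
  have h1 := (mollBump n k).integral_normed (μ := volume)
  have h2 := ofReal_integral_eq_lintegral_ofReal ((mollBump n k).integrable_normed (μ := volume))
    (Eventually.of_forall (mollBump n k).nonneg_normed)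
  rw [h1, ENNReal.ofReal_one] at h2
  rw [h2]
  exact lintegral_congr fun t => Real.enorm_of_nonneg ((mollBump n k).nonneg_normed t)

theorem lintegral_sq_le_of_measure_univ_eq_one {α : Type*} [MeasurableSpace α] {ν : Measure α}
    (hν : ν Set.univ = 1) {g : α → ℝ≥0∞} (hg : AEMeasurable g ν) :
    (∫⁻ x, g x ∂ν) ^ 2 ≤ ∫⁻ x, g x ^ 2 ∂ν := by
  have h := ENNReal.lintegral_mul_le_Lp_mul_Lq ν (p := 2) (q := 2) (by constructor <;> norm_num) hg
    (aemeasurable_const (b := (1 : ℝ≥0∞)))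
  simp only [Pi.mul_apply, mul_one, ENNReal.one_rpow, lintegral_one, hν] at h
  calc (∫⁻ x, g x ∂ν) ^ 2 ≤ ((∫⁻ x, g x ^ (2 : ℝ) ∂ν) ^ (1 / 2 : ℝ)) ^ 2 := by gcongr
    _ = ∫⁻ x, g x ^ 2 ∂ν := by
      rw [← ENNReal.rpow_natCast, ← ENNReal.rpow_mul]
      simp

/-- The kernel is a probability density: Jensen at each point, then Tonelli and translation
invariance. -/
theorem lintegral_enorm_moll_sq_le (k : ℕ) {f : Eu n → F} (hf : AEStronglyMeasurable f) :
    ∫⁻ x, ‖moll k f x‖ₑ ^ 2 ≤ ∫⁻ x, ‖f x‖ₑ ^ 2 := by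
  set ρ := (mollBump n k).normed volume
  have hρm : Measurable fun t => ‖ρ t‖ₑ := (mollBump n k).continuous_normed.measurable.enorm
  set ν : Measure (Eu n) := volume.withDensity fun t => ‖ρ t‖ₑ
  have hac : ν ≪ volume := withDensity_absolutelyContinuous _ _
  have hν : ν Set.univ = 1 := by
    rw [withDensity_apply _ MeasurableSet.univ, setLIntegral_univ, lintegral_enorm_mollBump]
  have hprod : AEMeasurable (fun p : Eu n × Eu n => ‖f (p.1 - p.2)‖ₑ ^ 2) (volume.prod ν) := by
    have h1 : AEMeasurable (fun p : Eu n × Eu n => ‖f (p.1 - p.2)‖ₑ ^ 2)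
        ((volume : Measure (Eu n)).prod volume) :=
      (hf.comp_quasiMeasurePreserving (quasiMeasurePreserving_sub volume volume)).enorm.pow_const 2
    exact h1.mono_ac (Measure.AbsolutelyContinuous.rfl.prod hac)
  have hpt : ∀ x, ‖moll k f x‖ₑ ^ 2 ≤ ∫⁻ t, ‖f (x - t)‖ₑ ^ 2 ∂ν := by
    intro x
    have hm : AEMeasurable (fun t => ‖f (x - t)‖ₑ) :=
      (hf.comp_quasiMeasurePreserving (Measure.measurePreserving_sub_left volume x).quasiMeasurePreserving).enorm
    refine le_trans ?_ (lintegral_sq_le_of_measure_univ_eq_one hν (hm.mono_ac hac))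
    gcongr
    rw [lintegral_withDensity_eq_lintegral_mul₀ hρm.aemeasurable hm, moll_apply]
    refine (enorm_integral_le_lintegral_enorm _).trans (le_of_eq ?_)
    exact lintegral_congr fun t => by rw [enorm_smul]; rfl
  have : IsFiniteMeasure ν := ⟨by rw [hν]; exact ENNReal.one_lt_top⟩
  calc ∫⁻ x, ‖moll k f x‖ₑ ^ 2 ≤ ∫⁻ x, ∫⁻ t, ‖f (x - t)‖ₑ ^ 2 ∂ν := lintegral_mono hpt
    _ = ∫⁻ t, (∫⁻ x, ‖f (x - t)‖ₑ ^ 2) ∂ν := lintegral_lintegral_swap (f := fun x t => ‖f (x - t)‖ₑ ^ 2) hprod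
    _ = ∫⁻ _t, (∫⁻ x, ‖f x‖ₑ ^ 2) ∂ν :=
      lintegral_congr fun t => lintegral_sub_right_eq_self (fun x => ‖f x‖ₑ ^ 2) t
    _ = ∫⁻ x, ‖f x‖ₑ ^ 2 := by rw [lintegral_const, hν, mul_one]

theorem contDiff_moll (k : ℕ) {f : Eu n → F} (hf : LocallyIntegrable f) :
    ContDiff ℝ ∞ (moll k f) :=
  (mollBump n k).hasCompactSupport_normed.contDiff_convolution_left _
    (mollBump n k).contDiff_normed hf

theorem enorm_sq_parallelogram (a b : F) :
    ‖a - b‖ₑ ^ 2 + ‖a + b‖ₑ ^ 2 = 2 * ‖a‖ₑ ^ 2 + 2 * ‖b‖ₑ ^ 2 := by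
  have h := parallelogram_law_with_norm ℝ a b
  have h' : ‖a - b‖ ^ 2 + ‖a + b‖ ^ 2 = 2 * ‖a‖ ^ 2 + 2 * ‖b‖ ^ 2 := by nlinarith
  simp only [← ofReal_norm]
  have h2 : (2 : ℝ≥0∞) = ENNReal.ofReal 2 := by simp
  rw [h2, ← ENNReal.ofReal_pow (norm_nonneg _), ← ENNReal.ofReal_pow (norm_nonneg _),
    ← ENNReal.ofReal_pow (norm_nonneg _), ← ENNReal.ofReal_pow (norm_nonneg _),
    ← ENNReal.ofReal_mul (by norm_num), ← ENNReal.ofReal_mul (by norm_num),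
    ← ENNReal.ofReal_add (by positivity) (by positivity),
    ← ENNReal.ofReal_add (by positivity) (by positivity), h']

theorem eLpNorm_two_sq {α : Type*} [MeasurableSpace α] (μ : Measure α) {G : Type*}
    [NormedAddCommGroup G] (f : α → G) : eLpNorm f 2 μ ^ 2 = ∫⁻ x, ‖f x‖ₑ ^ 2 ∂μ := by
  rw [eLpNorm_eq_lintegral_rpow_enorm_toReal (by norm_num) (by norm_num), ← ENNReal.rpow_natCast,
    ← ENNReal.rpow_mul]
  simp

/-- Mollifications converge in `L²`. -/
theorem tendsto_lintegral_moll_sub_sq [CompleteSpace F] {f : Eu n → F} (hf : MemLp f 2) :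
    Tendsto (fun k => ∫⁻ x, ‖moll k f x - f x‖ₑ ^ 2) atTop (𝓝 0) := by
  have hloc : LocallyIntegrable f := hf.locallyIntegrable (by norm_num)
  set I := ∫⁻ x, ‖f x‖ₑ ^ 2 with hI
  have hItop : I ≠ ⊤ := by
    rw [hI, ← eLpNorm_two_sq]
    exact ENNReal.pow_ne_top hf.2.ne
  have hfm : AEMeasurable (fun x => ‖f x‖ₑ ^ 2) := hf.1.enorm.pow_const 2
  have hmm : ∀ k, AEStronglyMeasurable (moll k f) := fun k =>
    (contDiff_moll k hloc).continuous.aestronglyMeasurable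
  -- Convergence in norm comes from almost everywhere convergence and contraction. By the
  -- parallelogram law `‖f_k - f‖² + ‖f_k + f‖² ≤ 4‖f‖²`, while Fatou gives `liminf ‖f_k + f‖² ≥
  -- 4‖f‖²`.
  have hsum : ∀ k, ∫⁻ x, ‖moll k f x - f x‖ₑ ^ 2 ≤ 4 * I - ∫⁻ x, ‖moll k f x + f x‖ₑ ^ 2 := by
    intro k
    have h1 : (∫⁻ x, ‖moll k f x - f x‖ₑ ^ 2) + ∫⁻ x, ‖moll k f x + f x‖ₑ ^ 2 ≤ 4 * I := by
      rw [← lintegral_add_left' (f := fun x => ‖moll k f x - f x‖ₑ ^ 2)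
        (((hmm k).sub hf.1).enorm.pow_const 2)]
      simp_rw [enorm_sq_parallelogram]
      rw [lintegral_add_right' _ (hfm.const_mul 2), lintegral_const_mul' _ _ (by norm_num),
        lintegral_const_mul' _ _ (by norm_num)]
      calc _ ≤ 2 * I + 2 * I := by gcongr; exact lintegral_enorm_moll_sq_le k hf.1
        _ = 4 * I := by ring
    refine ENNReal.le_sub_of_add_le_right ?_ h1
    exact ne_top_of_le_ne_top (by finiteness) (le_add_self.trans h1)
  have hliminf : 4 * I ≤ liminf (fun k => ∫⁻ x, ‖moll k f x + f x‖ₑ ^ 2) atTop := by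
    refine le_trans ?_ (lintegral_liminf_le' fun k => ((hmm k).add hf.1).enorm.pow_const 2)
    rw [hI, ← lintegral_const_mul' _ _ (by norm_num)]
    refine lintegral_mono_ae ?_
    filter_upwards [ae_tendsto_moll hloc] with x hx
    have : Tendsto (fun k => ‖moll k f x + f x‖ₑ ^ 2) atTop (𝓝 (‖f x + f x‖ₑ ^ 2)) :=
      ((ENNReal.continuous_pow 2).tendsto _).comp ((hx.add_const (f x)).enorm)
    rw [this.liminf_eq, ← two_smul ℝ (f x), enorm_smul, mul_pow]
    refine le_of_eq ?_
    congr 1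
    rw [Real.enorm_of_nonneg (by norm_num)]
    norm_num
  refine tendsto_of_le_liminf_of_limsup_le (by simp) ?_ 
  calc limsup (fun k => ∫⁻ x, ‖moll k f x - f x‖ₑ ^ 2) atTop
      ≤ limsup (fun k => 4 * I - ∫⁻ x, ‖moll k f x + f x‖ₑ ^ 2) atTop :=
        limsup_le_limsup (Eventually.of_forall hsum)
    _ = 4 * I - liminf (fun k => ∫⁻ x, ‖moll k f x + f x‖ₑ ^ 2) atTop :=
        ENNReal.limsup_const_sub _ _ (by finiteness)
    _ ≤ 0 := by rw [tsub_eq_zero_of_le hliminf]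

/-- The gradient as a vector in Euclidean space. -/
noncomputable def egrad (f : Eu n → ℝ) (x : Eu n) : Eu n :=
  WithLp.toLp 2 fun i => fderiv ℝ f x (EuclideanSpace.single i 1)

@[simp] theorem egrad_apply (f : Eu n → ℝ) (x : Eu n) (i : Fin n) :
    egrad f x i = fderiv ℝ f x (EuclideanSpace.single i 1) := rfl

theorem moll_coord (k : ℕ) {g : Eu n → Eu n} (hg : LocallyIntegrable g) (x : Eu n) (i : Fin n) :
    moll k g x i = ∫ t, (mollBump n k).normed volume t * g (x - t) i := by
  have hex := (mollBump n k).hasCompactSupport_normed (μ := volume) |>.convolutionExists_left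
    (ContinuousLinearMap.lsmul ℝ ℝ) (mollBump n k).continuous_normed hg x
  have := (EuclideanSpace.proj i : Eu n →L[ℝ] ℝ).integral_comp_comm hex
  simp only [ContinuousLinearMap.lsmul_apply, map_smul, smul_eq_mul] at this
  exact this.symm

theorem egrad_moll (k : ℕ) {f : Eu n → ℝ} (hf : LocallyIntegrable f) (x : Eu n) (i : Fin n) :
    egrad (moll k f) x i =
      ∫ y, fderiv ℝ ((mollBump n k).normed volume) (x - y) (EuclideanSpace.single i 1) * f y := by
  set ρ := (mollBump n k).normed (volume : Measure (Eu n))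
  have hcs : HasCompactSupport ρ := (mollBump n k).hasCompactSupport_normed
  have hρ : ContDiff ℝ 1 ρ := (mollBump n k).contDiff_normed
  have h1 := hcs.hasFDerivAt_convolution_left (ContinuousLinearMap.lsmul ℝ ℝ) hρ hf x
  have hex := (hcs.fderiv ℝ).convolutionExists_left
    ((ContinuousLinearMap.lsmul ℝ ℝ : ℝ →L[ℝ] ℝ →L[ℝ] ℝ).precompL (Eu n))
    (hρ.continuous_fderiv one_ne_zero) hf x
  rw [egrad_apply, show fderiv ℝ (moll k f) x = _ from h1.fderiv, convolution_def,
    ContinuousLinearMap.integral_apply hex,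
    ← integral_sub_left_eq_self _ volume x]
  simp

/-- Away from the boundary, mollification commutes with the weak gradient. -/
theorem egrad_moll_eq {Ω K : Set (Eu n)} {u : Eu n → ℝ} {g : Eu n → Eu n}
    (h : IsWeakGradient Ω u g) (hK : IsCompact K) (hKΩ : K ⊆ Ω) (k : ℕ) {x : Eu n}
    (hx : Metric.closedBall x (1 / (k + 1)) ⊆ K) :
    egrad (moll k (K.indicator u)) x = moll k (K.indicator g) x := by
  have hKm := hK.measurableSet
  have hu : LocallyIntegrable (K.indicator u) :=
    ((integrable_indicator_iff hKm).2 (h.1.integrableOn_compact_subset hKΩ hK)).locallyIntegrable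
  have hg : LocallyIntegrable (K.indicator g) :=
    ((integrable_indicator_iff hKm).2 (h.2.1.integrableOn_compact_subset hKΩ hK)).locallyIntegrable
  ext i
  rw [egrad_moll k hu, moll_coord k hg]
  set ρ := (mollBump n k).normed (volume : Measure (Eu n)) with hρdef
  have hρ : ContDiff ℝ ∞ ρ := (mollBump n k).contDiff_normed
  have hsupp : tsupport ρ = Metric.closedBall 0 (1 / (k + 1)) :=
    (mollBump n k).tsupport_normed_eq
  -- The reflected kernel is an admissible test function because its support lies in `K ⊆ Ω`;
  -- differentiating it in `y` instead of `x` produces the sign of the weak gradient identity.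
  set φ : Eu n → ℝ := fun y => ρ (x - y) with hφ
  have hφs : ContDiff ℝ ∞ φ := hρ.comp (contDiff_const.sub contDiff_id)
  have hzero : ∀ y, y ∉ Metric.closedBall x (1 / ((k : ℝ) + 1)) → x - y ∉ tsupport ρ := by
    intro y hy hmem
    rw [hsupp] at hmem
    apply hy
    simpa [dist_eq_norm, norm_sub_rev] using hmem
  have hφt : tsupport φ ⊆ Metric.closedBall x (1 / (k + 1)) := by
    refine closure_minimal (fun y hy => ?_) Metric.isClosed_closedBall
    by_contra hcon
    exact hy (image_eq_zero_of_notMem_tsupport (f := ρ) (hzero y hcon))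
  have hφc : HasCompactSupport φ :=
    HasCompactSupport.of_support_subset_isCompact (isCompact_closedBall x _)
      ((subset_tsupport φ).trans hφt)
  have hd : ∀ y, fderiv ℝ φ y (EuclideanSpace.single i 1) =
      -fderiv ℝ ρ (x - y) (EuclideanSpace.single i 1) := by
    intro y
    have h1 : HasFDerivAt φ ((fderiv ℝ ρ (x - y)).comp (-ContinuousLinearMap.id ℝ (Eu n))) y := by
      refine HasFDerivAt.comp y (hρ.differentiable (by simp) _).hasFDerivAt ?_
      simpa using (hasFDerivAt_id y).const_sub x
    rw [h1.fderiv]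
    simp
  have hweak := h.2.2 i φ hφs hφc ((hφt.trans hx).trans hKΩ)
  have e1 : ∫ y, fderiv ℝ ρ (x - y) (EuclideanSpace.single i 1) * K.indicator u y =
      -∫ y in Ω, u y * fderiv ℝ φ y (EuclideanSpace.single i 1) := by
    rw [← integral_neg, ← setIntegral_eq_integral_of_forall_compl_eq_zero (s := Ω)]
    · refine integral_congr_ae (Eventually.of_forall fun y => ?_)
      simp only [hd]
      by_cases hy : y ∈ K
      · rw [Set.indicator_of_mem hy]; ring
      · rw [image_eq_zero_of_notMem_tsupport
          (fun hmem => hzero y (fun hy' => hy (hx hy')) (tsupport_fderiv_subset ℝ hmem))]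
        simp
    · intro y hy
      rw [Set.indicator_of_notMem fun hyK => hy (hKΩ hyK), mul_zero]
  have e2 : ∫ y, ρ (x - y) * (K.indicator g (x - (x - y))) i = ∫ y in Ω, g y i * φ y := by
    rw [← setIntegral_eq_integral_of_forall_compl_eq_zero (s := Ω)]
    · refine integral_congr_ae (Eventually.of_forall fun y => ?_)
      simp only [hφ, sub_sub_cancel]
      by_cases hy : y ∈ K
      · rw [Set.indicator_of_mem hy]; ring
      · rw [image_eq_zero_of_notMem_tsupport
          (fun hmem => hzero y (fun hy' => hy (hx hy')) hmem)]
        simp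
    · intro y hy
      rw [sub_sub_cancel, Set.indicator_of_notMem fun hyK => hy (hKΩ hyK)]
      simp
  rw [hweak, neg_neg, ← e2] at e1
  rw [← integral_sub_left_eq_self (fun t => ρ t * (K.indicator g (x - t)) i) volume x, ← e1]

/-- Functions in `W^{1,2}_loc` are limits of smooth functions on compact sets. -/
theorem MemW12loc.exists_smooth_approx {Ω K : Set (Eu n)} (hΩ : IsOpen Ω) {u : Eu n → ℝ}
    {g : Eu n → Eu n} (h : MemW12loc Ω u g) (hK : IsCompact K) (hKΩ : K ⊆ Ω) :
    ∃ v : ℕ → Eu n → ℝ, (∀ k, ContDiff ℝ ∞ (v k)) ∧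
      Tendsto (fun k => eLpNorm (v k - u) 2 (volume.restrict K)) atTop (𝓝 0) ∧
      Tendsto (fun k => eLpNorm (egrad (v k) - g) 2 (volume.restrict K)) atTop (𝓝 0) ∧
      (∀ᵐ x ∂volume.restrict K, Tendsto (fun k => v k x) atTop (𝓝 (u x))) ∧
      ∀ᵐ x ∂volume.restrict K, Tendsto (fun k => egrad (v k) x) atTop (𝓝 (g x)) := by
  obtain ⟨δ, hδ, hsub⟩ := hK.exists_cthickening_subset_open hΩ hKΩ
  set K' := Metric.cthickening δ K
  have hK' : IsCompact K' := hK.cthickening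
  have hKK' : K ⊆ K' := Metric.self_subset_cthickening K
  have hm := hK'.measurableSet
  have hu2 : MemLp (K'.indicator u) 2 := (memLp_indicator_iff_restrict hm).2 (h.2 K' hK' hsub).1
  have hg2 : MemLp (K'.indicator g) 2 := (memLp_indicator_iff_restrict hm).2 (h.2 K' hK' hsub).2
  have hu : LocallyIntegrable (K'.indicator u) := hu2.locallyIntegrable (by norm_num)
  have hg : LocallyIntegrable (K'.indicator g) := hg2.locallyIntegrable (by norm_num)
  -- Starting the sequence at index `N` keeps every mollification ball around a point of `K` inside
  -- the thickening, where `egrad_moll_eq` applies.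
  obtain ⟨N, hN⟩ := exists_nat_one_div_lt hδ
  have hball : ∀ k, ∀ x ∈ K, Metric.closedBall x (1 / (((k + N : ℕ) : ℝ) + 1)) ⊆ K' := by
    intro k x hx
    refine (Metric.closedBall_subset_closedBall ?_).trans (Metric.closedBall_subset_cthickening hx δ)
    refine le_trans ?_ hN.le
    gcongr
    linarith [(Nat.cast_nonneg k : (0 : ℝ) ≤ k)]
  have hgrad : ∀ k, ∀ x ∈ K, egrad (moll (k + N) (K'.indicator u)) x =
      moll (k + N) (K'.indicator g) x := fun k x hx =>
    egrad_moll_eq h.1 hK' hsub (k + N) (hball k x hx)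
  have conv : ∀ {G : Type} [NormedAddCommGroup G] [InnerProductSpace ℝ G] [CompleteSpace G]
      (f : Eu n → G), MemLp (K'.indicator f) 2 → ∀ w : ℕ → Eu n → G,
      (∀ k, ∀ x ∈ K, w k x = moll (k + N) (K'.indicator f) x) →
      Tendsto (fun k => eLpNorm (w k - f) 2 (volume.restrict K)) atTop (𝓝 0) := by
    intro G _ _ _ f hf w hw
    have h1 := (tendsto_lintegral_moll_sub_sq hf).comp (tendsto_add_atTop_nat N)
    have h2 := ((ENNReal.continuous_rpow_const (y := 1 / 2)).tendsto 0).comp h1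
    rw [ENNReal.zero_rpow_of_pos (by norm_num)] at h2
    refine tendsto_of_tendsto_of_tendsto_of_le_of_le tendsto_const_nhds h2 (fun _ => zero_le)
      fun k => ?_
    have h3 : eLpNorm (w k - f) 2 (volume.restrict K) =
        (∫⁻ x in K, ‖(w k - f) x‖ₑ ^ 2) ^ (1 / 2 : ℝ) := by
      rw [← eLpNorm_two_sq, ← ENNReal.rpow_natCast, ← ENNReal.rpow_mul]
      simp
    simp only [h3, Function.comp_apply]
    refine ENNReal.rpow_le_rpow ?_ (by norm_num)
    calc ∫⁻ x in K, ‖(w k - f) x‖ₑ ^ 2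
        = ∫⁻ x in K, ‖moll (k + N) (K'.indicator f) x - K'.indicator f x‖ₑ ^ 2 := by
          refine setLIntegral_congr_fun hK.measurableSet fun x hx => ?_
          simp only [Pi.sub_apply, hw k x hx, Set.indicator_of_mem (hKK' hx)]
      _ ≤ _ := setLIntegral_le_lintegral _ _
  refine ⟨fun k => moll (k + N) (K'.indicator u), fun k => contDiff_moll _ hu,
    conv u hu2 _ fun k x hx => rfl, conv g hg2 _ hgrad, ?_, ?_⟩
  · rw [ae_restrict_iff' hK.measurableSet]
    filter_upwards [ae_tendsto_moll hu] with x hx hxK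
    rw [Set.indicator_of_mem (hKK' hxK)] at hx
    exact hx.comp (tendsto_add_atTop_nat N)
  · rw [ae_restrict_iff' hK.measurableSet]
    filter_upwards [ae_tendsto_moll hg] with x hx hxK
    rw [Set.indicator_of_mem (hKK' hxK)] at hx
    refine (hx.comp (tendsto_add_atTop_nat N)).congr fun k => ?_
    exact (hgrad k x hxK).symm

end BMOElliptic

/-! ### Calculus of weak gradients: products, chain rule, vanishing curl. -/

namespace BMOElliptic

variable {n : ℕ}

theorem norm_egrad (f : Eu n → ℝ) (x : Eu n) : ‖egrad f x‖ = ‖fderiv ℝ f x‖ := by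
  have h : egrad f x = (InnerProductSpace.toDual ℝ (Eu n)).symm (fderiv ℝ f x) := by
    ext i
    rw [egrad_apply, ← InnerProductSpace.toDual_symm_apply, EuclideanSpace.inner_single_right]
    simp
  rw [h, LinearIsometryEquiv.norm_map]

theorem egrad_mul {f g : Eu n → ℝ} {x : Eu n} (hf : DifferentiableAt ℝ f x)
    (hg : DifferentiableAt ℝ g x) :
    egrad (fun y => f y * g y) x = f x • egrad g x + g x • egrad f x := by
  ext i
  simp [fderiv_fun_mul hf hg]

theorem continuous_egrad {f : Eu n → ℝ} (hf : ContDiff ℝ 1 f) : Continuous (egrad f) := by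
  refine (PiLp.continuous_toLp 2 _).comp (continuous_pi fun i => ?_)
  exact (hf.continuous_fderiv one_ne_zero).clm_apply continuous_const

theorem egrad_eq_zero_of_notMem {f : Eu n → ℝ} {x : Eu n} (hx : x ∉ tsupport f) :
    egrad f x = 0 := by
  ext i
  rw [egrad_apply, image_eq_zero_of_notMem_tsupport
    (fun h => hx (tsupport_fderiv_subset ℝ h))]
  simp

/-- A function vanishing off a set is in `L^p` as soon as it is on that set. -/
theorem memLp_of_restrict {G : Type*} [NormedAddCommGroup G] {f : Eu n → G} {K : Set (Eu n)}
    (hK : MeasurableSet K) {p : ℝ≥0∞} (h : MemLp f p (volume.restrict K))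
    (h0 : ∀ x ∉ K, f x = 0) : MemLp f p := by
  rw [← memLp_indicator_iff_restrict hK] at h
  rwa [Set.indicator_eq_self.2 fun x hx => by_contra fun hxK => hx (h0 x hxK)] at h

theorem integrable_of_restrict {G : Type*} [NormedAddCommGroup G] {f : Eu n → G} {K : Set (Eu n)}
    (hK : MeasurableSet K) (h : IntegrableOn f K) (h0 : ∀ x ∉ K, f x = 0) : Integrable f :=
  memLp_one_iff_integrable.1 (memLp_of_restrict hK (memLp_one_iff_integrable.2 h) h0)

theorem exists_norm_le_of_hasCompactSupport {G : Type*} [NormedAddCommGroup G] {f : Eu n → G}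
    (hf : Continuous f) (hc : HasCompactSupport f) : ∃ C, ∀ x, ‖f x‖ ≤ C :=
  hf.bounded_above_of_compact_support hc

theorem integrableOn_mul_of_tsupport_subset {Ω : Set (Eu n)} {f ψ : Eu n → ℝ}
    (hf : LocallyIntegrableOn f Ω) (hψ : Continuous ψ) (hc : HasCompactSupport ψ)
    (hs : tsupport ψ ⊆ Ω) : Integrable fun x => f x * ψ x := by
  refine integrable_of_restrict hc.isCompact.measurableSet
    ((hf.integrableOn_compact_subset hs hc.isCompact).mul_continuousOn hψ.continuousOn
      hc.isCompact) fun x hx => ?_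
  rw [image_eq_zero_of_notMem_tsupport hx, mul_zero]

theorem integrableOn_coord {K : Set (Eu n)} {g : Eu n → Eu n} (hg : IntegrableOn g K) (i : Fin n) :
    IntegrableOn (fun x => g x i) K :=
  (EuclideanSpace.proj i : Eu n →L[ℝ] ℝ).integrable_comp hg

theorem locallyIntegrableOn_coord {Ω : Set (Eu n)} {g : Eu n → Eu n}
    (hg : LocallyIntegrableOn g Ω) (i : Fin n) : LocallyIntegrableOn (fun x => g x i) Ω := by
  intro x hx
  obtain ⟨s, hs, hgs⟩ := hg x hx
  exact ⟨s, hs, integrableOn_coord hgs i⟩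

theorem memLp_coord {μ : Measure (Eu n)} {g : Eu n → Eu n} {p : ℝ≥0∞} (hg : MemLp g p μ)
    (i : Fin n) : MemLp (fun x => g x i) p μ :=
  hg.of_le ((EuclideanSpace.proj i : Eu n →L[ℝ] ℝ).continuous.comp_aestronglyMeasurable hg.1)
    (Eventually.of_forall fun x => PiLp.norm_apply_le (g x) i)

/-- The product of a function in `W^{1,2}_loc` and a test function is in `W^{1,2}`. -/
theorem MemW12loc.smooth_mul {Ω : Set (Eu n)} {w : Eu n → ℝ} {Dw : Eu n → Eu n}
    (h : MemW12loc Ω w Dw) {ζ : Eu n → ℝ} (hζ : ContDiff ℝ ∞ ζ) (hc : HasCompactSupport ζ)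
    (hs : tsupport ζ ⊆ Ω) :
    MemW12 Ω (fun x => ζ x * w x) (fun x => ζ x • Dw x + w x • egrad ζ x) ∧
      MemLp (fun x => ζ x * w x) 2 ∧ MemLp (fun x => ζ x • Dw x + w x • egrad ζ x) 2 := by
  have hζ1 : ContDiff ℝ 1 ζ := hζ.of_le (by exact_mod_cast le_top)
  have hK := hc.isCompact
  obtain ⟨hw, hDw⟩ := h.2 _ hK hs
  obtain ⟨C, hC⟩ := exists_norm_le_of_hasCompactSupport hζ.continuous hc
  have hge : Continuous (egrad ζ) := continuous_egrad hζ1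
  have hgc : HasCompactSupport (egrad ζ) :=
    HasCompactSupport.of_support_subset_isCompact hK fun x hx =>
      by_contra fun hxK => hx (egrad_eq_zero_of_notMem hxK)
  obtain ⟨C', hC'⟩ := exists_norm_le_of_hasCompactSupport hge hgc
  have h1 : MemLp (fun x => ζ x * w x) 2 := by
    refine memLp_of_restrict hK.measurableSet (hw.of_le_mul (c := C)
      (hζ.continuous.aestronglyMeasurable.mul hw.1) (Eventually.of_forall fun x => ?_))
      fun x hx => by rw [image_eq_zero_of_notMem_tsupport hx, zero_mul]
    rw [norm_mul]; gcongr; exact hC x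
  have h2 : MemLp (fun x => ζ x • Dw x) 2 := by
    refine memLp_of_restrict hK.measurableSet (hDw.of_le_mul (c := C)
      (hζ.continuous.aestronglyMeasurable.smul hDw.1) (Eventually.of_forall fun x => ?_))
      fun x hx => by rw [image_eq_zero_of_notMem_tsupport hx, zero_smul]
    rw [norm_smul]; gcongr; exact hC x
  have h3 : MemLp (fun x => w x • egrad ζ x) 2 := by
    refine memLp_of_restrict hK.measurableSet (hw.of_le_mul (c := C')
      (hw.1.smul hge.aestronglyMeasurable) (Eventually.of_forall fun x => ?_))
      fun x hx => by rw [egrad_eq_zero_of_notMem hx, smul_zero]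
    rw [norm_smul, mul_comm]; gcongr; exact hC' x
  have h23 : MemLp (fun x => ζ x • Dw x + w x • egrad ζ x) 2 := h2.add h3
  refine ⟨⟨⟨(h1.locallyIntegrable (by norm_num)).locallyIntegrableOn _,
    (h23.locallyIntegrable (by norm_num)).locallyIntegrableOn _, ?_⟩,
    h1.restrict _, h23.restrict _⟩, h1, h23⟩
  intro i φ hφ hφc hφs
  have hφ1 : ContDiff ℝ 1 φ := hφ.of_le (by exact_mod_cast le_top)
  -- The cutoff is moved onto the test function: the Leibniz rule for the smooth product `ζ φ`
  -- yields that for `ζ w`.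
  have hprod := h.1.2.2 i (fun x => ζ x * φ x) (hζ.mul hφ) hc.mul_right
    ((tsupport_mul_subset_left).trans hs)
  have hd : ∀ x, fderiv ℝ (fun x => ζ x * φ x) x (EuclideanSpace.single i 1) =
      ζ x * fderiv ℝ φ x (EuclideanSpace.single i 1) + φ x * egrad ζ x i := by
    intro x
    rw [fderiv_fun_mul (hζ1.differentiable one_ne_zero x) (hφ1.differentiable one_ne_zero x)]
    simp
  have hci : Continuous fun x => egrad ζ x i :=
    (EuclideanSpace.proj i : Eu n →L[ℝ] ℝ).continuous.comp hge
  have i1 : Integrable fun x => w x * (φ x * egrad ζ x i) := by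
    refine integrableOn_mul_of_tsupport_subset h.1.1 (hφ.continuous.mul hci) hφc.mul_right
      ((tsupport_mul_subset_left).trans hφs)
  have i2 : Integrable fun x => w x * (ζ x * fderiv ℝ φ x (EuclideanSpace.single i 1)) :=
    integrableOn_mul_of_tsupport_subset h.1.1 (hζ.continuous.mul
      ((hφ1.continuous_fderiv one_ne_zero).clm_apply continuous_const)) hc.mul_right
      ((tsupport_mul_subset_left).trans hs)
  have i3 : Integrable fun x => Dw x i * (ζ x * φ x) :=
    integrableOn_mul_of_tsupport_subset (locallyIntegrableOn_coord h.1.2.1 i)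
      (hζ.continuous.mul hφ.continuous) hc.mul_right ((tsupport_mul_subset_left).trans hs)
  have e1 : ∫ x in Ω, w x * fderiv ℝ (fun x => ζ x * φ x) x (EuclideanSpace.single i 1) =
      (∫ x in Ω, w x * (ζ x * fderiv ℝ φ x (EuclideanSpace.single i 1))) +
        ∫ x in Ω, w x * (φ x * egrad ζ x i) := by
    rw [← integral_add i2.integrableOn i1.integrableOn]
    refine integral_congr_ae (Eventually.of_forall fun x => ?_)
    simp only [hd]; ring
  have e2 : ∫ x in Ω, (ζ x • Dw x + w x • egrad ζ x) i * φ x =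
      (∫ x in Ω, Dw x i * (ζ x * φ x)) + ∫ x in Ω, w x * (φ x * egrad ζ x i) := by
    rw [← integral_add i3.integrableOn i1.integrableOn]
    refine integral_congr_ae (Eventually.of_forall fun x => ?_)
    simp only [PiLp.add_apply, PiLp.smul_apply, smul_eq_mul]; ring
  have e3 : ∫ x in Ω, ζ x * w x * fderiv ℝ φ x (EuclideanSpace.single i 1) =
      ∫ x in Ω, w x * (ζ x * fderiv ℝ φ x (EuclideanSpace.single i 1)) := by
    refine integral_congr_ae (Eventually.of_forall fun x => ?_)
    simp only []; ring
  rw [e1] at hprod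
  rw [e2, e3]
  linarith

theorem tendsto_integral_mul_of_eLpNorm_two {α : Type*} [MeasurableSpace α] {μ : Measure α}
    {f : ℕ → α → ℝ} {f₀ ψ : α → ℝ} (hf : ∀ k, MemLp (f k) 2 μ) (hf₀ : MemLp f₀ 2 μ)
    (hψ : MemLp ψ 2 μ) (h : Tendsto (fun k => eLpNorm (f k - f₀) 2 μ) atTop (𝓝 0)) :
    Tendsto (fun k => ∫ x, f k x * ψ x ∂μ) atTop (𝓝 (∫ x, f₀ x * ψ x ∂μ)) := by
  have hint : ∀ k, Integrable (fun x => f k x * ψ x) μ := fun k => (hf k).integrable_mul hψ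
  have hint₀ : Integrable (fun x => f₀ x * ψ x) μ := hf₀.integrable_mul hψ
  refine tendsto_integral_of_L1 _ hint₀.1 (Eventually.of_forall hint) ?_
  have h0 : Tendsto (fun k => eLpNorm (f k - f₀) 2 μ * eLpNorm ψ 2 μ) atTop (𝓝 0) := by
    have := ENNReal.Tendsto.mul_const h (b := eLpNorm ψ 2 μ) (Or.inr hψ.2.ne)
    rwa [zero_mul] at this
  refine tendsto_of_tendsto_of_tendsto_of_le_of_le tendsto_const_nhds h0 (fun _ => zero_le)
    fun k => ?_
  have := eLpNorm_smul_le_mul_eLpNorm (p := 2) (q := 2) (r := 1) hψ.1 ((hf k).sub hf₀).1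
  rw [eLpNorm_one_eq_lintegral_enorm] at this
  refine le_trans (le_of_eq (lintegral_congr fun x => ?_)) this
  simp [sub_mul]

theorem memLp_of_continuous_of_isCompact {G : Type*} [NormedAddCommGroup G] {K : Set (Eu n)}
    (hK : IsCompact K) {f : Eu n → G} (hf : Continuous f) (p : ℝ≥0∞) :
    MemLp f p (volume.restrict K) := by
  have : IsFiniteMeasure (volume.restrict K) := ⟨by
    rw [Measure.restrict_apply_univ]; exact hK.measure_lt_top⟩
  obtain ⟨C, hC⟩ := hK.exists_bound_of_continuousOn hf.continuousOn
  exact MemLp.of_bound hf.aestronglyMeasurable C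
    ((ae_restrict_iff' hK.measurableSet).2 (Eventually.of_forall hC))

theorem tendsto_eLpNorm_coord {μ : Measure (Eu n)} {v : ℕ → Eu n → Eu n} {g : Eu n → Eu n}
    (h : Tendsto (fun k => eLpNorm (v k - g) 2 μ) atTop (𝓝 0)) (i : Fin n) :
    Tendsto (fun k => eLpNorm ((fun x => v k x i) - fun x => g x i) 2 μ) atTop (𝓝 0) := by
  refine tendsto_of_tendsto_of_tendsto_of_le_of_le tendsto_const_nhds h (fun _ => zero_le)
    fun k => eLpNorm_mono fun x => ?_
  simpa using PiLp.norm_apply_le (v k x - g x) i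

theorem abs_sub_le_of_hasDerivAt {f f' : ℝ → ℝ} (hf : ∀ t, HasDerivAt f (f' t) t) {M : ℝ}
    (hM : ∀ t, |f' t| ≤ M) (s t : ℝ) : |f s - f t| ≤ M * |s - t| :=
  Convex.norm_image_sub_le_of_norm_hasDerivWithin_le (fun x _ => (hf x).hasDerivWithinAt)
    (fun x _ => hM x) convex_univ (Set.mem_univ t) (Set.mem_univ s)

theorem isFiniteMeasure_restrict_of_isCompact {K : Set (Eu n)} (hK : IsCompact K) :
    IsFiniteMeasure (volume.restrict K) :=
  ⟨by rw [Measure.restrict_apply_univ]; exact hK.measure_lt_top⟩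

theorem memLp_comp_of_lipschitz {μ : Measure (Eu n)} [IsFiniteMeasure μ] {u : Eu n → ℝ}
    {f : ℝ → ℝ} {M : ℝ} {p : ℝ≥0∞} (hu : MemLp u p μ) (hfc : Continuous f)
    (hlip : ∀ s t, |f s - f t| ≤ M * |s - t|) : MemLp (fun x => f (u x)) p μ := by
  have h1 : MemLp (fun _ : Eu n => |f 0|) p μ := memLp_const _
  have h2 : MemLp (fun x => M * |u x|) p μ := hu.abs.const_mul M
  have hb : MemLp (fun x => |f 0| + M * |u x|) p μ := h1.add h2
  refine hb.of_le (hfc.comp_aestronglyMeasurable hu.1) (Eventually.of_forall fun x => ?_)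
  have h1 := hlip (u x) 0
  rw [sub_zero] at h1
  have h2 : |f (u x)| ≤ |f 0| + |f (u x) - f 0| := by
    have := abs_add_le (f 0) (f (u x) - f 0)
    simpa using this
  rw [Real.norm_eq_abs, Real.norm_eq_abs]
  exact (h2.trans (by linarith)).trans (le_abs_self _)

theorem locallyIntegrableOn_of_memLp_two {Ω : Set (Eu n)} (hΩ : IsOpen Ω) {G : Type*}
    [NormedAddCommGroup G] {F : Eu n → G}
    (hF : ∀ K : Set (Eu n), IsCompact K → K ⊆ Ω → MemLp F 2 (volume.restrict K)) :
    LocallyIntegrableOn F Ω := by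
  rw [locallyIntegrableOn_iff hΩ.isLocallyClosed]
  intro K hKΩ hK
  have := isFiniteMeasure_restrict_of_isCompact hK
  exact (hF K hK hKΩ).integrable (by norm_num)

theorem setIntegral_eq_of_subset_of_eq_zero {Ω K : Set (Eu n)} (hKΩ : K ⊆ Ω) {F : Eu n → ℝ}
    (hF : ∀ x ∉ K, F x = 0) : ∫ x in Ω, F x = ∫ x in K, F x := by
  rw [setIntegral_eq_integral_of_forall_compl_eq_zero hF,
    setIntegral_eq_integral_of_forall_compl_eq_zero fun x hx => hF x fun hxK => hx (hKΩ hxK)]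

/-- The classical identity for smooth approximants `v k`, passed to the limit. Since `f'` is merely
continuous and bounded, `f' ∘ v k` converges only almost everywhere. The gradient term is therefore
split: with the limit gradient `g` dominated convergence applies, and the remainder contains `egrad
(v k) - g`, which tends to zero in `L²`. -/
theorem MemW12loc.integral_comp_mul_fderiv {Ω : Set (Eu n)} (hΩ : IsOpen Ω) {u : Eu n → ℝ}
    {g : Eu n → Eu n} (h : MemW12loc Ω u g) {f f' : ℝ → ℝ} (hf : ∀ t, HasDerivAt f (f' t) t)
    (hf' : Continuous f') {M : ℝ} (hM : ∀ t, |f' t| ≤ M) (i : Fin n) {φ : Eu n → ℝ}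
    (hφ : ContDiff ℝ ∞ φ) (hφc : HasCompactSupport φ) (hφs : tsupport φ ⊆ Ω) :
    ∫ x in tsupport φ, f (u x) * fderiv ℝ φ x (EuclideanSpace.single i 1) =
      -∫ x in tsupport φ, f' (u x) * φ x * g x i := by
  have hfc : Continuous f := continuous_iff_continuousAt.2 fun t => (hf t).continuousAt
  have hlip := abs_sub_le_of_hasDerivAt hf hM
  have hM0 : 0 ≤ M := (abs_nonneg _).trans (hM 0)
  have hφ1 : ContDiff ℝ 1 φ := hφ.of_le (by exact_mod_cast le_top)
  set K := tsupport φ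
  have hK : IsCompact K := hφc.isCompact
  obtain ⟨hu, hg⟩ := h.2 K hK hφs
  have := isFiniteMeasure_restrict_of_isCompact hK
  obtain ⟨v, hv, hv1, hv2, hv3, -⟩ := h.exists_smooth_approx hΩ hK hφs
  have hv1' : ∀ k, ContDiff ℝ 1 (v k) := fun k => (hv k).of_le (by exact_mod_cast le_top)
  have hf1 : ContDiff ℝ 1 f := by
    rw [contDiff_one_iff_deriv]
    refine ⟨fun t => (hf t).differentiableAt, ?_⟩
    rwa [show deriv f = f' from funext fun t => (hf t).deriv]
  have hdφ : Continuous fun x => fderiv ℝ φ x (EuclideanSpace.single i 1) :=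
    (hφ1.continuous_fderiv one_ne_zero).clm_apply continuous_const
  have hdφ0 : ∀ x ∉ K, fderiv ℝ φ x (EuclideanSpace.single i 1) = 0 := fun x hx => by
    rw [image_eq_zero_of_notMem_tsupport (fun hm => hx (tsupport_fderiv_subset ℝ hm))]; rfl
  have hφ0 : ∀ x ∉ K, φ x = 0 := fun x hx => image_eq_zero_of_notMem_tsupport hx
  have hparts : ∀ k, ∫ x in K, f (v k x) * fderiv ℝ φ x (EuclideanSpace.single i 1) =
      -∫ x in K, f' (v k x) * φ x * egrad (v k) x i := by
    intro k
    have hfv : ContDiff ℝ 1 (fun x => f (v k x)) := hf1.comp (hv1' k)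
    have hd : ∀ x, fderiv ℝ (fun x => f (v k x)) x (EuclideanSpace.single i 1) =
        f' (v k x) * egrad (v k) x i := by
      intro x
      have := (hf (v k x)).comp_hasFDerivAt x ((hv1' k).differentiable one_ne_zero x).hasFDerivAt
      rw [show fderiv ℝ (fun x => f (v k x)) x = _ from this.fderiv]
      simp
    have hdc : Continuous fun x => fderiv ℝ (fun x => f (v k x)) x (EuclideanSpace.single i 1) :=
      (hfv.continuous_fderiv one_ne_zero).clm_apply continuous_const
    have key := integral_mul_fderiv_eq_neg_fderiv_mul_of_integrable (μ := volume)
      (f := fun x => f (v k x)) (g := φ) (v := EuclideanSpace.single i 1)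
      ((hdc.mul hφ.continuous).integrable_of_hasCompactSupport hφc.mul_left)
      ((hfv.continuous.mul hdφ).integrable_of_hasCompactSupport
        (hφc.fderiv_apply ℝ _).mul_left)
      ((hfv.continuous.mul hφ.continuous).integrable_of_hasCompactSupport hφc.mul_left)
      (fun x _ => hfv.differentiable one_ne_zero x) (fun x _ => hφ1.differentiable one_ne_zero x)
    rw [setIntegral_eq_integral_of_forall_compl_eq_zero fun x hx => by rw [hdφ0 x hx, mul_zero],
      setIntegral_eq_integral_of_forall_compl_eq_zero fun x hx => by
        rw [hφ0 x hx, mul_zero, zero_mul], key]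
    congr 1
    refine integral_congr_ae (Eventually.of_forall fun x => ?_)
    simp only [hd]; ring
  have hlim1 : Tendsto (fun k => ∫ x in K, f (v k x) * fderiv ℝ φ x (EuclideanSpace.single i 1))
      atTop (𝓝 (∫ x in K, f (u x) * fderiv ℝ φ x (EuclideanSpace.single i 1))) := by
    refine tendsto_integral_mul_of_eLpNorm_two
      (fun k => memLp_of_continuous_of_isCompact hK (hfc.comp (hv k).continuous) 2)
      (memLp_comp_of_lipschitz hu hfc hlip) (memLp_of_continuous_of_isCompact hK hdφ 2) ?_
    have h0 : Tendsto (fun k => ENNReal.ofReal M * eLpNorm (v k - u) 2 (volume.restrict K)) atTop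
        (𝓝 0) := by
      have := ENNReal.Tendsto.const_mul hv1 (a := ENNReal.ofReal M) (Or.inr ENNReal.ofReal_ne_top)
      rwa [mul_zero] at this
    refine tendsto_of_tendsto_of_tendsto_of_le_of_le tendsto_const_nhds h0 (fun _ => zero_le)
      fun k => ?_
    exact eLpNorm_le_mul_eLpNorm_of_ae_le_mul (Eventually.of_forall fun x => hlip _ _) 2
  have hφ2 : MemLp φ 2 (volume.restrict K) := memLp_of_continuous_of_isCompact hK hφ.continuous 2
  obtain ⟨C, hC⟩ := exists_norm_le_of_hasCompactSupport hφ.continuous hφc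
  have hgi := memLp_coord hg i
  have hlim2 : Tendsto (fun k => ∫ x in K, f' (v k x) * φ x * g x i) atTop
      (𝓝 (∫ x in K, f' (u x) * φ x * g x i)) := by
    refine tendsto_integral_of_dominated_convergence (fun x => M * C * |g x i|) (fun k => ?_)
      ((hgi.integrable (by norm_num)).abs.const_mul _)
      (fun k => Eventually.of_forall fun x => ?_) ?_
    · exact ((hf'.comp (hv k).continuous).mul hφ.continuous).aestronglyMeasurable.mul hgi.1
    · rw [norm_mul, norm_mul, Real.norm_eq_abs (g x i)]
      gcongr
      · exact hM _
      · exact hC x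
    · filter_upwards [hv3] with x hx
      exact (((hf'.tendsto _).comp hx).mul_const _).mul_const _
  have hlim3 : Tendsto (fun k => ∫ x in K, f' (v k x) * φ x * (egrad (v k) x i - g x i)) atTop
      (𝓝 0) := by
    have hC0 : 0 ≤ C := (norm_nonneg _).trans (hC 0)
    have hcoord := tendsto_eLpNorm_coord hv2 i
    have hone : MemLp (fun _ : Eu n => (1 : ℝ)) 2 (volume.restrict K) := memLp_const _
    have hgk : ∀ k, MemLp (fun x => egrad (v k) x i) 2 (volume.restrict K) := fun k =>
      memLp_coord (memLp_of_continuous_of_isCompact hK (continuous_egrad (hv1' k)) 2) i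
    have hmk : ∀ k, MemLp (fun x => |egrad (v k) x i - g x i|) 2 (volume.restrict K) := fun k =>
      ((hgk k).sub hgi).abs
    have hl1 : Tendsto (fun k => ∫ x in K, |egrad (v k) x i - g x i| * (M * C)) atTop (𝓝 0) := by
      have := tendsto_integral_mul_of_eLpNorm_two (f₀ := fun _ => 0) (ψ := fun _ => M * C)
        hmk (memLp_const _) (memLp_const _) ?_
      · simpa using this
      · refine hcoord.congr fun k => ?_
        refine eLpNorm_congr_norm_ae (Eventually.of_forall fun x => ?_)
        simp
    refine squeeze_zero_norm (fun k => ?_) hl1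
    refine norm_integral_le_of_norm_le (((hmk k).integrable (by norm_num)).mul_const _)
      (Eventually.of_forall fun x => ?_)
    rw [norm_mul, norm_mul, Real.norm_eq_abs (egrad (v k) x i - g x i), mul_comm]
    gcongr
    · exact hM _
    · exact hC x
  have hlim4 : Tendsto (fun k => ∫ x in K, f' (v k x) * φ x * egrad (v k) x i) atTop
      (𝓝 (∫ x in K, f' (u x) * φ x * g x i)) := by
    have := hlim2.add hlim3
    rw [add_zero] at this
    refine this.congr fun k => ?_
    have hgk : MemLp (fun x => egrad (v k) x i) 2 (volume.restrict K) :=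
      memLp_coord (memLp_of_continuous_of_isCompact hK (continuous_egrad (hv1' k)) 2) i
    have hψ : MemLp (fun x => f' (v k x) * φ x) 2 (volume.restrict K) :=
      memLp_of_continuous_of_isCompact hK ((hf'.comp (hv k).continuous).mul hφ.continuous) 2
    rw [← integral_add (f := fun x => f' (v k x) * φ x * g x i)
      (g := fun x => f' (v k x) * φ x * (egrad (v k) x i - g x i))
      (hψ.integrable_mul hgi) (hψ.integrable_mul (hgk.sub hgi))]
    refine integral_congr_ae (Eventually.of_forall fun x => ?_)
    simp only []; ring
  exact tendsto_nhds_unique (hlim1.congr hparts) hlim4.neg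

/-- The chain rule for `W^{1,2}_loc` and a `C¹` function with bounded derivative. -/
theorem MemW12loc.comp {Ω : Set (Eu n)} (hΩ : IsOpen Ω) {u : Eu n → ℝ} {g : Eu n → Eu n}
    (h : MemW12loc Ω u g) {f f' : ℝ → ℝ} (hf : ∀ t, HasDerivAt f (f' t) t) (hf' : Continuous f')
    {M : ℝ} (hM : ∀ t, |f' t| ≤ M) :
    MemW12loc Ω (fun x => f (u x)) (fun x => f' (u x) • g x) := by
  have hfc : Continuous f := continuous_iff_continuousAt.2 fun t => (hf t).continuousAt
  have hM0 : 0 ≤ M := (abs_nonneg _).trans (hM 0)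
  have hL1 : ∀ K : Set (Eu n), IsCompact K → K ⊆ Ω →
      MemLp (fun x => f (u x)) 2 (volume.restrict K) := by
    intro K hK hKΩ
    have := isFiniteMeasure_restrict_of_isCompact hK
    exact memLp_comp_of_lipschitz (h.2 K hK hKΩ).1 hfc (abs_sub_le_of_hasDerivAt hf hM)
  have hL2 : ∀ K : Set (Eu n), IsCompact K → K ⊆ Ω →
      MemLp (fun x => f' (u x) • g x) 2 (volume.restrict K) := by
    intro K hK hKΩ
    obtain ⟨hu, hg⟩ := h.2 K hK hKΩ
    refine hg.of_le_mul (c := M) ((hf'.comp_aestronglyMeasurable hu.1).smul hg.1)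
      (Eventually.of_forall fun x => ?_)
    rw [norm_smul]; gcongr; exact hM _
  refine ⟨⟨locallyIntegrableOn_of_memLp_two hΩ hL1, locallyIntegrableOn_of_memLp_two hΩ hL2, ?_⟩,
    fun K hK hKΩ => ⟨hL1 K hK hKΩ, hL2 K hK hKΩ⟩⟩
  intro i φ hφ hφc hφs
  have hφ0 : ∀ x ∉ tsupport φ, φ x = 0 := fun x hx => image_eq_zero_of_notMem_tsupport hx
  rw [setIntegral_eq_of_subset_of_eq_zero hφs fun x hx => by
      rw [← egrad_apply, egrad_eq_zero_of_notMem hx]; simp,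
    setIntegral_eq_of_subset_of_eq_zero hφs fun x hx => by rw [hφ0 x hx, mul_zero],
    h.integral_comp_mul_fderiv hΩ hf hf' hM i hφ hφc hφs]
  congr 1
  refine integral_congr_ae (Eventually.of_forall fun x => ?_)
  simp only [PiLp.smul_apply, smul_eq_mul]; ring

theorem exists_cutoff {Ω K : Set (Eu n)} (hΩ : IsOpen Ω) (hK : IsCompact K) (hKΩ : K ⊆ Ω) :
    ∃ χ : Eu n → ℝ, ContDiff ℝ ∞ χ ∧ HasCompactSupport χ ∧ tsupport χ ⊆ Ω ∧
      ∀ x ∈ K, ∀ᶠ y in 𝓝 x, χ y = 1 := by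
  obtain ⟨δ, hδ, hsub⟩ := hK.exists_cthickening_subset_open hΩ hKΩ
  have hint : K ⊆ interior (Metric.cthickening δ K) :=
    (Metric.self_subset_thickening hδ K).trans
      (interior_maximal (Metric.thickening_subset_cthickening δ K) Metric.isOpen_thickening)
  obtain ⟨f, hf1, hf0, -⟩ := exists_contMDiffMap_one_nhds_of_subset_interior
    (n := (⊤ : ℕ∞)) (modelWithCornersSelf ℝ (Eu n)) hK.isClosed hint
  have hts : tsupport f ⊆ Metric.cthickening δ K :=
    closure_minimal (fun x hx => by_contra fun hxK => hx (hf0 x hxK)) Metric.isClosed_cthickening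
  refine ⟨f, f.contMDiff.contDiff, HasCompactSupport.of_support_subset_isCompact hK.cthickening
    ((subset_tsupport f).trans hts), hts.trans hsub, fun x hx => ?_⟩
  exact hf1.filter_mono (nhds_le_nhdsSet hx)

/-- `∇u` and `∇φ` are curl-free: `∫ u_{x_j} φ_{x_i} - u_{x_i} φ_{x_j} = 0`. -/
theorem integral_curl_eq_zero {Ω K : Set (Eu n)} (hΩ : IsOpen Ω) {u φ : Eu n → ℝ}
    {g Dφ : Eu n → Eu n} (h : MemW12loc Ω u g) (hφ : MemW12 Ω φ Dφ) (hK : IsCompact K)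
    (hKΩ : K ⊆ Ω) (h0 : ∀ x ∉ K, φ x = 0) (h0' : ∀ x ∉ K, Dφ x = 0) (i j : Fin n) :
    ∫ x in Ω, (g x j * Dφ x i - g x i * Dφ x j) = 0 := by
  obtain ⟨χ, hχ, hχc, hχs, hχ1⟩ := exists_cutoff hΩ hK hKΩ
  obtain ⟨v, hv, -, hv2, -, -⟩ := h.exists_smooth_approx hΩ hK hKΩ
  have hgK := (h.2 K hK hKΩ).2
  have hDK : MemLp Dφ 2 (volume.restrict K) :=
    hφ.2.2.mono_measure (Measure.restrict_mono hKΩ le_rfl)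
  have hv1' : ∀ k, ContDiff ℝ 1 (v k) := fun k => (hv k).of_le (by exact_mod_cast le_top)
  have hlim : ∀ i j : Fin n, Tendsto (fun k => ∫ x in K, egrad (v k) x j * Dφ x i) atTop
      (𝓝 (∫ x in K, g x j * Dφ x i)) := fun i j =>
    tendsto_integral_mul_of_eLpNorm_two
      (fun k => memLp_coord (memLp_of_continuous_of_isCompact hK (continuous_egrad (hv1' k)) 2) j)
      (memLp_coord hgK j) (memLp_coord hDK i) (tendsto_eLpNorm_coord hv2 j)
  -- With `u` replaced by a smooth `v k`, the derivative is moved off `φ` by testing its weak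
  -- gradient with `χ ∂_j (v k)`, where `χ = 1` near `K`. What results is a Hessian of `v k`,
  -- symmetric in `i` and `j`.
  have hsec : ∀ k (i j : Fin n), ∫ x in K, egrad (v k) x j * Dφ x i =
      -∫ x in K, φ x * fderiv ℝ (fderiv ℝ (v k)) x (EuclideanSpace.single i 1)
        (EuclideanSpace.single j 1) := by
    intro k i j
    have hd1 : ContDiff ℝ ∞ (fderiv ℝ (v k)) := (hv k).fderiv_right (m := ∞) (by simp)
    have hd2 : ContDiff ℝ ∞ fun x => fderiv ℝ (v k) x (EuclideanSpace.single j 1) :=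
      hd1.clm_apply contDiff_const
    have key := hφ.1.2.2 i (fun x => χ x * fderiv ℝ (v k) x (EuclideanSpace.single j 1))
      (hχ.mul hd2) hχc.mul_right ((tsupport_mul_subset_left).trans hχs)
    rw [setIntegral_eq_of_subset_of_eq_zero hKΩ fun x hx => by rw [h0 x hx, zero_mul],
      setIntegral_eq_of_subset_of_eq_zero hKΩ fun x hx => by rw [h0' x hx]; simp] at key
    have e1 : ∫ x in K, Dφ x i * (χ x * fderiv ℝ (v k) x (EuclideanSpace.single j 1)) =
        ∫ x in K, egrad (v k) x j * Dφ x i := by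
      refine setIntegral_congr_fun hK.measurableSet fun x hx => ?_
      simp only [(hχ1 x hx).self_of_nhds, egrad_apply]; ring
    have e2 : ∫ x in K, φ x * fderiv ℝ (fun x => χ x * fderiv ℝ (v k) x
        (EuclideanSpace.single j 1)) x (EuclideanSpace.single i 1) =
        ∫ x in K, φ x * fderiv ℝ (fderiv ℝ (v k)) x (EuclideanSpace.single i 1)
        (EuclideanSpace.single j 1) := by
      refine setIntegral_congr_fun hK.measurableSet fun x hx => ?_
      have hloc : (fun x => χ x * fderiv ℝ (v k) x (EuclideanSpace.single j 1)) =ᶠ[𝓝 x]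
          fun x => fderiv ℝ (v k) x (EuclideanSpace.single j 1) := by
        filter_upwards [hχ1 x hx] with y hy
        rw [hy, one_mul]
      simp only [hloc.fderiv_eq]
      congr 1
      have := (hd1.differentiable (by simp) x).hasFDerivAt.clm_apply
        (hasFDerivAt_const (EuclideanSpace.single j (1 : ℝ)) x)
      rw [this.fderiv]
      simp
    rw [e1, e2] at key
    linarith
  have hsymm : ∀ k, ∫ x in K, egrad (v k) x j * Dφ x i = ∫ x in K, egrad (v k) x i * Dφ x j := by
    intro k
    rw [hsec, hsec]
    congr 1
    refine integral_congr_ae (Eventually.of_forall fun x => ?_)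
    simp only []
    rw [((hv k).contDiffAt.isSymmSndFDerivAt
      (by simp [minSmoothness_of_isRCLikeNormedField]; exact WithTop.coe_le_coe.2 (le_top : (2 : ℕ∞) ≤ ⊤))).eq]
  have hfin := tendsto_nhds_unique ((hlim i j).congr hsymm) (hlim j i)
  rw [setIntegral_eq_of_subset_of_eq_zero hKΩ fun x hx => by rw [h0' x hx]; simp,
    integral_sub (f := fun x => g x j * Dφ x i) (g := fun x => g x i * Dφ x j)
      ((memLp_coord hgK j).integrable_mul (memLp_coord hDK i))
      ((memLp_coord hgK i).integrable_mul (memLp_coord hDK j)), hfin, sub_self]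

end BMOElliptic

/-! ### Sobolev and Poincaré inequalities. -/

namespace BMOElliptic

variable {n : ℕ}

/-- If `f k → f` in `L²`, the limit of `eLpNorm (f k)` dominates nothing beyond `eLpNorm f`. -/
theorem le_mul_eLpNorm_of_le_liminf {α G : Type*} [MeasurableSpace α] [NormedAddCommGroup G]
    {μ : Measure α} {f : ℕ → α → G} {f₀ : α → G} (hf : ∀ k, AEStronglyMeasurable (f k) μ)
    (hf₀ : AEStronglyMeasurable f₀ μ) (h : Tendsto (fun k => eLpNorm (f k - f₀) 2 μ) atTop (𝓝 0))
    {A C : ℝ≥0∞} (hC : C ≠ ⊤) {a : ℕ → ℝ≥0∞} (hA : A ≤ liminf a atTop)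
    (ha : ∀ k, a k ≤ C * eLpNorm (f k) 2 μ) : A ≤ C * eLpNorm f₀ 2 μ := by
  have h1 : Tendsto (fun k => C * (eLpNorm (f k - f₀) 2 μ + eLpNorm f₀ 2 μ)) atTop
      (𝓝 (C * (0 + eLpNorm f₀ 2 μ))) :=
    ENNReal.Tendsto.const_mul (h.add_const _) (Or.inr hC)
  rw [zero_add] at h1
  refine hA.trans (le_trans (liminf_le_liminf (Eventually.of_forall fun k => ?_)) h1.liminf_eq.le)
  refine (ha k).trans ?_
  gcongr
  calc eLpNorm (f k) 2 μ = eLpNorm (f k - f₀ + f₀) 2 μ := by rw [sub_add_cancel]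
    _ ≤ _ := eLpNorm_add_le ((hf k).sub hf₀) hf₀ (by norm_num)

/-- The Sobolev conjugate of `2` in dimension `n`. -/
noncomputable def sobExp (n : ℕ) : NNReal := Real.toNNReal (2 * n / (n - 2))

/-- This is `∇(ζ v_k) → ∇(ζ w)` in `L²`, the convergence needed to carry the Sobolev inequality from
smooth approximants to `w`. -/
theorem tendsto_eLpNorm_smul_egrad_add {ζ : Eu n → ℝ} (hζ : ContDiff ℝ 1 ζ)
    (hc : HasCompactSupport ζ) {v : ℕ → Eu n → ℝ} {w : Eu n → ℝ} {Dw : Eu n → Eu n}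
    (hv1' : ∀ k, ContDiff ℝ 1 (v k))
    (hu : AEStronglyMeasurable w (volume.restrict (tsupport ζ)))
    (hD : AEStronglyMeasurable Dw (volume.restrict (tsupport ζ)))
    (hv1 : Tendsto (fun k => eLpNorm (v k - w) 2 (volume.restrict (tsupport ζ))) atTop (𝓝 0))
    (hv2 : Tendsto (fun k => eLpNorm (egrad (v k) - Dw) 2 (volume.restrict (tsupport ζ))) atTop
      (𝓝 0)) :
    Tendsto (fun k => eLpNorm ((fun x => ζ x • egrad (v k) x + v k x • egrad ζ x) -
        fun x => ζ x • Dw x + w x • egrad ζ x) 2) atTop (𝓝 0) := by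
  have hK := hc.isCompact
  have hge : Continuous (egrad ζ) := continuous_egrad hζ
  have hgc : HasCompactSupport (egrad ζ) :=
    HasCompactSupport.of_support_subset_isCompact hK fun x hx =>
      by_contra fun hxK => hx (egrad_eq_zero_of_notMem hxK)
  obtain ⟨C, hC⟩ := exists_norm_le_of_hasCompactSupport hζ.continuous hc
  obtain ⟨C', hC'⟩ := exists_norm_le_of_hasCompactSupport hge hgc
  have h0 : Tendsto (fun k => ENNReal.ofReal C *
      eLpNorm (egrad (v k) - Dw) 2 (volume.restrict (tsupport ζ)) +
      ENNReal.ofReal C' * eLpNorm (v k - w) 2 (volume.restrict (tsupport ζ))) atTop (𝓝 0) := by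
    have := (ENNReal.Tendsto.const_mul hv2 (a := ENNReal.ofReal C)
      (Or.inr ENNReal.ofReal_ne_top)).add (ENNReal.Tendsto.const_mul hv1 (a := ENNReal.ofReal C')
      (Or.inr ENNReal.ofReal_ne_top))
    simpa using this
  refine tendsto_of_tendsto_of_tendsto_of_le_of_le tendsto_const_nhds h0 (fun _ => zero_le)
    fun k => ?_
  have hsupp : ∀ x ∉ tsupport ζ, ((fun x => ζ x • egrad (v k) x + v k x • egrad ζ x) -
      fun x => ζ x • Dw x + w x • egrad ζ x) x = 0 := fun x hx => by
    simp [image_eq_zero_of_notMem_tsupport hx, egrad_eq_zero_of_notMem hx]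
  have e0 : ((fun x => ζ x • egrad (v k) x + v k x • egrad ζ x) -
      fun x => ζ x • Dw x + w x • egrad ζ x) =
      (fun x => ζ x • (egrad (v k) - Dw) x) + fun x => (v k - w) x • egrad ζ x := by
    ext1 x
    simp only [Pi.sub_apply, Pi.add_apply, smul_sub, sub_smul]
    abel
  have hmD : AEStronglyMeasurable (egrad (v k) - Dw) (volume.restrict (tsupport ζ)) :=
    (continuous_egrad (hv1' k)).aestronglyMeasurable.sub hD
  have hmu : AEStronglyMeasurable (v k - w) (volume.restrict (tsupport ζ)) :=
    (hv1' k).continuous.aestronglyMeasurable.sub hu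
  rw [← (Set.indicator_eq_self (s := tsupport ζ)).2 (fun x hx => by_contra fun hxK =>
    hx (hsupp x hxK)), eLpNorm_indicator_eq_eLpNorm_restrict hK.measurableSet, e0]
  refine (eLpNorm_add_le (hζ.continuous.aestronglyMeasurable.smul hmD)
    (hmu.smul hge.aestronglyMeasurable) (by norm_num)).trans (add_le_add ?_ ?_)
  · refine eLpNorm_le_mul_eLpNorm_of_ae_le_mul (Eventually.of_forall fun x => ?_) 2
    rw [Pi.smul_apply', norm_smul]; gcongr; exact hC x
  · refine eLpNorm_le_mul_eLpNorm_of_ae_le_mul (Eventually.of_forall fun x => ?_) 2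
    rw [Pi.smul_apply', norm_smul, mul_comm]; gcongr; exact hC' x

/-- The constant of the Sobolev inequality for `W^{1,2}` in dimension `n`. -/
noncomputable def sobConst (n : ℕ) : NNReal :=
  SNormLESNormFDerivOfEqConst ℝ (volume : Measure (Eu n)) ((2 : NNReal) : ℝ)

theorem eLpNorm_sobExp_le (hn : 3 ≤ n) {f : Eu n → ℝ} (hf : ContDiff ℝ 1 f)
    (hc : HasCompactSupport f) : eLpNorm f (sobExp n) ≤ sobConst n * eLpNorm (egrad f) 2 := by
  have hn' : (3 : ℝ) ≤ n := by exact_mod_cast hn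
  have h1 : (n : ℝ) ≠ 0 := by linarith
  have h2 : (n : ℝ) - 2 ≠ 0 := by linarith
  have hp : ((sobExp n : NNReal) : ℝ)⁻¹ =
      ((2 : NNReal) : ℝ)⁻¹ - (Module.finrank ℝ (Eu n) : ℝ)⁻¹ := by
    rw [finrank_euclideanSpace_fin, sobExp, Real.coe_toNNReal _
      (div_nonneg (by linarith) (by linarith))]
    push_cast
    field_simp
  have key := eLpNorm_le_eLpNorm_fderiv_of_eq (F := ℝ) (volume : Measure (Eu n)) hf hc
    (p := 2) (p' := sobExp n) (by norm_num) (by rw [finrank_euclideanSpace_fin]; omega) hp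
  have h3 : eLpNorm (egrad f) 2 = eLpNorm (fderiv ℝ f) ((2 : NNReal) : ℝ≥0∞) volume := by
    rw [ENNReal.coe_ofNat]
    exact eLpNorm_congr_norm_ae (Eventually.of_forall fun x => norm_egrad _ x)
  rw [h3]
  exact key

/-- The Sobolev inequality for the product of a `W^{1,2}_loc` function and a cutoff. -/
theorem MemW12loc.eLpNorm_mul_le {Ω : Set (Eu n)} (hn : 3 ≤ n) (hΩ : IsOpen Ω) {w : Eu n → ℝ}
    {Dw : Eu n → Eu n} (h : MemW12loc Ω w Dw) {ζ : Eu n → ℝ} (hζ : ContDiff ℝ ∞ ζ)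
    (hc : HasCompactSupport ζ) (hs : tsupport ζ ⊆ Ω) :
    eLpNorm (fun x => ζ x * w x) (sobExp n) ≤
      sobConst n * eLpNorm (fun x => ζ x • Dw x + w x • egrad ζ x) 2 := by
  have hζ1 : ContDiff ℝ 1 ζ := hζ.of_le (by exact_mod_cast le_top)
  have hK := hc.isCompact
  obtain ⟨v, hv, hv1, hv2, hv3, -⟩ := h.exists_smooth_approx hΩ hK hs
  have hv1' : ∀ k, ContDiff ℝ 1 (v k) := fun k => (hv k).of_le (by exact_mod_cast le_top)
  obtain ⟨-, hm1, hm2⟩ := h.smooth_mul hζ hc hs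
  have hgr : ∀ k, egrad (fun x => ζ x * v k x) = fun x => ζ x • egrad (v k) x + v k x • egrad ζ x :=
    fun k => funext fun x => egrad_mul (hζ1.differentiable one_ne_zero x)
      ((hv1' k).differentiable one_ne_zero x)
  have hge : Continuous (egrad ζ) := continuous_egrad hζ1
  have hcont : ∀ k, Continuous fun x => ζ x • egrad (v k) x + v k x • egrad ζ x := fun k =>
    (hζ.continuous.smul (continuous_egrad (hv1' k))).add ((hv k).continuous.smul hge)
  have hu := (h.2 _ hK hs).1
  have hD := (h.2 _ hK hs).2
  have hae : ∀ᵐ x, Tendsto (fun k => ζ x * v k x) atTop (𝓝 (ζ x * w x)) := by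
    rw [ae_restrict_iff' hK.measurableSet] at hv3
    filter_upwards [hv3] with x hx
    by_cases hxK : x ∈ tsupport ζ
    · exact (hx hxK).const_mul _
    · simp [image_eq_zero_of_notMem_tsupport hxK]
  have hfatou : eLpNorm (fun x => ζ x * w x) (sobExp n) volume ≤
      liminf (fun k => eLpNorm (fun x => ζ x * v k x) (sobExp n) volume) atTop :=
    Lp.eLpNorm_lim_le_liminf_eLpNorm (f := fun k x => ζ x * v k x)
      (fun k => (hζ.continuous.mul (hv k).continuous).aestronglyMeasurable) _ hae
  have hbound : ∀ k, eLpNorm (fun x => ζ x * v k x) (sobExp n) volume ≤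
      sobConst n * eLpNorm (fun x => ζ x • egrad (v k) x + v k x • egrad ζ x) 2 volume := by
    intro k
    rw [← hgr k]
    exact eLpNorm_sobExp_le hn (hζ1.mul (hv1' k)) hc.mul_right
  exact le_mul_eLpNorm_of_le_liminf (fun k => (hcont k).aestronglyMeasurable) hm2.1
    (tendsto_eLpNorm_smul_egrad_add hζ1 hc hv1' hu.1 hD.1 hv1 hv2) ENNReal.coe_ne_top hfatou hbound

theorem lintegral_comp_smul_add {r : ℝ} (hr : r ≠ 0) (b : Eu n) {G : Eu n → ℝ≥0∞}
    (hG : Measurable G) :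
    ∫⁻ x, G (r • x + b) = ENNReal.ofReal |(r ^ n)⁻¹| * ∫⁻ x, G x := by
  have h1 := lintegral_map (μ := (volume : Measure (Eu n))) (f := fun x => G (x + b))
    (g := fun x : Eu n => r • x) (hG.comp (measurable_add_const b)) (measurable_const_smul r)
  rw [← h1, Measure.map_addHaar_smul _ hr, lintegral_smul_measure,
    lintegral_add_right_eq_self G b, finrank_euclideanSpace_fin, smul_eq_mul]

/-- Only half of the segment is integrated, so that `1 - t ≥ 1 / 2` and the change of variables in
`x` used below stays nondegenerate. -/
theorem enorm_sub_midpoint_le {v : Eu n → ℝ} (hv : ContDiff ℝ 1 v) (x y : Eu n) :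
    ‖v x - v (midpoint ℝ x y)‖ₑ ≤ ‖y - x‖ₑ *
      ∫⁻ t in Set.Ioc (0 : ℝ) (1 / 2), ‖fderiv ℝ v ((1 - t) • x + t • y)‖ₑ := by
  have hd : ∀ t : ℝ, HasDerivAt (fun t : ℝ => v ((1 - t) • x + t • y))
      (fderiv ℝ v ((1 - t) • x + t • y) (y - x)) t := by
    intro t
    have h1 : HasDerivAt (fun t : ℝ => (1 - t) • x + t • y) (y - x) t := by
      have := (((hasDerivAt_id t).const_sub 1).smul_const x).fun_add
        ((hasDerivAt_id t).smul_const y)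
      exact HasDerivAt.congr_deriv this (by simp [sub_eq_neg_add])
    exact (hv.differentiable one_ne_zero _).hasFDerivAt.comp_hasDerivAt t h1
  have hcont : Continuous fun t : ℝ => fderiv ℝ v ((1 - t) • x + t • y) (y - x) :=
    ((hv.continuous_fderiv one_ne_zero).comp (by fun_prop)).clm_apply continuous_const
  have key := intervalIntegral.integral_eq_sub_of_hasDerivAt (a := 0) (b := 1 / 2)
    (fun t _ => hd t) (hcont.intervalIntegrable _ _)
  have hm : (1 - 1 / 2 : ℝ) • x + (1 / 2 : ℝ) • y = midpoint ℝ x y := by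
    rw [midpoint_eq_smul_add, smul_add]; norm_num
  rw [hm] at key
  simp only [sub_zero, one_smul, zero_smul, add_zero] at key
  rw [← enorm_neg, neg_sub, ← key, intervalIntegral.integral_of_le (by norm_num),
    ← lintegral_const_mul' _ _ enorm_ne_top]
  refine (enorm_integral_le_lintegral_enorm _).trans (lintegral_mono fun t => ?_)
  rw [mul_comm]
  exact ContinuousLinearMap.le_opENorm _ _

theorem convex_cube (c : Eu n) (l : ℝ) : Convex ℝ (cube c l) := by
  have : cube c l = ⋂ i, (fun x : Eu n => x i) ⁻¹' Set.Icc (c i) (c i + l) := by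
    ext x; simp [cube]
  rw [this]
  refine convex_iInter fun i => ?_
  exact (convex_Icc _ _).linear_preimage (EuclideanSpace.proj i : Eu n →L[ℝ] ℝ).toLinearMap

theorem norm_le_of_abs_coord_le {x : Eu n} {r : ℝ} (hr : 0 ≤ r) (h : ∀ i, |x i| ≤ r) :
    ‖x‖ ≤ n * r := by
  rw [EuclideanSpace.norm_eq, Real.sqrt_le_left (by positivity)]
  have h1 : ∑ i, ‖x i‖ ^ 2 ≤ ∑ _i : Fin n, r ^ 2 :=
    Finset.sum_le_sum fun i _ => by rw [Real.norm_eq_abs]; gcongr; exact h i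
  refine h1.trans ?_
  rw [Finset.sum_const, Finset.card_univ, Fintype.card_fin, nsmul_eq_mul, mul_pow]
  have : (n : ℝ) ≤ (n : ℝ) ^ 2 := by exact_mod_cast Nat.le_self_pow two_ne_zero n
  gcongr

theorem norm_sub_le_of_mem_cube {c : Eu n} {l : ℝ} (hl : 0 ≤ l) {x y : Eu n} (hx : x ∈ cube c l)
    (hy : y ∈ cube c l) : ‖y - x‖ ≤ n * l := by
  refine norm_le_of_abs_coord_le hl fun i => ?_
  have h1 := hx i
  have h2 := hy i
  rw [PiLp.sub_apply, abs_le]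
  constructor <;> linarith [h1.1, h1.2, h2.1, h2.2]

/-- Both `x` and `y` are compared with their midpoint, and by symmetry the two contributions are
equal. For `t ≤ 1 / 2` the map `x ↦ (1 - t) x + t y` contracts volume by at most `2^{-n}`, and
convexity keeps the segment in the cube, so integrating in `x` first bounds the integrand by the
full integral of the gradient. -/
theorem lintegral_cube_enorm_sub_le {v : Eu n → ℝ} (hv : ContDiff ℝ 1 v) (c : Eu n) {l : ℝ}
    (hl : 0 < l) :
    ∫⁻ x in cube c l, ∫⁻ y in cube c l, ‖v x - v y‖ₑ ≤
      ENNReal.ofReal (n * l) * 2 ^ n * volume (cube c l) * ∫⁻ x in cube c l, ‖egrad v x‖ₑ := by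
  set Q := cube c l
  have hQ : MeasurableSet Q := measurableSet_cube c l
  set G : Eu n → ℝ≥0∞ := Q.indicator fun x => ‖fderiv ℝ v x‖ₑ with hGdef
  have hG : Measurable G := (hv.continuous_fderiv one_ne_zero).enorm.measurable.indicator hQ
  have hGint : ∫⁻ x, G x = ∫⁻ x in Q, ‖egrad v x‖ₑ := by
    rw [lintegral_indicator hQ]
    refine lintegral_congr fun x => ?_
    rw [← ofReal_norm, ← ofReal_norm, norm_egrad]
  set T : Set ℝ := Set.Ioc (0 : ℝ) (1 / 2)
  have hpt : ∀ x ∈ Q, ∀ y ∈ Q, ‖v x - v (midpoint ℝ x y)‖ₑ ≤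
      ENNReal.ofReal (n * l) * ∫⁻ t in T, G ((1 - t) • x + t • y) := by
    intro x hx y hy
    refine (enorm_sub_midpoint_le hv x y).trans (mul_le_mul' ?_ (le_of_eq ?_))
    · rw [← ofReal_norm]
      exact ENNReal.ofReal_le_ofReal (norm_sub_le_of_mem_cube hl.le hx hy)
    · refine setLIntegral_congr_fun measurableSet_Ioc fun t ht => ?_
      simp only [hGdef]
      rw [Set.indicator_of_mem]
      exact convex_cube c l hx hy (by linarith [ht.1, ht.2]) ht.1.le (by ring)
  have hjoint : Measurable fun p : (Eu n × Eu n) × ℝ => G ((1 - p.2) • p.1.1 + p.2 • p.1.2) :=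
    hG.comp (by fun_prop)
  have htwo : ∀ t ∈ T, ∀ y, ∫⁻ x in Q, G ((1 - t) • x + t • y) ≤ 2 ^ n * ∫⁻ x, G x := by
    intro t ht y
    refine (setLIntegral_le_lintegral _ _).trans ?_
    rw [lintegral_comp_smul_add (by linarith [ht.2]) _ hG]
    gcongr
    have h1 : (1 / 2 : ℝ) ≤ 1 - t := by linarith [ht.2]
    have h2 : |((1 - t) ^ n)⁻¹| ≤ 2 ^ n := by
      rw [abs_of_nonneg (inv_nonneg.2 (pow_nonneg (by linarith) _)), ← inv_pow]
      refine pow_le_pow_left₀ (inv_nonneg.2 (by linarith)) ?_ n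
      rw [inv_le_comm₀ (by linarith) (by norm_num)]; linarith
    refine (ENNReal.ofReal_le_ofReal h2).trans (le_of_eq ?_)
    rw [ENNReal.ofReal_pow (by norm_num)]; simp
  have hmid : ∫⁻ y in Q, ∫⁻ x in Q, ‖v x - v (midpoint ℝ x y)‖ₑ ≤
      ENNReal.ofReal (n * l) * (volume Q * (ENNReal.ofReal (1 / 2) * (2 ^ n * ∫⁻ x, G x))) := by
    calc ∫⁻ y in Q, ∫⁻ x in Q, ‖v x - v (midpoint ℝ x y)‖ₑ
        ≤ ∫⁻ y in Q, ∫⁻ x in Q, ENNReal.ofReal (n * l) * ∫⁻ t in T, G ((1 - t) • x + t • y) :=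
          setLIntegral_mono' hQ fun y hy => setLIntegral_mono' hQ fun x hx => hpt x hx y hy
      _ = ∫⁻ y in Q, ENNReal.ofReal (n * l) * ∫⁻ t in T, ∫⁻ x in Q, G ((1 - t) • x + t • y) := by
          refine lintegral_congr fun y => ?_
          rw [lintegral_const_mul' _ _ ENNReal.ofReal_ne_top, lintegral_lintegral_swap]
          exact (hjoint.comp (by fun_prop : Measurable fun q : Eu n × ℝ =>
            ((q.1, y), q.2))).aemeasurable
      _ ≤ ∫⁻ y in Q, ENNReal.ofReal (n * l) * ∫⁻ t in T, 2 ^ n * ∫⁻ x, G x := by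
          refine lintegral_mono fun y => ?_
          exact mul_le_mul' le_rfl (setLIntegral_mono' measurableSet_Ioc fun t ht => htwo t ht y)
      _ = _ := by
          rw [setLIntegral_const, setLIntegral_const, Real.volume_Ioc, sub_zero]
          ring
  have hvc := hv.continuous
  have hvm : Measurable v := hvc.measurable
  have hmm : Measurable fun p : Eu n × Eu n => ‖v p.1 - v (midpoint ℝ p.1 p.2)‖ₑ := by
    have : Continuous fun p : Eu n × Eu n => midpoint ℝ p.1 p.2 := by
      simp_rw [midpoint_eq_smul_add]; fun_prop
    exact ((hvc.comp continuous_fst).sub (hvc.comp this)).enorm.measurable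
  have hmid' : ∫⁻ x in Q, ∫⁻ y in Q, ‖v x - v (midpoint ℝ x y)‖ₑ =
      ∫⁻ y in Q, ∫⁻ x in Q, ‖v x - v (midpoint ℝ x y)‖ₑ :=
    lintegral_lintegral_swap hmm.aemeasurable
  calc ∫⁻ x in Q, ∫⁻ y in Q, ‖v x - v y‖ₑ
      ≤ ∫⁻ x in Q, ((∫⁻ y in Q, ‖v x - v (midpoint ℝ x y)‖ₑ) +
          ∫⁻ y in Q, ‖v y - v (midpoint ℝ y x)‖ₑ) := by
        refine lintegral_mono fun x => ?_
        rw [← lintegral_add_left (f := fun y => ‖v x - v (midpoint ℝ x y)‖ₑ)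
          (hmm.comp (by fun_prop : Measurable fun y : Eu n => (x, y)))]
        refine lintegral_mono fun y => ?_
        rw [midpoint_comm (R := ℝ) y x, ← edist_eq_enorm_sub, ← edist_eq_enorm_sub,
          ← edist_eq_enorm_sub]
        exact edist_triangle_right _ _ _
    _ = (∫⁻ x in Q, ∫⁻ y in Q, ‖v x - v (midpoint ℝ x y)‖ₑ) +
        ∫⁻ x in Q, ∫⁻ y in Q, ‖v y - v (midpoint ℝ y x)‖ₑ :=
        lintegral_add_left (Measurable.lintegral_prod_right' hmm) _
    _ ≤ _ := by
        rw [hmid']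
        refine (add_le_add hmid hmid).trans (le_of_eq ?_)
        rw [hGint, ← two_mul]
        have : (2 : ℝ≥0∞) * ENNReal.ofReal (1 / 2) = 1 := by
          rw [← ENNReal.ofReal_ofNat, ← ENNReal.ofReal_mul (by norm_num)]; norm_num
        calc _ = (2 * ENNReal.ofReal (1 / 2)) * (ENNReal.ofReal (n * l) * 2 ^ n * volume Q *
              ∫⁻ x in Q, ‖egrad v x‖ₑ) := by ring
          _ = _ := by rw [this, one_mul]

theorem isCompact_cube (c : Eu n) (l : ℝ) : IsCompact (cube c l) := by
  rw [cube_eq_preimage]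
  exact ((PiLp.homeomorph 2 (fun _ : Fin n => ℝ)).isCompact_preimage).2 isCompact_Icc

theorem volume_cube_ne_zero (c : Eu n) {l : ℝ} (hl : 0 < l) : volume (cube c l) ≠ 0 := by
  rw [volume_cube c hl.le]; simp; positivity

theorem volume_cube_ne_top (c : Eu n) (l : ℝ) : volume (cube c l) ≠ ⊤ :=
  (isCompact_cube c l).measure_lt_top.ne

theorem lintegral_cube_enorm_sub_average_le {v : Eu n → ℝ} (hv : ContDiff ℝ 1 v) (c : Eu n) {l : ℝ}
    (hl : 0 < l) :
    ∫⁻ x in cube c l, ‖v x - ⨍ y in cube c l, v y‖ₑ ≤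
      ENNReal.ofReal (n * l) * 2 ^ n * ∫⁻ x in cube c l, ‖egrad v x‖ₑ := by
  set Q := cube c l
  have hQ0 := volume_cube_ne_zero c hl
  have hQt := volume_cube_ne_top c l
  have hint : IntegrableOn v Q := hv.continuous.continuousOn.integrableOn_compact (isCompact_cube c l)
  have hpt : ∀ x, ‖v x - ⨍ y in Q, v y‖ₑ ≤ (volume Q)⁻¹ * ∫⁻ y in Q, ‖v x - v y‖ₑ := by
    intro x
    have hc : IntegrableOn (fun _ : Eu n => v x) Q := integrableOn_const hQt enorm_ne_top
    have h1 : v x - ⨍ y in Q, v y = (volume.real Q)⁻¹ * ∫ y in Q, (v x - v y) := by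
      rw [integral_sub hc hint, setAverage_eq, setIntegral_const, smul_eq_mul, smul_eq_mul, mul_sub,
        inv_mul_cancel_left₀]
      exact (ENNReal.toReal_pos hQ0 hQt).ne'
    rw [h1, enorm_mul]
    refine mul_le_mul' (le_of_eq ?_) (enorm_integral_le_lintegral_enorm _)
    rw [Real.enorm_of_nonneg (by positivity), measureReal_def, ENNReal.ofReal_inv_of_pos
      (ENNReal.toReal_pos hQ0 hQt), ENNReal.ofReal_toReal hQt]
  calc ∫⁻ x in Q, ‖v x - ⨍ y in Q, v y‖ₑ
      ≤ ∫⁻ x in Q, (volume Q)⁻¹ * ∫⁻ y in Q, ‖v x - v y‖ₑ := lintegral_mono hpt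
    _ = (volume Q)⁻¹ * ∫⁻ x in Q, ∫⁻ y in Q, ‖v x - v y‖ₑ :=
        lintegral_const_mul' _ _ (ENNReal.inv_ne_top.2 hQ0)
    _ ≤ (volume Q)⁻¹ * (ENNReal.ofReal (n * l) * 2 ^ n * volume Q *
          ∫⁻ x in Q, ‖egrad v x‖ₑ) := by
        gcongr; exact lintegral_cube_enorm_sub_le hv c hl
    _ = ((volume Q)⁻¹ * volume Q) * (ENNReal.ofReal (n * l) * 2 ^ n *
          ∫⁻ x in Q, ‖egrad v x‖ₑ) := by ring
    _ = _ := by rw [ENNReal.inv_mul_cancel hQ0 hQt, one_mul]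

theorem lintegral_enorm_le_mul_eLpNorm_two {G : Type*} [NormedAddCommGroup G] {μ : Measure (Eu n)}
    {f : Eu n → G} (hf : AEStronglyMeasurable f μ) :
    ∫⁻ x, ‖f x‖ₑ ∂μ ≤ μ Set.univ ^ (1 / 2 : ℝ) * eLpNorm f 2 μ := by
  have := eLpNorm_le_eLpNorm_mul_rpow_measure_univ (p := 1) (q := 2) (by norm_num) hf
  rw [eLpNorm_one_eq_lintegral_enorm, mul_comm] at this
  refine this.trans (le_of_eq ?_)
  norm_num

/-- The Poincaré inequality on cubes for `W^{1,2}_loc` functions. -/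
theorem MemW12loc.poincare {Ω : Set (Eu n)} (hΩ : IsOpen Ω) {w : Eu n → ℝ} {Dw : Eu n → Eu n}
    (h : MemW12loc Ω w Dw) {c : Eu n} {l : ℝ} (hl : 0 < l) (hs : cube c l ⊆ Ω) :
    ∫⁻ x in cube c l, ‖w x - ⨍ y in cube c l, w y‖ₑ ≤
      ENNReal.ofReal (n * l) * 2 ^ n * volume (cube c l) ^ (1 / 2 : ℝ) *
        eLpNorm Dw 2 (volume.restrict (cube c l)) := by
  have hQ := isCompact_cube c l
  have := isFiniteMeasure_restrict_of_isCompact hQ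
  obtain ⟨v, hv, hv1, hv2, hv3, -⟩ := h.exists_smooth_approx hΩ hQ hs
  have hv1' : ∀ k, ContDiff ℝ 1 (v k) := fun k => (hv k).of_le (by exact_mod_cast le_top)
  obtain ⟨hw, hD⟩ := h.2 _ hQ hs
  have hvt := volume_cube_ne_top c l
  refine le_mul_eLpNorm_of_le_liminf (f := fun k => egrad (v k))
    (fun k => (continuous_egrad (hv1' k)).aestronglyMeasurable) hD.1 hv2 (by finiteness)
    (a := fun k => ∫⁻ x in cube c l, ‖v k x - ⨍ y in cube c l, v k y‖ₑ) ?_ fun k => ?_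
  · have hav : Tendsto (fun k => ⨍ y in cube c l, v k y) atTop (𝓝 (⨍ y in cube c l, w y)) := by
      have := tendsto_integral_mul_of_eLpNorm_two (ψ := fun _ => (1 : ℝ))
        (fun k => memLp_of_continuous_of_isCompact hQ (hv k).continuous 2) hw (memLp_const 1) hv1
      simp only [mul_one] at this
      simp only [setAverage_eq]
      exact this.const_smul _
    have hlim : ∀ᵐ x ∂volume.restrict (cube c l), ‖w x - ⨍ y in cube c l, w y‖ₑ =
        liminf (fun k => ‖v k x - ⨍ y in cube c l, v k y‖ₑ) atTop := by
      filter_upwards [hv3] with x hx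
      exact ((hx.sub hav).enorm).liminf_eq.symm
    rw [lintegral_congr_ae hlim]
    exact lintegral_liminf_le fun k =>
      ((hv k).continuous.measurable.sub_const _).enorm
  · refine (lintegral_cube_enorm_sub_average_le (hv1' k) c hl).trans ?_
    rw [mul_assoc _ (volume (cube c l) ^ (1 / 2 : ℝ))]
    gcongr
    have := lintegral_enorm_le_mul_eLpNorm_two (μ := volume.restrict (cube c l))
      (continuous_egrad (hv1' k)).aestronglyMeasurable
    rwa [Measure.restrict_apply_univ] at this

end BMOElliptic

/-! ### The skew pairing and the Caccioppoli inequality. -/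

namespace BMOElliptic

variable {n : ℕ}

theorem matForm_add_right (M : Matrix (Fin n) (Fin n) ℝ) (p q q' : Eu n) :
    matForm M p (q + q') = matForm M p q + matForm M p q' := by
  simp only [matForm, PiLp.add_apply, mul_add, Finset.sum_add_distrib]

theorem matForm_smul_right (M : Matrix (Fin n) (Fin n) ℝ) (p q : Eu n) (s : ℝ) :
    matForm M p (s • q) = s * matForm M p q := by
  simp only [matForm, PiLp.smul_apply, smul_eq_mul, Finset.mul_sum]
  exact Finset.sum_congr rfl fun i _ => Finset.sum_congr rfl fun j _ => by ring

theorem skewForm_eq (M : Matrix (Fin n) (Fin n) ℝ) (p q : Eu n) :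
    skewForm M p q = 1 / 2 * (matForm M p q - matForm M q p) := by
  simp only [skewForm, matForm, ← Finset.sum_sub_distrib]
  congr 1
  exact Finset.sum_congr rfl fun i _ => Finset.sum_congr rfl fun j _ => by ring

theorem abs_matForm_le (M : Matrix (Fin n) (Fin n) ℝ) (p q : Eu n) :
    |matForm M p q| ≤ (∑ i, ∑ j, |M i j|) * (‖p‖ * ‖q‖) := by
  simp only [matForm, Finset.sum_mul]
  refine (Finset.abs_sum_le_sum_abs _ _).trans (Finset.sum_le_sum fun i _ => ?_)
  refine (Finset.abs_sum_le_sum_abs _ _).trans (Finset.sum_le_sum fun j _ => ?_)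
  rw [abs_mul, abs_mul, mul_assoc]
  gcongr
  · exact PiLp.norm_apply_le p j
  · exact PiLp.norm_apply_le q i

theorem abs_skewForm_le (M : Matrix (Fin n) (Fin n) ℝ) (p q : Eu n) :
    |skewForm M p q| ≤ (∑ i, ∑ j, |M i j|) * (‖p‖ * ‖q‖) := by
  rw [skewForm_eq, abs_mul, abs_of_pos (by norm_num : (0 : ℝ) < 1 / 2)]
  have h1 := abs_matForm_le M p q
  have h2 := abs_matForm_le M q p
  rw [mul_comm ‖q‖] at h2
  have h3 := abs_sub (matForm M p q) (matForm M q p)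
  linarith

/-- The cancellation on which everything rests: the component of the test gradient parallel to `∇u`
is invisible to the skew form. -/
theorem skewForm_smul_add (M : Matrix (Fin n) (Fin n) ℝ) (p q : Eu n) (s : ℝ) :
    skewForm M p (s • p + q) = skewForm M p q := by
  simp only [skewForm, PiLp.add_apply, PiLp.smul_apply, smul_eq_mul]
  congr 1
  exact Finset.sum_congr rfl fun i _ => Finset.sum_congr rfl fun j _ => by ring

theorem skewForm_sub_left (M M' : Matrix (Fin n) (Fin n) ℝ) (p q : Eu n) :
    skewForm (M - M') p q = skewForm M p q - skewForm M' p q := by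
  simp only [skewForm, Matrix.sub_apply, sub_mul, Finset.sum_sub_distrib]
  ring

theorem abs_truncMat_sub_le (N : ℕ) (M M' : Matrix (Fin n) (Fin n) ℝ) (i j : Fin n) :
    |(truncMat N M - truncMat N M') i j| ≤ |M i j - M' i j| := by
  simp only [Matrix.sub_apply, truncMat]
  rw [max_comm, max_comm (-(N : ℝ)), min_comm, min_comm (N : ℝ) (M' i j)]
  exact (abs_sup_sub_sup_le_abs _ _ _).trans (abs_inf_sub_inf_le_abs _ _ _)

theorem abs_truncMat_le (N : ℕ) (M : Matrix (Fin n) (Fin n) ℝ) (i j : Fin n) :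
    |truncMat N M i j| ≤ N := by
  have hN : (0 : ℝ) ≤ N := Nat.cast_nonneg N
  rw [truncMat, abs_le]
  exact ⟨le_max_left _ _, max_le (by linarith) (min_le_left _ _)⟩

theorem integrableOn_coord_mul {Ω K : Set (Eu n)} {p q : Eu n → Eu n} (hK : MeasurableSet K)
    (hp : MemLp p 2 (volume.restrict K)) (hq : MemLp q 2 (volume.restrict K))
    (h0 : ∀ x ∉ K, q x = 0) (i j : Fin n) : IntegrableOn (fun x => p x j * q x i) Ω := by
  have h1 : IntegrableOn (fun x => p x j * q x i) K :=
    (memLp_coord hp j).integrable_mul (memLp_coord hq i)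
  exact (integrable_of_restrict hK h1 fun x hx => by rw [h0 x hx]; simp).integrableOn

theorem integrableOn_coeff_mul {Ω K : Set (Eu n)} {p q : Eu n → Eu n} (hK : MeasurableSet K)
    (hp : MemLp p 2 (volume.restrict K)) (hq : MemLp q 2 (volume.restrict K))
    (h0 : ∀ x ∉ K, q x = 0) {A : Eu n → ℝ} {C : ℝ}
    (hA : AEStronglyMeasurable A (volume.restrict Ω))
    (hC : ∀ᵐ x ∂volume.restrict Ω, |A x| ≤ C) (i j : Fin n) :
    IntegrableOn (fun x => A x * (p x j * q x i)) Ω :=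
  (integrableOn_coord_mul hK hp hq h0 i j).bdd_mul hA hC

theorem integrableOn_matForm {Ω K : Set (Eu n)} {p q : Eu n → Eu n} (hK : MeasurableSet K)
    (hp : MemLp p 2 (volume.restrict K)) (hq : MemLp q 2 (volume.restrict K))
    (h0 : ∀ x ∉ K, q x = 0) {A : Eu n → Matrix (Fin n) (Fin n) ℝ} {C : ℝ}
    (hA : ∀ i j, AEStronglyMeasurable (fun x => A x i j) (volume.restrict Ω))
    (hC : ∀ i j, ∀ᵐ x ∂volume.restrict Ω, |A x i j| ≤ C) :
    IntegrableOn (fun x => matForm (A x) (p x) (q x)) Ω := by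
  refine integrable_finsetSum _ fun i _ => integrable_finsetSum _ fun j _ => ?_
  refine (integrableOn_coeff_mul hK hp hq h0 (hA i j) (hC i j) i j).congr
    (Eventually.of_forall fun x => ?_)
  simp only []; ring

theorem integrableOn_skewForm {Ω K : Set (Eu n)} {p q : Eu n → Eu n} (hK : MeasurableSet K)
    (hp : MemLp p 2 (volume.restrict K)) (hq : MemLp q 2 (volume.restrict K))
    (h0 : ∀ x ∉ K, q x = 0) {A : Eu n → Matrix (Fin n) (Fin n) ℝ} {C : ℝ}
    (hA : ∀ i j, AEStronglyMeasurable (fun x => A x i j) (volume.restrict Ω))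
    (hC : ∀ i j, ∀ᵐ x ∂volume.restrict Ω, |A x i j| ≤ C) :
    IntegrableOn (fun x => skewForm (A x) (p x) (q x)) Ω := by
  refine Integrable.const_mul (integrable_finsetSum _ fun i _ => integrable_finsetSum _ fun j _ => ?_) _
  refine ((integrableOn_coeff_mul hK hp hq h0 (hA i j) (hC i j) i j).sub
    (integrableOn_coeff_mul hK hp hq h0 (hA i j) (hC i j) j i)).congr
    (Eventually.of_forall fun x => ?_)
  simp only [Pi.sub_apply]; ring

/-- The skew pairing of gradients with constant coefficients vanishes. -/
theorem integral_skewForm_const {Ω K : Set (Eu n)} (hΩ : IsOpen Ω) {u φ : Eu n → ℝ}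
    {g Dφ : Eu n → Eu n} (h : MemW12loc Ω u g) (hφ : MemW12 Ω φ Dφ) (hK : IsCompact K)
    (hKΩ : K ⊆ Ω) (h0 : ∀ x ∉ K, φ x = 0) (h0' : ∀ x ∉ K, Dφ x = 0)
    (M : Matrix (Fin n) (Fin n) ℝ) : ∫ x in Ω, skewForm M (g x) (Dφ x) = 0 := by
  have hp := (h.2 K hK hKΩ).2
  have hq : MemLp Dφ 2 (volume.restrict K) :=
    hφ.2.2.mono_measure (Measure.restrict_mono hKΩ le_rfl)
  have hint : ∀ i j, IntegrableOn (fun x => M i j * (g x j * Dφ x i - g x i * Dφ x j)) Ω :=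
    fun i j => ((integrableOn_coord_mul hK.measurableSet hp hq h0' i j).sub
      (integrableOn_coord_mul hK.measurableSet hp hq h0' j i)).const_mul _
  simp only [skewForm]
  rw [integral_const_mul, integral_finsetSum _ fun i _ => integrable_finsetSum _ fun j _ => hint i j]
  simp_rw [integral_finsetSum _ fun j _ => hint _ j, integral_const_mul,
    integral_curl_eq_zero hΩ h hφ hK hKΩ h0 h0']
  simp

/-- The truncated skew integrals differ from those of `b - c` by nothing, for constant `c`. -/
theorem enorm_skewIntegral_le {Ω K : Set (Eu n)} (hΩ : IsOpen Ω) {u φ : Eu n → ℝ}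
    {g Dφ V : Eu n → Eu n} {s : Eu n → ℝ} (h : MemW12loc Ω u g) (hφ : MemW12 Ω φ Dφ)
    (hK : IsCompact K) (hKΩ : K ⊆ Ω) (h0 : ∀ x ∉ K, φ x = 0) (h0' : ∀ x ∉ K, Dφ x = 0)
    (hV : ∀ x, Dφ x = s x • g x + V x)
    {b : Eu n → Matrix (Fin n) (Fin n) ℝ} (hb : ∀ i j, LocallyIntegrableOn (fun x => b x i j) Ω)
    (c : Matrix (Fin n) (Fin n) ℝ) {ℓ : ℝ} (hℓ : HasSkewIntegral Ω b g Dφ ℓ) :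
    ‖ℓ‖ₑ ≤ ∫⁻ x in Ω, ENNReal.ofReal ((∑ i, ∑ j, |b x i j - c i j|) * (‖g x‖ * ‖V x‖)) := by
  have hp := (h.2 K hK hKΩ).2
  have hq : MemLp Dφ 2 (volume.restrict K) :=
    hφ.2.2.mono_measure (Measure.restrict_mono hKΩ le_rfl)
  refine le_of_tendsto hℓ.enorm (Eventually.of_forall fun N => ?_)
  have hm : ∀ i j, AEStronglyMeasurable (fun x => truncMat N (b x) i j) (volume.restrict Ω) := by
    intro i j
    have h1 : AEStronglyMeasurable (fun x => b x i j) (volume.restrict Ω) :=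
      (hb i j).aestronglyMeasurable
    have h2 : Continuous fun t : ℝ => max (-(N : ℝ)) (min (N : ℝ) t) := by fun_prop
    exact h2.comp_aestronglyMeasurable h1
  have i1 := integrableOn_skewForm (Ω := Ω) hK.measurableSet hp hq h0' hm
    (fun i j => Eventually.of_forall fun x => abs_truncMat_le N (b x) i j)
  have i2 := integrableOn_skewForm (Ω := Ω) hK.measurableSet hp hq h0'
    (A := fun _ => truncMat N c) (fun i j => aestronglyMeasurable_const)
    (fun i j => Eventually.of_forall fun x => abs_truncMat_le N c i j)
  -- The truncation of a constant matrix is again constant, so its pairing vanishes and it can be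
  -- subtracted at each height `N`; the 1-Lipschitz bound `abs_truncMat_sub_le` then replaces the
  -- truncated difference by `|b - c|`, uniformly in `N`.
  have e : ∫ x in Ω, skewForm (truncMat N (b x)) (g x) (Dφ x) =
      ∫ x in Ω, skewForm (truncMat N (b x) - truncMat N c) (g x) (Dφ x) := by
    simp_rw [skewForm_sub_left]
    rw [integral_sub i1 i2, integral_skewForm_const hΩ h hφ hK hKΩ h0 h0', sub_zero]
  rw [e]
  refine (enorm_integral_le_lintegral_enorm _).trans (lintegral_mono fun x => ?_)
  rw [Real.enorm_eq_ofReal_abs, hV x, skewForm_smul_add]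
  refine ENNReal.ofReal_le_ofReal ((abs_skewForm_le _ _ _).trans ?_)
  refine mul_le_mul_of_nonneg_right (Finset.sum_le_sum fun i _ => Finset.sum_le_sum fun j _ => ?_)
    (by positivity)
  exact abs_truncMat_sub_le N _ _ i j

/-- The testing property in the definition of weak solutions. -/
def TestsWeakly (Ω : Set (Eu n)) (a b : Eu n → Matrix (Fin n) (Fin n) ℝ) (Du : Eu n → Eu n) :
    Prop :=
  ∀ (φ : Eu n → ℝ) (Dφ : Eu n → Eu n), MemW12 Ω φ Dφ → CompactlySupportedIn Ω φ →
    ∃ ℓ : ℝ, HasSkewIntegral Ω b Du Dφ ℓ ∧ (∫ x in Ω, matForm (a x) (Du x) (Dφ x)) + ℓ = 0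

/-- The weight in the Caccioppoli inequality. -/
noncomputable def oscWeight (Lam : ℝ) (b : Eu n → Matrix (Fin n) (Fin n) ℝ)
    (c : Matrix (Fin n) (Fin n) ℝ) (x : Eu n) : ℝ :=
  n ^ 2 * |Lam| + ∑ i, ∑ j, |b x i j - c i j|

theorem oscWeight_nonneg (Lam : ℝ) (b : Eu n → Matrix (Fin n) (Fin n) ℝ)
    (c : Matrix (Fin n) (Fin n) ℝ) (x : Eu n) : 0 ≤ oscWeight Lam b c x := by
  unfold oscWeight; positivity

theorem IsCoefficient.aestronglyMeasurable_oscWeight {Ω : Set (Eu n)} {lam Lam Gam : ℝ}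
    {a b : Eu n → Matrix (Fin n) (Fin n) ℝ} (hab : IsCoefficient Ω lam Lam Gam a b)
    (c : Matrix (Fin n) (Fin n) ℝ) :
    AEStronglyMeasurable (oscWeight Lam b c) (volume.restrict Ω) := by
  refine aestronglyMeasurable_const.add ?_
  refine Finset.aestronglyMeasurable_fun_sum _ fun i _ =>
    Finset.aestronglyMeasurable_fun_sum _ fun j _ => ?_
  exact ((hab.b_loc i j).aestronglyMeasurable.sub aestronglyMeasurable_const).norm

theorem IsCoefficient.sum_abs_le {Ω : Set (Eu n)} {lam Lam Gam : ℝ}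
    {a b : Eu n → Matrix (Fin n) (Fin n) ℝ} (hab : IsCoefficient Ω lam Lam Gam a b) :
    ∀ᵐ x ∂volume.restrict Ω, ∑ i, ∑ j, |a x i j| ≤ n ^ 2 * |Lam| := by
  have h := ae_all_iff.2 fun i => ae_all_iff.2 fun j => hab.a_bound i j
  filter_upwards [h] with x hx
  calc ∑ i, ∑ j, |a x i j| ≤ ∑ _i : Fin n, ∑ _j : Fin n, |Lam| :=
        Finset.sum_le_sum fun i _ => Finset.sum_le_sum fun j _ => (hx i j).trans (le_abs_self _)
    _ = n ^ 2 * |Lam| := by simp; ring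

/-- Cancelling one factor `X` is legitimate only if `X` is finite, so finiteness of the energy must
be known beforehand. -/
theorem le_mul_of_mul_sq_le {X Y : ℝ≥0∞} {l K : ℝ} (hl : 0 < l) (hX : X ≠ ⊤)
    (h : ENNReal.ofReal l * X ^ 2 ≤ ENNReal.ofReal K * (Y * X)) :
    X ≤ ENNReal.ofReal (K / l) * Y := by
  rcases eq_or_ne X 0 with rfl | hX0
  · exact zero_le
  have hl0 : ENNReal.ofReal l ≠ 0 := by simpa using hl
  have h1 : ENNReal.ofReal l * X * X ≤ ENNReal.ofReal K * Y * X := by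
    calc _ = ENNReal.ofReal l * X ^ 2 := by ring
      _ ≤ _ := h
      _ = _ := by ring
  have h2 := (ENNReal.mul_le_mul_iff_left hX0 hX).1 h1
  rw [ENNReal.ofReal_div_of_pos hl]
  calc X = (ENNReal.ofReal l)⁻¹ * (ENNReal.ofReal l * X) := by
        rw [← mul_assoc, ENNReal.inv_mul_cancel hl0 ENNReal.ofReal_ne_top, one_mul]
    _ ≤ (ENNReal.ofReal l)⁻¹ * (ENNReal.ofReal K * Y) := by gcongr
    _ = _ := by rw [ENNReal.div_eq_inv_mul]; ring

/-- The Caccioppoli inequality for nonlinear functions of a nonnegative solution. -/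
theorem IsCoefficient.caccioppoli {Ω : Set (Eu n)} (hΩ : IsOpen Ω) {lam Lam Gam : ℝ}
    (hlam : 0 < lam) {a b : Eu n → Matrix (Fin n) (Fin n) ℝ}
    (hab : IsCoefficient Ω lam Lam Gam a b) {u : Eu n → ℝ} {Du : Eu n → Eu n}
    (hu : MemW12loc Ω u Du) (hsol : TestsWeakly Ω a b Du)
    (hu0 : ∀ᵐ x ∂volume.restrict Ω, 0 ≤ u x) {η : Eu n → ℝ} (hη : ContDiff ℝ ∞ η)
    (hc : HasCompactSupport η) (hs : tsupport η ⊆ Ω) {h G : ℝ → ℝ}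
    (hG : ∀ t, HasDerivAt G (h t ^ 2) t) (hh : Continuous h) {M : ℝ} (hM : ∀ t, |h t| ≤ M)
    {K ε : ℝ} (hK0 : 0 ≤ K) (hε : 0 ≤ ε) (hK : ∀ t, 0 ≤ t → |G t| ≤ K * (t + ε) * h t ^ 2)
    (c : Matrix (Fin n) (Fin n) ℝ) :
    eLpNorm (fun x => (η x * h (u x)) • Du x) 2 (volume.restrict Ω) ≤
      ENNReal.ofReal (2 * K / lam) *
        eLpNorm (fun x => oscWeight Lam b c x * ‖egrad η x‖ * ((u x + ε) * h (u x))) 2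
          (volume.restrict Ω) := by
  have hη1 : ContDiff ℝ 1 η := hη.of_le (by exact_mod_cast le_top)
  set S := tsupport η with hSdef
  have hS : IsCompact S := hc.isCompact
  set ζ : Eu n → ℝ := fun x => η x * η x with hζdef
  have hζ : ContDiff ℝ ∞ ζ := hη.mul hη
  have hζc : HasCompactSupport ζ := hc.mul_right
  have hζS : tsupport ζ ⊆ S := tsupport_mul_subset_left
  have hgζ : ∀ x, egrad ζ x = (2 * η x) • egrad η x := fun x => by
    rw [hζdef, egrad_mul (hη1.differentiable one_ne_zero x) (hη1.differentiable one_ne_zero x),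
      ← add_smul]
    congr 1; ring
  have hM2 : ∀ t, |h t ^ 2| ≤ M ^ 2 := fun t => by
    rw [abs_pow]; exact pow_le_pow_left₀ (abs_nonneg _) (hM t) 2
  -- The bound on `h` makes `G` Lipschitz, so `G(u)` stays in `W^{1,2}_loc` and `η² G(u)` is an
  -- admissible test function.
  have hw := hu.comp hΩ hG (hh.pow 2) hM2
  obtain ⟨hφ, hφ2, hD2⟩ := hw.smooth_mul hζ hζc (hζS.trans hs)
  set φ : Eu n → ℝ := fun x => ζ x * G (u x)
  set Dφ : Eu n → Eu n := fun x => ζ x • (h (u x) ^ 2 • Du x) + G (u x) • egrad ζ x with hDφ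
  have hη0 : ∀ x ∉ S, η x = 0 := fun x hx => image_eq_zero_of_notMem_tsupport hx
  have hφ0 : ∀ x ∉ S, φ x = 0 := fun x hx => by simp [φ, ζ, hη0 x hx]
  have hV0 : ∀ x ∉ S, G (u x) • egrad ζ x = 0 := fun x hx => by
    rw [hgζ, hη0 x hx]; simp
  have hD0 : ∀ x ∉ S, Dφ x = 0 := fun x hx => by
    simp only [hDφ]; rw [hV0 x hx]; simp [ζ, hη0 x hx]
  have hcs : CompactlySupportedIn Ω φ := ⟨S, hS, hs, Eventually.of_forall hφ0⟩
  obtain ⟨ℓ, hℓ, heq⟩ := hsol φ Dφ hφ hcs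
  have hℓle := enorm_skewIntegral_le hΩ hu hφ hS hs hφ0 hD0
    (s := fun x => ζ x * h (u x) ^ 2) (V := fun x => G (u x) • egrad ζ x)
    (fun x => by simp only [hDφ, smul_smul]) hab.b_loc c hℓ
  obtain ⟨huS, hDuS⟩ := hu.2 S hS hs
  obtain ⟨Cη, hCη⟩ := exists_norm_le_of_hasCompactSupport hη.continuous hc
  have hm1 : MemLp (fun x => (η x * h (u x)) • Du x) 2 (volume.restrict S) := by
    refine hDuS.of_le_mul (c := Cη * M) ((hη.continuous.aestronglyMeasurable.mul
      (hh.comp_aestronglyMeasurable huS.1)).smul hDuS.1) (Eventually.of_forall fun x => ?_)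
    rw [norm_smul, norm_mul]
    gcongr
    · exact (norm_nonneg _).trans (hCη x)
    · exact hCη x
    · exact hM _
  have hm1' : MemLp (fun x => (η x * h (u x)) • Du x) 2 :=
    memLp_of_restrict hS.measurableSet hm1 fun x hx => by simp [hη0 x hx]
  have hV1 : MemLp (fun x => ζ x • (h (u x) ^ 2 • Du x)) 2 (volume.restrict S) := by
    refine hm1.of_le_mul (c := Cη * M) ?_ (Eventually.of_forall fun x => ?_)
    · exact hζ.continuous.aestronglyMeasurable.smul
        (((hh.pow 2).comp_aestronglyMeasurable huS.1).smul hDuS.1)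
    · have : ζ x • (h (u x) ^ 2 • Du x) = (η x * h (u x)) • ((η x * h (u x)) • Du x) := by
        rw [smul_smul, smul_smul]; congr 1; simp only [hζdef]; ring
      rw [this, norm_smul (η x * h (u x)), norm_mul]
      gcongr
      · exact (norm_nonneg _).trans (hCη x)
      · exact hCη x
      · exact hM _
  have hV2 : MemLp (fun x => G (u x) • egrad ζ x) 2 (volume.restrict S) := by
    have := (hD2.restrict S).sub hV1
    refine this.ae_eq (Eventually.of_forall fun x => ?_)
    simp [hDφ]
  have ham : ∀ i j, AEStronglyMeasurable (fun x => a x i j) (volume.restrict Ω) := fun i j =>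
    (hab.a_meas i j).aestronglyMeasurable
  have iV1 := integrableOn_matForm (Ω := Ω) hS.measurableSet hDuS hV1
    (fun x hx => by simp [hζdef, hη0 x hx]) ham hab.a_bound
  have iV2 := integrableOn_matForm (Ω := Ω) hS.measurableSet hDuS hV2 hV0 ham hab.a_bound
  have hsplit : ∫ x in Ω, matForm (a x) (Du x) (Dφ x) =
      (∫ x in Ω, matForm (a x) (Du x) (ζ x • (h (u x) ^ 2 • Du x))) +
        ∫ x in Ω, matForm (a x) (Du x) (G (u x) • egrad ζ x) := by
    rw [← integral_add iV1 iV2]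
    refine integral_congr_ae (Eventually.of_forall fun x => ?_)
    simp only [hDφ]
    exact matForm_add_right _ _ _ _
  have hsq : Integrable (fun x => ‖(η x * h (u x)) • Du x‖ ^ 2) (volume.restrict Ω) :=
    (hm1'.restrict Ω).integrable_norm_pow (by norm_num)
  have hell : lam * ∫ x in Ω, ‖(η x * h (u x)) • Du x‖ ^ 2 ≤
      ∫ x in Ω, matForm (a x) (Du x) (ζ x • (h (u x) ^ 2 • Du x)) := by
    rw [← integral_const_mul]
    refine integral_mono_ae (hsq.const_mul _) iV1 ?_
    filter_upwards [hab.a_elliptic] with x hx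
    rw [matForm_smul_right, matForm_smul_right, norm_smul, mul_pow, Real.norm_eq_abs, sq_abs]
    have := mul_le_mul_of_nonneg_left (hx (Du x)) (sq_nonneg (η x * h (u x)))
    simp only [hζdef]
    nlinarith
  set P : Eu n → ℝ≥0∞ := fun x => ‖(η x * h (u x)) • Du x‖ₑ with hP
  set W : Eu n → ℝ≥0∞ := fun x => ‖oscWeight Lam b c x * ‖egrad η x‖ * ((u x + ε) * h (u x))‖ₑ
    with hW
  -- Here `|G| ≤ K (t + ε) h²` is used: one factor `η h(u)` joins `∇u` to form the energy, the other
  -- remains with `∇η`.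
  have hbase : ∀ᵐ x ∂volume.restrict Ω, ‖Du x‖ * ‖G (u x) • egrad ζ x‖ ≤
      2 * K * (‖(η x * h (u x)) • Du x‖ * (‖egrad η x‖ * ((u x + ε) * |h (u x)|))) := by
    filter_upwards [hu0] with x hx
    have h1 := hK (u x) hx
    rw [hgζ, smul_smul, norm_smul, norm_smul, norm_mul, norm_mul, norm_mul, Real.norm_eq_abs,
      Real.norm_eq_abs, Real.norm_eq_abs, Real.norm_eq_abs, abs_two]
    have h2 : |h (u x)| * |h (u x)| = h (u x) ^ 2 := by rw [← sq, sq_abs]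
    calc ‖Du x‖ * (|G (u x)| * (2 * |η x|) * ‖egrad η x‖)
        ≤ ‖Du x‖ * (K * (u x + ε) * h (u x) ^ 2 * (2 * |η x|) * ‖egrad η x‖) := by gcongr
      _ = _ := by rw [← h2]; ring
  have hWx : ∀ᵐ x ∂volume.restrict Ω, W x =
      ENNReal.ofReal (oscWeight Lam b c x * (‖egrad η x‖ * ((u x + ε) * |h (u x)|))) := by
    filter_upwards [hu0] with x hx
    simp only [hW]
    rw [Real.enorm_eq_ofReal_abs, abs_mul, abs_mul, abs_mul, abs_of_nonneg (oscWeight_nonneg _ _ _ _),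
      abs_norm, abs_of_nonneg (by linarith : 0 ≤ u x + ε)]
    ring_nf
  have hPm : AEMeasurable P (volume.restrict Ω) := (hm1'.restrict Ω).1.enorm
  have huΩ : AEStronglyMeasurable u (volume.restrict Ω) := hu.1.1.aestronglyMeasurable
  have hWm : AEMeasurable W (volume.restrict Ω) :=
    (((hab.aestronglyMeasurable_oscWeight c).mul
      (continuous_egrad hη1).norm.aestronglyMeasurable).mul
      ((huΩ.add aestronglyMeasurable_const).mul (hh.comp_aestronglyMeasurable huΩ))).enorm
  have hVΩ : AEMeasurable (fun x => ENNReal.ofReal (n ^ 2 * |Lam| *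
      (‖Du x‖ * ‖G (u x) • egrad ζ x‖))) (volume.restrict Ω) := by
    have h1 : AEStronglyMeasurable Du (volume.restrict Ω) := hu.1.2.1.aestronglyMeasurable
    have h2 : AEStronglyMeasurable (fun x => G (u x) • egrad ζ x) (volume.restrict Ω) :=
      ((continuous_iff_continuousAt.2 fun t => (hG t).continuousAt).comp_aestronglyMeasurable
        huΩ).smul (continuous_egrad (hζ.of_le (by exact_mod_cast le_top))).aestronglyMeasurable
    exact ((h1.norm.mul h2.norm).const_mul _).aemeasurable.ennreal_ofReal
  have hmat : ‖∫ x in Ω, matForm (a x) (Du x) (G (u x) • egrad ζ x)‖ₑ ≤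
      ∫⁻ x in Ω, ENNReal.ofReal (n ^ 2 * |Lam| * (‖Du x‖ * ‖G (u x) • egrad ζ x‖)) := by
    refine (enorm_integral_le_lintegral_enorm _).trans (lintegral_mono_ae ?_)
    filter_upwards [hab.sum_abs_le] with x hx
    rw [Real.enorm_eq_ofReal_abs]
    refine ENNReal.ofReal_le_ofReal ((abs_matForm_le _ _ _).trans ?_)
    gcongr
  have hreal : lam * ∫ x in Ω, ‖(η x * h (u x)) • Du x‖ ^ 2 ≤
      |ℓ| + |∫ x in Ω, matForm (a x) (Du x) (G (u x) • egrad ζ x)| := by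
    have h1 := neg_abs_le ℓ
    have h2 := neg_abs_le (∫ x in Ω, matForm (a x) (Du x) (G (u x) • egrad ζ x))
    rw [hsplit] at heq
    linarith
  have hX2 : ENNReal.ofReal (∫ x in Ω, ‖(η x * h (u x)) • Du x‖ ^ 2) = ∫⁻ x in Ω, P x ^ 2 := by
    rw [ofReal_integral_eq_lintegral_ofReal hsq (Eventually.of_forall fun x => by positivity)]
    refine lintegral_congr fun x => ?_
    rw [ENNReal.ofReal_pow (norm_nonneg _), ofReal_norm]
  have hmain : ENNReal.ofReal lam * (∫⁻ x in Ω, P x ^ 2) ≤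
      ENNReal.ofReal (2 * K) * ∫⁻ x in Ω, W x * P x := by
    rw [← hX2, ← ENNReal.ofReal_mul hlam.le]
    calc _ ≤ ENNReal.ofReal (|ℓ| + |∫ x in Ω, matForm (a x) (Du x) (G (u x) • egrad ζ x)|) :=
          ENNReal.ofReal_le_ofReal hreal
      _ ≤ (∫⁻ x in Ω, ENNReal.ofReal ((∑ i, ∑ j, |b x i j - c i j|) *
            (‖Du x‖ * ‖G (u x) • egrad ζ x‖))) +
          ∫⁻ x in Ω, ENNReal.ofReal (n ^ 2 * |Lam| * (‖Du x‖ * ‖G (u x) • egrad ζ x‖)) := by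
          rw [ENNReal.ofReal_add (abs_nonneg _) (abs_nonneg _), ← Real.enorm_eq_ofReal_abs,
            ← Real.enorm_eq_ofReal_abs]
          exact add_le_add hℓle hmat
      _ = ∫⁻ x in Ω, ENNReal.ofReal (oscWeight Lam b c x *
            (‖Du x‖ * ‖G (u x) • egrad ζ x‖)) := by
          rw [← lintegral_add_right' _ hVΩ]
          refine lintegral_congr fun x => ?_
          rw [← ENNReal.ofReal_add (by positivity) (by positivity), oscWeight]
          congr 1; ring
      _ ≤ ∫⁻ x in Ω, ENNReal.ofReal (2 * K) * (W x * P x) := by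
          refine lintegral_mono_ae ?_
          filter_upwards [hbase, hWx, hu0] with x hx hxW hx0
          have hu' : 0 ≤ u x + ε := by linarith
          have hn := oscWeight_nonneg Lam b c x
          rw [hxW]
          simp only [hP]
          rw [← ofReal_norm, ← ENNReal.ofReal_mul (by positivity),
            ← ENNReal.ofReal_mul (by positivity)]
          refine ENNReal.ofReal_le_ofReal ?_
          calc _ ≤ oscWeight Lam b c x * (2 * K * (‖(η x * h (u x)) • Du x‖ *
                (‖egrad η x‖ * ((u x + ε) * |h (u x)|)))) := by gcongr
            _ = _ := by ring
      _ = _ := lintegral_const_mul' _ _ ENNReal.ofReal_ne_top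
  -- Cauchy–Schwarz splits off one power of the energy norm, which is finite because `η` has compact
  -- support and `h` is bounded. The weighted norm on the right may be infinite.
  refine le_mul_of_mul_sq_le hlam (hm1'.restrict Ω).2.ne ?_
  rw [eLpNorm_two_sq]
  refine hmain.trans ?_
  gcongr
  have hold := ENNReal.lintegral_mul_le_Lp_mul_Lq (volume.restrict Ω) (p := 2) (q := 2)
    (by constructor <;> norm_num) hWm hPm
  refine hold.trans (le_of_eq ?_)
  rw [eLpNorm_eq_lintegral_rpow_enorm_toReal (by norm_num) (by norm_num),
    eLpNorm_eq_lintegral_rpow_enorm_toReal (by norm_num) (by norm_num)]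
  simp [hP, hW]

end BMOElliptic

/-! ### Cutoffs, `L^p` bounds for the weight, and Caccioppoli with Sobolev. -/

namespace BMOElliptic

variable {n : ℕ}

theorem exists_bound_deriv_smoothTransition :
    ∃ M : ℝ, 0 < M ∧ ∀ t, |deriv Real.smoothTransition t| ≤ M := by
  have hc : Continuous (deriv Real.smoothTransition) :=
    (Real.smoothTransition.contDiff (n := 1)).continuous_deriv le_rfl
  obtain ⟨C, hC⟩ := (isCompact_Icc (a := (0 : ℝ)) (b := 1)).exists_bound_of_continuousOn
    hc.continuousOn
  refine ⟨max C 1, by positivity, fun t => ?_⟩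
  by_cases ht : t ∈ Set.Icc (0 : ℝ) 1
  · exact (hC t ht).trans (le_max_left _ _)
  · have : deriv Real.smoothTransition t = 0 := by
      rw [Set.mem_Icc, not_and_or, not_le, not_le] at ht
      rcases ht with ht | ht
      · have h1 : Real.smoothTransition =ᶠ[𝓝 t] fun _ => (0 : ℝ) := by
          filter_upwards [Iio_mem_nhds ht] with s hs
          exact Real.smoothTransition.zero_of_nonpos (le_of_lt hs)
        rw [h1.deriv_eq]; simp
      · have h1 : Real.smoothTransition =ᶠ[𝓝 t] fun _ => (1 : ℝ) := by
          filter_upwards [Ioi_mem_nhds ht] with s hs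
          exact Real.smoothTransition.one_of_one_le (le_of_lt hs)
        rw [h1.deriv_eq]; simp
    rw [this, abs_zero]; positivity

/-- A bound for the gradients of cutoff functions between concentric balls. -/
noncomputable def cutoffConst : ℝ := 2 * exists_bound_deriv_smoothTransition.choose

theorem cutoffConst_pos : 0 < cutoffConst :=
  mul_pos two_pos exists_bound_deriv_smoothTransition.choose_spec.1

/-- A smooth step in the variable `(r² - |x - z|²) / (r² - ρ²)`, which avoids the singularity of the
norm at the centre. The gradient bound follows from `2 r / (r² - ρ²) ≤ 2 / (r - ρ)`. -/
theorem exists_ball_cutoff (z : Eu n) {ρ r : ℝ} (hρ : 0 < ρ) (hr : ρ < r) :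
    ∃ η : Eu n → ℝ, ContDiff ℝ ∞ η ∧ HasCompactSupport η ∧ tsupport η ⊆ Metric.closedBall z r ∧
      (∀ x ∈ Metric.closedBall z ρ, η x = 1) ∧ ∀ x, ‖egrad η x‖ ≤ cutoffConst / (r - ρ) := by
  set M := exists_bound_deriv_smoothTransition.choose
  have hM := exists_bound_deriv_smoothTransition.choose_spec.2
  have hM0 := exists_bound_deriv_smoothTransition.choose_spec.1
  have hd : 0 < r ^ 2 - ρ ^ 2 := by nlinarith
  set q : Eu n → ℝ := fun x => (r ^ 2 - ‖x - z‖ ^ 2) / (r ^ 2 - ρ ^ 2) with hq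
  have hqs : ContDiff ℝ ∞ q := by
    refine ContDiff.div_const (contDiff_const.sub ?_) _
    exact (contDiff_id.sub contDiff_const).norm_sq ℝ
  set η : Eu n → ℝ := fun x => Real.smoothTransition (q x) with hη
  have hηs : ContDiff ℝ ∞ η := Real.smoothTransition.contDiff.comp hqs
  have hts : tsupport η ⊆ Metric.closedBall z r := by
    refine closure_minimal (fun x hx => ?_) Metric.isClosed_closedBall
    by_contra hcon
    refine hx (Real.smoothTransition.zero_of_nonpos ?_)
    rw [Metric.mem_closedBall, dist_eq_norm, not_le] at hcon
    exact div_nonpos_of_nonpos_of_nonneg (by nlinarith) hd.le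
  refine ⟨η, hηs, HasCompactSupport.of_support_subset_isCompact (isCompact_closedBall z r)
    ((subset_tsupport η).trans hts), hts, fun x hx => ?_, fun x => ?_⟩
  · refine Real.smoothTransition.one_of_one_le ?_
    rw [Metric.mem_closedBall, dist_eq_norm] at hx
    rw [hq, one_le_div hd]
    have := norm_nonneg (x - z)
    nlinarith
  · by_cases hx : x ∈ Metric.closedBall z r
    · rw [Metric.mem_closedBall, dist_eq_norm] at hx
      rw [norm_egrad]
      have h1 : HasFDerivAt (fun x : Eu n => ‖x - z‖ ^ 2)
          ((2 : ℝ) • innerSL ℝ (x - z) : Eu n →L[ℝ] ℝ) x := by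
        have := ((hasFDerivAt_id x).sub_const z).norm_sq
        refine this.congr_fderiv ?_
        ext v
        simp
      have h2 : HasFDerivAt q ((r ^ 2 - ρ ^ 2)⁻¹ • (-((2 : ℝ) • innerSL ℝ (x - z)) : Eu n →L[ℝ] ℝ)) x := by
        have := (h1.const_sub (r ^ 2)).const_mul (r ^ 2 - ρ ^ 2)⁻¹
        refine this.congr_of_eventuallyEq (Eventually.of_forall fun y => ?_)
        simp only [hq]
        rw [div_eq_inv_mul]
      have h3 : HasDerivAt Real.smoothTransition (deriv Real.smoothTransition (q x)) (q x) :=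
        ((Real.smoothTransition.contDiff (n := 1)).differentiable one_ne_zero _).hasDerivAt
      have h4 := h3.comp_hasFDerivAt x h2
      rw [show fderiv ℝ η x = _ from h4.fderiv, norm_smul, norm_smul, norm_neg, Real.norm_eq_abs,
        norm_inv, Real.norm_of_nonneg hd.le]
      have h5 : ‖((2 : ℝ) • innerSL ℝ (x - z) : Eu n →L[ℝ] ℝ)‖ ≤ 2 * r := by
        rw [norm_smul, innerSL_apply_norm, Real.norm_of_nonneg two_pos.le]
        linarith
      calc _ ≤ M * ((r ^ 2 - ρ ^ 2)⁻¹ * (2 * r)) := by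
            gcongr
            exact hM _
        _ ≤ 2 * M / (r - ρ) := by
            rw [← div_eq_inv_mul, mul_div_assoc', div_le_div_iff₀ hd (by linarith)]
            have : 0 < r - ρ := by linarith
            nlinarith [mul_pos hM0 (mul_pos hρ this)]
    · rw [egrad_eq_zero_of_notMem (fun h => hx (hts h)), norm_zero]
      exact div_nonneg cutoffConst_pos.le (by linarith)

/-- The closed cube with centre `z` and half-side `r`. -/
def ccube (z : Eu n) (r : ℝ) : Set (Eu n) :=
  cube (WithLp.toLp 2 fun i => z i - r) (2 * r)

theorem closedBall_subset_ccube (z : Eu n) (r : ℝ) : Metric.closedBall z r ⊆ ccube z r := by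
  intro x hx i
  rw [Metric.mem_closedBall, dist_eq_norm] at hx
  have h1 : |x i - z i| ≤ r := (PiLp.norm_apply_le (x - z) i).trans hx
  rw [abs_le] at h1
  constructor
  · simp only []; linarith [h1.1]
  · simp only []; linarith [h1.2]

theorem ccube_subset_closedBall (z : Eu n) {r : ℝ} (hr : 0 ≤ r) :
    ccube z r ⊆ Metric.closedBall z (n * r) := by
  intro x hx
  rw [Metric.mem_closedBall, dist_eq_norm]
  refine norm_le_of_abs_coord_le hr fun i => ?_
  have h := hx i
  simp only [Set.mem_Icc] at h
  rw [PiLp.sub_apply, abs_le]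
  constructor <;> linarith [h.1, h.2]

theorem integral_osc_le_of_bmoSeminorm_le {Ω : Set (Eu n)} {f : Eu n → ℝ} {Gam : ℝ}
    (hGam : 0 ≤ Gam) (hf : LocallyIntegrableOn f Ω) (h : bmoSeminorm Ω f ≤ ENNReal.ofReal Gam)
    {c : Eu n} {l : ℝ} (hl : 0 < l) (hs : cube c l ⊆ Ω) :
    ∫ x in cube c l, |f x - ⨍ y in cube c l, f y| ≤ Gam * l ^ n := by
  have h1 : (⨍⁻ x in cube c l, ‖f x - ⨍ y in cube c l, f y ∂volume‖ₑ ∂volume) ≤ ENNReal.ofReal Gam := by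
    refine le_trans ?_ h
    rw [bmoSeminorm]
    exact le_iSup_of_le c (le_iSup_of_le l (le_iSup_of_le hl (le_iSup_of_le hs le_rfl)))
  rw [setLAverage_eq, ENNReal.div_le_iff (volume_cube_ne_zero c hl) (volume_cube_ne_top c l),
    volume_cube c hl.le, ← ENNReal.ofReal_mul hGam] at h1
  have hint : IntegrableOn f (cube c l) := hf.integrableOn_compact_subset hs (isCompact_cube c l)
  have hint2 : IntegrableOn (fun x => |f x - ⨍ y in cube c l, f y|) (cube c l) :=
    (Integrable.sub hint (integrableOn_const (volume_cube_ne_top c l) enorm_ne_top)).abs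
  rw [← ENNReal.ofReal_le_ofReal_iff (by positivity),
    ofReal_integral_eq_lintegral_ofReal hint2 (Eventually.of_forall fun x => abs_nonneg _)]
  refine le_trans (le_of_eq (lintegral_congr fun x => ?_)) h1
  rw [Real.enorm_eq_ofReal_abs]

/-- From `s ≤ e^s` at `s = θ t / p`, raised to the power `p`. -/
theorem rpow_le_mul_exp {t p θ : ℝ} (ht : 0 ≤ t) (hp : 0 < p) (hθ : 0 < θ) :
    t ^ p ≤ (p / θ) ^ p * Real.exp (θ * t) := by
  have h1 : θ * t / p ≤ Real.exp (θ * t / p) := by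
    linarith [Real.add_one_le_exp (θ * t / p)]
  have h2 : t ≤ p / θ * Real.exp (θ * t / p) := by
    calc t = p / θ * (θ * t / p) := by field_simp
      _ ≤ _ := by gcongr
  calc t ^ p ≤ (p / θ * Real.exp (θ * t / p)) ^ p := Real.rpow_le_rpow ht h2 hp.le
    _ = (p / θ) ^ p * Real.exp (θ * t) := by
      rw [Real.mul_rpow (by positivity) (Real.exp_pos _).le, ← Real.exp_mul]
      congr 2
      field_simp

/-- The constant in the `L^p` form of the John–Nirenberg inequality. -/
noncomputable def jnConst (n : ℕ) (A p : ℝ) : ℝ :=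
  p / jnExponent n A * 3 ^ (1 / p)

/-- The `L^p` form of the John–Nirenberg inequality. -/
theorem eLpNorm_sub_average_le {f : Eu n → ℝ} {c : Eu n} {l A : ℝ} (hl : 0 < l)
    (hA : 0 < A) (hf : IntegrableOn f (cube c l))
    (h : ∀ (c' : Eu n) (l' : ℝ), 0 < l' → cube c' l' ⊆ cube c l →
      ∫ x in cube c' l', |f x - ⨍ y in cube c' l', f y| ≤ A * l' ^ n) {p : ℝ} (hp : 0 < p) :
    eLpNorm (fun x => f x - ⨍ y in cube c l, f y) (ENNReal.ofReal p) (volume.restrict (cube c l)) ≤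
      ENNReal.ofReal (jnConst n A p) * volume (cube c l) ^ (1 / p) := by
  have hθ := jnExponent_pos n hA
  set θ := jnExponent n A
  have key := lintegral_exp_mul_abs_sub_le hl hA hf h
  rw [eLpNorm_eq_lintegral_rpow_enorm_toReal (by simpa using hp) ENNReal.ofReal_ne_top,
    ENNReal.toReal_ofReal hp.le]
  calc (∫⁻ x in cube c l, ‖f x - ⨍ y in cube c l, f y‖ₑ ^ p) ^ (1 / p)
      ≤ (∫⁻ x in cube c l, ENNReal.ofReal ((p / θ) ^ p) *
          ENNReal.ofReal (Real.exp (θ * |f x - ⨍ y in cube c l, f y|))) ^ (1 / p) := by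
        gcongr with x
        rw [Real.enorm_eq_ofReal_abs, ENNReal.ofReal_rpow_of_nonneg (abs_nonneg _) hp.le,
          ← ENNReal.ofReal_mul (by positivity)]
        exact ENNReal.ofReal_le_ofReal (rpow_le_mul_exp (abs_nonneg _) hp hθ)
    _ ≤ (ENNReal.ofReal ((p / θ) ^ p) * (ENNReal.ofReal 3 * volume (cube c l))) ^ (1 / p) := by
        rw [lintegral_const_mul' _ _ ENNReal.ofReal_ne_top]
        refine ENNReal.rpow_le_rpow (mul_le_mul' le_rfl (key.trans (le_of_eq ?_))) (by positivity)
        rw [volume_cube c hl.le, ENNReal.ofReal_mul (by norm_num)]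
    _ = _ := by
        rw [ENNReal.mul_rpow_of_nonneg _ _ (by positivity),
          ENNReal.mul_rpow_of_nonneg _ _ (by positivity),
          ENNReal.ofReal_rpow_of_nonneg (by positivity) (by positivity),
          ENNReal.ofReal_rpow_of_nonneg (by positivity) (by positivity), ← mul_assoc,
          ← ENNReal.ofReal_mul (by positivity), ← Real.rpow_mul (by positivity), jnConst,
          mul_one_div_cancel hp.ne', Real.rpow_one]

/-- The matrix of mean values of `b` over a cube. -/
noncomputable def meanMat (b : Eu n → Matrix (Fin n) (Fin n) ℝ) (c : Eu n) (l : ℝ) :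
    Matrix (Fin n) (Fin n) ℝ := fun i j => ⨍ y in cube c l, b y i j

/-- The constant in the bound for the `L^p` norm of the weight in the Caccioppoli inequality. -/
noncomputable def weightConst (n : ℕ) (Lam Gam p : ℝ) : ℝ :=
  1 + n ^ 2 * |Lam| + n * (n * jnConst n (Gam + 1) p)

theorem weightConst_pos (n : ℕ) (Lam : ℝ) {Gam p : ℝ} (hGam : 0 ≤ Gam) (hp : 0 < p) :
    0 < weightConst n Lam Gam p := by
  have := jnExponent_pos n (by linarith : 0 < Gam + 1)
  unfold weightConst jnConst
  positivity

theorem IsCoefficient.eLpNorm_weight_le {Ω : Set (Eu n)} {lam Lam Gam : ℝ}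
    {a b : Eu n → Matrix (Fin n) (Fin n) ℝ} (hab : IsCoefficient Ω lam Lam Gam a b)
    (hGam : 0 ≤ Gam) {c : Eu n} {l : ℝ} (hl : 0 < l) (hs : cube c l ⊆ Ω) {p : ℝ} (hp : 1 ≤ p) :
    eLpNorm (fun x => 1 + oscWeight Lam b (meanMat b c l) x) (ENNReal.ofReal p)
        (volume.restrict (cube c l)) ≤
      ENNReal.ofReal (weightConst n Lam Gam p) * volume (cube c l) ^ (1 / p) := by
  have hp0 : 0 < p := by linarith
  -- John–Nirenberg needs a positive oscillation bound and `Gam` may be zero, hence `Gam + 1`.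
  have hA : 0 < Gam + 1 := by linarith
  have hp1 : 1 ≤ ENNReal.ofReal p := by
    rw [← ENNReal.ofReal_one]; exact ENNReal.ofReal_le_ofReal hp
  have hθ := jnExponent_pos n hA
  have hjn : 0 ≤ jnConst n (Gam + 1) p := by unfold jnConst; positivity
  set Q := cube c l
  set μ := volume.restrict Q
  have hint : ∀ i j, IntegrableOn (fun x => b x i j) Q := fun i j =>
    (hab.b_loc i j).integrableOn_compact_subset hs (isCompact_cube c l)
  have hij : ∀ i j, eLpNorm (fun x => |b x i j - meanMat b c l i j|) (ENNReal.ofReal p) μ ≤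
      ENNReal.ofReal (jnConst n (Gam + 1) p) * volume Q ^ (1 / p) := by
    intro i j
    have h1 : eLpNorm (fun x => |b x i j - meanMat b c l i j|) (ENNReal.ofReal p) μ =
        eLpNorm (fun x => b x i j - meanMat b c l i j) (ENNReal.ofReal p) μ :=
      eLpNorm_congr_norm_ae (Eventually.of_forall fun x => by simp)
    rw [h1]
    refine eLpNorm_sub_average_le hl hA (hint i j) (fun c' l' hl' hs' => ?_) hp0
    refine (integral_osc_le_of_bmoSeminorm_le hGam (hab.b_loc i j) (hab.b_bmo i j) hl'
      (hs'.trans hs)).trans ?_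
    gcongr
    linarith
  have hmij : ∀ i j, AEStronglyMeasurable (fun x => |b x i j - meanMat b c l i j|) μ := fun i j =>
    ((hint i j).1.sub aestronglyMeasurable_const).norm
  have hmi : ∀ i, AEStronglyMeasurable (fun x => ∑ j, |b x i j - meanMat b c l i j|) μ := fun i =>
    Finset.aestronglyMeasurable_fun_sum _ fun j _ => hmij i j
  have hsum : eLpNorm (fun x => ∑ i, ∑ j, |b x i j - meanMat b c l i j|) (ENNReal.ofReal p) μ ≤
      n * (n * (ENNReal.ofReal (jnConst n (Gam + 1) p) * volume Q ^ (1 / p))) := by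
    have e1 : (fun x => ∑ i, ∑ j, |b x i j - meanMat b c l i j|) =
        ∑ i, fun x => ∑ j, |b x i j - meanMat b c l i j| := by
      ext x; simp
    rw [e1]
    refine (eLpNorm_sum_le (fun i _ => hmi i) hp1).trans ?_
    refine (Finset.sum_le_card_nsmul _ _
      (n * (ENNReal.ofReal (jnConst n (Gam + 1) p) * volume Q ^ (1 / p))) fun i _ => ?_).trans
      (le_of_eq (by simp))
    have e2 : (fun x => ∑ j, |b x i j - meanMat b c l i j|) =
        ∑ j, fun x => |b x i j - meanMat b c l i j| := by
      ext x; simp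
    rw [e2]
    refine (eLpNorm_sum_le (fun j _ => hmij i j) hp1).trans ?_
    exact (Finset.sum_le_card_nsmul _ _ _ fun j _ => hij i j).trans (le_of_eq (by simp))
  have hconst : eLpNorm (fun _ : Eu n => 1 + (n : ℝ) ^ 2 * |Lam|) (ENNReal.ofReal p) μ ≤
      ENNReal.ofReal (1 + n ^ 2 * |Lam|) * volume Q ^ (1 / p) := by
    rw [eLpNorm_const' _ (by simpa using hp0) ENNReal.ofReal_ne_top,
      Real.enorm_of_nonneg (by positivity), ENNReal.toReal_ofReal hp0.le,
      Measure.restrict_apply_univ]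
  have e : (fun x => 1 + oscWeight Lam b (meanMat b c l) x) =
      (fun _ => 1 + (n : ℝ) ^ 2 * |Lam|) +
        fun x => ∑ i, ∑ j, |b x i j - meanMat b c l i j| := by
    ext x
    simp only [oscWeight, Pi.add_apply]
    ring
  rw [e]
  refine (eLpNorm_add_le aestronglyMeasurable_const
    (Finset.aestronglyMeasurable_fun_sum _ fun i _ => hmi i) hp1).trans
    ((add_le_add hconst hsum).trans (le_of_eq ?_))
  have e3 : ENNReal.ofReal (n * (n * jnConst n (Gam + 1) p)) =
      n * (n * ENNReal.ofReal (jnConst n (Gam + 1) p)) := by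
    rw [ENNReal.ofReal_mul (by positivity), ENNReal.ofReal_mul (by positivity),
      ENNReal.ofReal_natCast]
  rw [weightConst, ENNReal.ofReal_add (p := 1 + (n : ℝ) ^ 2 * |Lam|) (by positivity)
    (by positivity), e3]
  ring

/-- Caccioppoli's inequality combined with Sobolev's. -/
theorem IsCoefficient.sobolev_caccioppoli {Ω : Set (Eu n)} (hn : 3 ≤ n) (hΩ : IsOpen Ω)
    {lam Lam Gam : ℝ} (hlam : 0 < lam) {a b : Eu n → Matrix (Fin n) (Fin n) ℝ}
    (hab : IsCoefficient Ω lam Lam Gam a b) {u : Eu n → ℝ} {Du : Eu n → Eu n}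
    (hu : MemW12loc Ω u Du) (hsol : TestsWeakly Ω a b Du)
    (hu0 : ∀ᵐ x ∂volume.restrict Ω, 0 ≤ u x) {η : Eu n → ℝ} (hη : ContDiff ℝ ∞ η)
    (hc : HasCompactSupport η) (hs : tsupport η ⊆ Ω) {h G H : ℝ → ℝ}
    (hG : ∀ t, HasDerivAt G (h t ^ 2) t) (hH : ∀ t, HasDerivAt H (h t) t) (hh : Continuous h)
    {M : ℝ} (hM : ∀ t, |h t| ≤ M) {K K' ε : ℝ} (hK0 : 0 ≤ K) (hK0' : 0 ≤ K') (hε : 0 ≤ ε)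
    (hK : ∀ t, 0 ≤ t → |G t| ≤ K * (t + ε) * h t ^ 2)
    (hK' : ∀ t, 0 ≤ t → |H t| ≤ K' * ((t + ε) * |h t|)) (c : Matrix (Fin n) (Fin n) ℝ) :
    eLpNorm (fun x => η x * H (u x)) (sobExp n) ≤
      sobConst n * (ENNReal.ofReal (2 * K / lam + K') *
        eLpNorm (fun x => (1 + oscWeight Lam b c x) * ‖egrad η x‖ * ((u x + ε) * h (u x))) 2
          (volume.restrict Ω)) := by
  have hw := hu.comp hΩ hH hh hM
  have hη1 : ContDiff ℝ 1 η := hη.of_le (by exact_mod_cast le_top)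
  refine (hw.eLpNorm_mul_le hn hΩ hη hc hs).trans ?_
  gcongr
  have huΩ : AEStronglyMeasurable u (volume.restrict Ω) := hu.1.1.aestronglyMeasurable
  have hDuΩ : AEStronglyMeasurable Du (volume.restrict Ω) := hu.1.2.1.aestronglyMeasurable
  set F : Eu n → Eu n := fun x => η x • h (u x) • Du x + H (u x) • egrad η x with hF
  have hFΩ : eLpNorm F 2 = eLpNorm F 2 (volume.restrict Ω) := by
    rw [← eLpNorm_indicator_eq_eLpNorm_restrict hΩ.measurableSet, Set.indicator_eq_self.2]
    intro x hx
    by_contra hxΩ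
    refine hx ?_
    have hxs : x ∉ tsupport η := fun h => hxΩ (hs h)
    simp only [hF]
    rw [image_eq_zero_of_notMem_tsupport hxs, egrad_eq_zero_of_notMem hxs]
    simp
  have hFe : F = (fun x => (η x * h (u x)) • Du x) + fun x => H (u x) • egrad η x := by
    ext1 x; simp only [hF, Pi.add_apply, smul_smul]
  set Y := eLpNorm (fun x => (1 + oscWeight Lam b c x) * ‖egrad η x‖ * ((u x + ε) * h (u x))) 2
    (volume.restrict Ω) with hY
  have h1 : eLpNorm (fun x => (η x * h (u x)) • Du x) 2 (volume.restrict Ω) ≤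
      ENNReal.ofReal (2 * K / lam) * Y := by
    refine (hab.caccioppoli hΩ hlam hu hsol hu0 hη hc hs hG hh hM hK0 hε hK c).trans ?_
    gcongr
    refine eLpNorm_mono fun x => ?_
    rw [norm_mul, norm_mul (oscWeight Lam b c x),
      norm_mul ((1 + oscWeight Lam b c x) * ‖egrad η x‖), norm_mul (1 + oscWeight Lam b c x),
      Real.norm_of_nonneg (oscWeight_nonneg _ _ _ _), Real.norm_of_nonneg
      (by linarith [oscWeight_nonneg Lam b c x] : 0 ≤ 1 + oscWeight Lam b c x)]
    refine mul_le_mul_of_nonneg_right (mul_le_mul_of_nonneg_right ?_ (norm_nonneg _)) (norm_nonneg _)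
    linarith
  -- The summand `1` in the weight is there for this term: the part of `∇(η H(u))` that falls on `η`
  -- carries no coefficient.
  have h2 : eLpNorm (fun x => H (u x) • egrad η x) 2 (volume.restrict Ω) ≤
      ENNReal.ofReal K' * Y := by
    refine eLpNorm_le_mul_eLpNorm_of_ae_le_mul ?_ 2
    filter_upwards [hu0] with x hx
    have hω := oscWeight_nonneg Lam b c x
    have hle := hK' (u x) hx
    rw [norm_smul, norm_mul, norm_mul, norm_mul, norm_norm, Real.norm_of_nonneg
      (by linarith : 0 ≤ 1 + oscWeight Lam b c x), Real.norm_of_nonneg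
      (by linarith : 0 ≤ u x + ε), Real.norm_eq_abs, Real.norm_eq_abs]
    have h0 : 0 ≤ K' * ((u x + ε) * |h (u x)|) := (abs_nonneg _).trans hle
    calc |H (u x)| * ‖egrad η x‖ ≤ K' * ((u x + ε) * |h (u x)|) * ‖egrad η x‖ := by gcongr
      _ ≤ (1 + oscWeight Lam b c x) * (K' * ((u x + ε) * |h (u x)|) * ‖egrad η x‖) :=
          le_mul_of_one_le_left (by positivity) (by linarith)
      _ = _ := by ring
  have hHm : AEStronglyMeasurable (fun x => H (u x)) (volume.restrict Ω) :=
    (continuous_iff_continuousAt.2 fun t => (hH t).continuousAt).comp_aestronglyMeasurable huΩ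
  rw [hFΩ, hFe]
  refine (eLpNorm_add_le ((hη.continuous.aestronglyMeasurable.mul
    (hh.comp_aestronglyMeasurable huΩ)).smul hDuΩ)
    (hHm.smul (continuous_egrad hη1).aestronglyMeasurable) (by norm_num)).trans ?_
  refine (add_le_add h1 h2).trans (le_of_eq ?_)
  rw [ENNReal.ofReal_add (by positivity) hK0']
  ring

end BMOElliptic

/-! ### Energy estimates for powers of a solution. -/

namespace BMOElliptic

variable {n : ℕ}

/-- `u` is a nonnegative weak solution in the open set `Ω`, with weak gradient `Du`. -/
structure IsNonnegSolution (Ω : Set (Eu n)) (lam Lam Gam : ℝ)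
    (a b : Eu n → Matrix (Fin n) (Fin n) ℝ) (u : Eu n → ℝ) (Du : Eu n → Eu n) : Prop where
  isOpen : IsOpen Ω
  coeff : IsCoefficient Ω lam Lam Gam a b
  mem : MemW12loc Ω u Du
  tests : TestsWeakly Ω a b Du
  nonneg : ∀ᵐ x ∂volume.restrict Ω, 0 ≤ u x

theorem hasDerivAt_const_add_integral {h : ℝ → ℝ} (hh : Continuous h) (A t : ℝ) :
    HasDerivAt (fun t => A + ∫ s in (0 : ℝ)..t, h s) (h t) t :=
  (hh.integral_hasStrictDerivAt 0 t).hasDerivAt.const_add _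

/-- The nonlinearities must be differentiable on all of `ℝ`, while the powers make sense only on `t
≥ 0`. They are defined as primitives of continuous extensions and recognised on the half-line where
`u` takes its values. -/
theorem const_add_integral_eq {h P : ℝ → ℝ} (hh : Continuous h) {t : ℝ} (ht : 0 ≤ t)
    (hP : ∀ s, 0 ≤ s → s ≤ t → HasDerivAt P (h s) s) :
    P 0 + ∫ s in (0 : ℝ)..t, h s = P t := by
  rw [intervalIntegral.integral_eq_sub_of_hasDerivAt (f := P) (fun s hs => ?_)
    (hh.intervalIntegrable _ _)]
  · ring
  · rw [Set.uIcc_of_le ht] at hs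
    exact hP s hs.1 hs.2

/-- The constant in the Caccioppoli–Sobolev inequality for powers. -/
noncomputable def powConst (lam γ : ℝ) : ℝ := (2 / lam + 1) * (1 + |γ|) * (1 + 1 / |2 * γ - 1|)

theorem powConst_pos {lam : ℝ} (hlam : 0 < lam) (γ : ℝ) : 0 < powConst lam γ := by
  unfold powConst; positivity

theorem hasDerivAt_add_rpow {t ε : ℝ} (h : 0 < t + ε) (γ : ℝ) :
    HasDerivAt (fun s => (s + ε) ^ γ) (γ * (t + ε) ^ (γ - 1)) t := by
  have := ((hasDerivAt_id t).add_const ε).rpow_const (p := γ) (Or.inl h.ne')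
  simpa using this

theorem le_powConst {lam : ℝ} (hlam : 0 < lam) (γ : ℝ) :
    |γ| * (2 * (1 / |2 * γ - 1|) / lam) + 1 ≤ powConst lam γ := by
  have h1 : 0 ≤ 1 / |2 * γ - 1| := by positivity
  have h2 := abs_nonneg γ
  have h3 : 0 < 2 / lam := by positivity
  set d := 1 / |2 * γ - 1|
  have e : |γ| * (2 * d / lam) = 2 / lam * (|γ| * d) := by ring
  rw [powConst, e]
  have : 0 ≤ |γ| * d := by positivity
  have h4 : 0 ≤ 2 / lam * (|γ| * d) := by positivity
  have h5 : 0 ≤ 2 / lam * |γ| := by positivity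
  have h6 : 0 ≤ 2 / lam * d := by positivity
  nlinarith

theorem le_powConst' {lam : ℝ} (hlam : 0 < lam) {γ : ℝ} (hγ : 0 ≤ γ) :
    (2 / lam + 1) * γ ≤ powConst lam γ := by
  have h1 : 0 ≤ 1 / |2 * γ - 1| := by positivity
  have h3 : 0 < 2 / lam := by positivity
  rw [powConst, abs_of_nonneg hγ]
  have h4 : (2 / lam + 1) * γ ≤ (2 / lam + 1) * (1 + γ) := by gcongr; linarith
  refine h4.trans ?_
  exact le_mul_of_one_le_right (by positivity) (by linarith)

section
variable {Ω : Set (Eu n)} {lam Lam Gam : ℝ} {a b : Eu n → Matrix (Fin n) (Fin n) ℝ}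
  {u : Eu n → ℝ} {Du : Eu n → Eu n} {η : Eu n → ℝ} {ε γ : ℝ}

/-- For `γ < 1` the function `h = γ (t + ε)^(γ - 1)` is bounded thanks to `ε`, so explicit
primitives suffice: `H = (t + ε)^γ` and `G = γ² (t + ε)^(2γ - 1) / (2γ - 1)`. The excluded value `γ
= 1 / 2` is where `G` would be a logarithm, and the constant degenerates like `1 / |2γ - 1|` nearby.
-/
theorem IsNonnegSolution.power_estimate_lt_one (hS : IsNonnegSolution Ω lam Lam Gam a b u Du)
    (hn : 3 ≤ n) (hlam : 0 < lam) (hη : ContDiff ℝ ∞ η) (hc : HasCompactSupport η)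
    (hs : tsupport η ⊆ Ω) (hε : 0 < ε) (hγ0 : γ ≠ 0) (hγ2 : 2 * γ - 1 ≠ 0) (hγ : γ < 1)
    (c : Matrix (Fin n) (Fin n) ℝ) :
    eLpNorm (fun x => η x * (u x + ε) ^ γ) (sobExp n) (volume.restrict Ω) ≤
      sobConst n * (ENNReal.ofReal (powConst lam γ) *
        eLpNorm (fun x => (1 + oscWeight Lam b c x) * ‖egrad η x‖ * (u x + ε) ^ γ) 2
          (volume.restrict Ω)) := by
  have hpos : ∀ t : ℝ, 0 < max t 0 + ε := fun t => by positivity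
  set h : ℝ → ℝ := fun t => γ * (max t 0 + ε) ^ (γ - 1) with hh
  have hcont : Continuous h := by
    refine continuous_const.mul (Continuous.rpow_const (by fun_prop) fun t => Or.inl (hpos t).ne')
  have hM : ∀ t, |h t| ≤ |γ| * ε ^ (γ - 1) := by
    intro t
    rw [hh, abs_mul, abs_of_nonneg (Real.rpow_nonneg (hpos t).le _)]
    refine mul_le_mul_of_nonneg_left ?_ (abs_nonneg γ)
    refine Real.rpow_le_rpow_of_nonpos hε ?_ ?_ <;> linarith [le_max_right t 0]
  have hmul : ∀ t, 0 ≤ t → (t + ε) * h t = γ * (t + ε) ^ γ := by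
    intro t ht
    simp only [hh]
    rw [max_eq_left ht, Real.rpow_sub_one (by positivity)]
    field_simp
  have hsq : ∀ t, 0 ≤ t → h t ^ 2 = γ ^ 2 * (t + ε) ^ (2 * γ - 1 - 1) := by
    intro t ht
    simp only [hh]
    rw [max_eq_left ht, mul_pow, ← Real.rpow_natCast ((t + ε) ^ (γ - 1)),
      ← Real.rpow_mul (by positivity)]
    congr 2
    push_cast
    ring
  set P : ℝ → ℝ := fun t => γ ^ 2 * ((t + ε) ^ (2 * γ - 1) / (2 * γ - 1)) with hP
  have hHeq : ∀ t, 0 ≤ t → (0 + ε) ^ γ + ∫ s in (0 : ℝ)..t, h s = (t + ε) ^ γ := by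
    intro t ht
    refine const_add_integral_eq (P := fun t => (t + ε) ^ γ) hcont ht fun s hs _ => ?_
    simpa only [hh, max_eq_left hs] using hasDerivAt_add_rpow (by positivity : 0 < s + ε) γ
  have hGeq : ∀ t, 0 ≤ t → P 0 + ∫ s in (0 : ℝ)..t, h s ^ 2 = P t := by
    intro t ht
    refine const_add_integral_eq (h := fun s => h s ^ 2) (hcont.pow 2) ht fun s hs _ => ?_
    rw [hsq s hs]
    have := ((hasDerivAt_add_rpow (by positivity : 0 < s + ε) (2 * γ - 1)).div_const
      (2 * γ - 1)).const_mul (γ ^ 2)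
    rwa [mul_div_assoc, mul_div_left_comm, div_self hγ2, mul_one] at this
  have key := hS.coeff.sobolev_caccioppoli hn hS.isOpen hlam hS.mem hS.tests hS.nonneg hη hc hs
    (hasDerivAt_const_add_integral (h := fun s => h s ^ 2) (hcont.pow 2) (P 0))
    (hasDerivAt_const_add_integral hcont ((0 + ε) ^ γ)) hcont hM
    (K := 1 / |2 * γ - 1|) (K' := 1 / |γ|) (ε := ε) (by positivity) (by positivity) hε.le
    (fun t ht => by
      have hp : 0 < t + ε := by positivity
      rw [hGeq t ht, hsq t ht, hP, abs_mul, abs_div, abs_of_nonneg (sq_nonneg γ),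
        abs_of_nonneg (Real.rpow_nonneg hp.le _), Real.rpow_sub_one hp.ne' (2 * γ - 1)]
      apply le_of_eq
      field_simp)
    (fun t ht => by
      have hp : 0 < t + ε := by positivity
      rw [hHeq t ht, ← abs_of_pos hp, ← abs_mul, abs_of_pos hp, hmul t ht, abs_mul, ← mul_assoc,
        one_div_mul_cancel (abs_ne_zero.2 hγ0), one_mul]) c
  have hl : eLpNorm (fun x => η x * (u x + ε) ^ γ) (sobExp n) (volume.restrict Ω) ≤
      eLpNorm (fun x => η x * ((0 + ε) ^ γ + ∫ s in (0 : ℝ)..u x, h s)) (sobExp n) := by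
    refine le_trans (le_of_eq (eLpNorm_congr_ae ?_))
      (eLpNorm_mono_measure _ Measure.restrict_le_self)
    filter_upwards [hS.nonneg] with x hx
    rw [hHeq _ hx]
  have hr : eLpNorm (fun x => (1 + oscWeight Lam b c x) * ‖egrad η x‖ * ((u x + ε) * h (u x))) 2
      (volume.restrict Ω) ≤ ENNReal.ofReal |γ| *
      eLpNorm (fun x => (1 + oscWeight Lam b c x) * ‖egrad η x‖ * (u x + ε) ^ γ) 2
          (volume.restrict Ω) := by
    refine eLpNorm_le_mul_eLpNorm_of_ae_le_mul ?_ 2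
    filter_upwards [hS.nonneg] with x hx
    rw [hmul _ hx, mul_left_comm, norm_mul, Real.norm_eq_abs γ]
  refine hl.trans (key.trans (mul_le_mul' le_rfl ?_))
  refine (mul_le_mul' le_rfl hr).trans ?_
  rw [← mul_assoc, ← ENNReal.ofReal_mul (by positivity)]
  gcongr
  refine le_trans (le_of_eq ?_) (le_powConst hlam γ)
  have := abs_pos.2 hγ0
  field_simp

/-- For `γ ≥ 1` the power is unbounded, so the base of `h` is capped at `ε + k` and `k → ∞` by
Fatou. No formula for the primitives is needed: `h` is nonnegative and increasing, so the integral
of `h²` up to `t` is at most `t h(t)²`, and `K = K' = 1` work for every `k`. -/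
theorem IsNonnegSolution.power_estimate_one_le (hS : IsNonnegSolution Ω lam Lam Gam a b u Du)
    (hn : 3 ≤ n) (hlam : 0 < lam) (hη : ContDiff ℝ ∞ η) (hc : HasCompactSupport η)
    (hs : tsupport η ⊆ Ω) (hε : 0 < ε) (hγ : 1 ≤ γ)
    (c : Matrix (Fin n) (Fin n) ℝ) :
    eLpNorm (fun x => η x * (u x + ε) ^ γ) (sobExp n) (volume.restrict Ω) ≤
      sobConst n * (ENNReal.ofReal (powConst lam γ) *
        eLpNorm (fun x => (1 + oscWeight Lam b c x) * ‖egrad η x‖ * (u x + ε) ^ γ) 2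
          (volume.restrict Ω)) := by
  have hγ0 : 0 < γ := by linarith
  set h : ℕ → ℝ → ℝ := fun k t => γ * (min (max t 0 + ε) (ε + k)) ^ (γ - 1) with hh
  set H : ℕ → ℝ → ℝ := fun k t => (0 + ε) ^ γ + ∫ s in (0 : ℝ)..t, h k s with hH
  have hpos : ∀ (k : ℕ) (t : ℝ), 0 < min (max t 0 + ε) (ε + k) := fun k t => by positivity
  have hcont : ∀ k, Continuous (h k) := fun k =>
    continuous_const.mul (Continuous.rpow_const (by fun_prop) fun t => Or.inl (hpos k t).ne')
  have hnn : ∀ k t, 0 ≤ h k t := fun k t =>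
    mul_nonneg hγ0.le (Real.rpow_nonneg (hpos k t).le _)
  have hmono : ∀ k, Monotone (h k) := fun k s t hst => by
    simp only [hh]
    have := (hpos k s).le
    gcongr
  have hM : ∀ k t, |h k t| ≤ γ * (ε + k) ^ (γ - 1) := by
    intro k t
    rw [abs_of_nonneg (hnn k t)]
    simp only [hh]
    have := (hpos k t).le
    gcongr
    exact min_le_right _ _
  have hint : ∀ (f : ℝ → ℝ), Continuous f → Monotone f → ∀ t, 0 ≤ t →
      ∫ s in (0 : ℝ)..t, f s ≤ t * f t := by
    intro f hf hm t ht
    have := intervalIntegral.integral_mono_on ht (hf.intervalIntegrable (μ := volume) 0 t)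
      (continuous_const.intervalIntegrable 0 t) (fun s hs => hm hs.2)
    simpa using this
  have hHeq : ∀ (k : ℕ) (t : ℝ), 0 ≤ t → t ≤ k → H k t = (t + ε) ^ γ := by
    intro k t ht htk
    refine const_add_integral_eq (P := fun t => (t + ε) ^ γ) (hcont k) ht fun s hs hst => ?_
    have := hasDerivAt_add_rpow (by positivity : 0 < s + ε) γ
    simpa only [hh, max_eq_left hs, min_eq_left (by linarith : s + ε ≤ ε + k)] using this
  have hr : ∀ k, eLpNorm (fun x => (1 + oscWeight Lam b c x) * ‖egrad η x‖ *
      ((u x + ε) * h k (u x))) 2 (volume.restrict Ω) ≤ ENNReal.ofReal γ *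
      eLpNorm (fun x => (1 + oscWeight Lam b c x) * ‖egrad η x‖ * (u x + ε) ^ γ) 2
          (volume.restrict Ω) := by
    intro k
    refine eLpNorm_le_mul_eLpNorm_of_ae_le_mul ?_ 2
    filter_upwards [hS.nonneg] with x hx
    have hp : 0 < u x + ε := by positivity
    have h1 : (u x + ε) * h k (u x) ≤ γ * (u x + ε) ^ γ := by
      have h2 : (min (max (u x) 0 + ε) (ε + k)) ^ (γ - 1) ≤ (u x + ε) ^ (γ - 1) := by
        refine Real.rpow_le_rpow (hpos k _).le ?_ (by linarith)
        rw [max_eq_left hx]; exact min_le_left _ _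
      calc (u x + ε) * h k (u x) ≤ (u x + ε) * (γ * (u x + ε) ^ (γ - 1)) := by
            simp only [hh]; gcongr
        _ = γ * (u x + ε) ^ γ := by
            rw [Real.rpow_sub_one hp.ne']; field_simp
    rw [norm_mul, norm_mul _ ((u x + ε) ^ γ), mul_left_comm γ]
    refine mul_le_mul_of_nonneg_left ?_ (norm_nonneg _)
    rw [Real.norm_of_nonneg (mul_nonneg hp.le (hnn _ _)),
      Real.norm_of_nonneg (Real.rpow_nonneg hp.le _)]
    exact h1
  have key : ∀ k, eLpNorm (fun x => η x * H k (u x)) (sobExp n) (volume.restrict Ω) ≤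
      sobConst n * (ENNReal.ofReal (powConst lam γ) *
        eLpNorm (fun x => (1 + oscWeight Lam b c x) * ‖egrad η x‖ * (u x + ε) ^ γ) 2
          (volume.restrict Ω)) := by
    intro k
    have hsqm : ∀ t, 0 ≤ t → ∫ s in (0 : ℝ)..t, h k s ^ 2 ≤ t * h k t ^ 2 :=
      hint (fun s => h k s ^ 2) ((hcont k).pow 2) fun s t hst =>
        pow_le_pow_left₀ (hnn k s) (hmono k hst) 2
    have := hS.coeff.sobolev_caccioppoli hn hS.isOpen hlam hS.mem hS.tests hS.nonneg hη hc hs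
      (hasDerivAt_const_add_integral (h := fun s => h k s ^ 2) ((hcont k).pow 2) (ε * h k 0 ^ 2))
      (hasDerivAt_const_add_integral (hcont k) ((0 + ε) ^ γ)) (hcont k) (hM k)
      (K := 1) (K' := 1) (ε := ε) zero_le_one zero_le_one hε.le
      (fun t ht => by
        have h0 : 0 ≤ ∫ s in (0 : ℝ)..t, h k s ^ 2 :=
          intervalIntegral.integral_nonneg ht fun s _ => sq_nonneg _
        rw [abs_of_nonneg (by positivity)]
        have h1 : h k 0 ^ 2 ≤ h k t ^ 2 := pow_le_pow_left₀ (hnn k 0) (hmono k ht) 2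
        nlinarith [hsqm t ht, mul_le_mul_of_nonneg_left h1 hε.le])
      (fun t ht => by
        have h0 : 0 ≤ ∫ s in (0 : ℝ)..t, h k s :=
          intervalIntegral.integral_nonneg ht fun s _ => hnn k s
        -- The initial value of `H` is forced by `H = (t + ε)^γ`; since `ε * h k 0 = γ ε^γ`, this is
        -- where `γ ≥ 1` enters.
        have h1 : (0 + ε) ^ γ ≤ ε * h k 0 := by
          have : ε ^ γ = ε * ε ^ (γ - 1) := by
            rw [Real.rpow_sub_one hε.ne']; field_simp
          simp only [hh, max_self, zero_add]
          rw [min_eq_left (by simp), this]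
          exact mul_le_mul_of_nonneg_left
            (le_mul_of_one_le_left (Real.rpow_nonneg hε.le _) hγ) hε.le
        have h2 : 0 ≤ (0 + ε) ^ γ := Real.rpow_nonneg (by linarith) _
        rw [abs_of_nonneg (by positivity), abs_of_nonneg (hnn k t)]
        nlinarith [hint (h k) (hcont k) (hmono k) t ht,
          mul_le_mul_of_nonneg_left (hmono k ht) hε.le]) c
    refine (eLpNorm_mono_measure _ Measure.restrict_le_self).trans (this.trans (mul_le_mul' le_rfl ?_))
    refine (mul_le_mul' le_rfl (hr k)).trans ?_
    rw [← mul_assoc, ← ENNReal.ofReal_mul (by positivity)]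
    gcongr
    rw [mul_one]
    exact le_powConst' hlam hγ0.le
  have huΩ : AEStronglyMeasurable u (volume.restrict Ω) := hS.mem.1.1.aestronglyMeasurable
  have hHm : ∀ k, AEStronglyMeasurable (fun x => η x * H k (u x)) (volume.restrict Ω) := fun k =>
    hη.continuous.aestronglyMeasurable.mul ((continuous_iff_continuousAt.2 fun t =>
      (hasDerivAt_const_add_integral (hcont k) _ t).continuousAt).comp_aestronglyMeasurable huΩ)
  refine (Lp.eLpNorm_lim_le_liminf_eLpNorm hHm (fun x => η x * (u x + ε) ^ γ) ?_).trans
    (liminf_le_of_le (by isBoundedDefault) fun B hB => ?_)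
  · filter_upwards [hS.nonneg] with x hx
    -- At each point the sequence is eventually constant: the cap is inactive once `k ≥ u x`.
    refine tendsto_const_nhds.congr' ?_
    filter_upwards [eventually_ge_atTop ⌈u x⌉₊] with k hk
    rw [hHeq k _ hx (Nat.ceil_le.1 hk)]
  · obtain ⟨k, hk⟩ := hB.exists
    exact hk.trans (key k)

theorem IsNonnegSolution.power_estimate (hS : IsNonnegSolution Ω lam Lam Gam a b u Du)
    (hn : 3 ≤ n) (hlam : 0 < lam) (hη : ContDiff ℝ ∞ η) (hc : HasCompactSupport η)
    (hs : tsupport η ⊆ Ω) (hε : 0 < ε) (hγ0 : γ ≠ 0) (hγ2 : 2 * γ - 1 ≠ 0)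
    (c : Matrix (Fin n) (Fin n) ℝ) :
    eLpNorm (fun x => η x * (u x + ε) ^ γ) (sobExp n) (volume.restrict Ω) ≤
      sobConst n * (ENNReal.ofReal (powConst lam γ) *
        eLpNorm (fun x => (1 + oscWeight Lam b c x) * ‖egrad η x‖ * (u x + ε) ^ γ) 2
          (volume.restrict Ω)) := by
  rcases lt_or_ge γ 1 with hγ | hγ
  · exact hS.power_estimate_lt_one hn hlam hη hc hs hε hγ0 hγ2 hγ c
  · exact hS.power_estimate_one_le hn hlam hη hc hs hε hγ c

end

end BMOElliptic

/-! ### Moser iteration and the reverse Hölder inequality. -/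

namespace BMOElliptic

variable {n : ℕ}

/-- By Chebyshev `μ {v ≥ c} ≤ (B / c) ^ t`, which tends to zero as `t → ∞` for every finite `c > B`.
-/
theorem ae_le_of_lintegral_rpow_le {α : Type*} [MeasurableSpace α] {μ : Measure α} {v : α → ℝ≥0∞}
    (hv : AEMeasurable v μ) {t : ℕ → ℝ} (ht0 : ∀ m, 0 < t m) (ht : Tendsto t atTop atTop)
    {B : ℝ≥0∞} (h : ∀ m, ∫⁻ x, v x ^ t m ∂μ ≤ B ^ t m) : ∀ᵐ x ∂μ, v x ≤ B := by
  rcases eq_or_ne B ⊤ with rfl | hB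
  · exact Eventually.of_forall fun x => le_top
  have key : ∀ c : ℝ≥0∞, B < c → c ≠ ⊤ → μ {x | c ≤ v x} = 0 := by
    intro c hc hct
    have hc0 : c ≠ 0 := (pos_of_gt hc).ne'
    have hle : ∀ m, μ {x | c ≤ v x} ≤ (B / c) ^ t m := by
      intro m
      have h1 := (mul_meas_ge_le_lintegral₀ (hv.pow_const (t m)) (c ^ t m)).trans (h m)
      simp only [ENNReal.rpow_le_rpow_iff (ht0 m)] at h1
      rw [ENNReal.div_rpow_of_nonneg _ _ (ht0 m).le, ENNReal.le_div_iff_mul_le, mul_comm]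
      · exact h1
      · left; simp [ENNReal.rpow_eq_zero_iff, hc0, hct]
      · left; exact ENNReal.rpow_ne_top_of_nonneg (ht0 m).le hct
    have hlt : B / c < 1 := by
      rw [ENNReal.div_lt_iff (Or.inl hc0) (Or.inl hct), one_mul]; exact hc
    have hlim := (ENNReal.tendsto_rpow_atTop_of_base_lt_one hlt).comp ht
    exact le_antisymm (ge_of_tendsto' hlim hle) zero_le
  have h2 : ∀ k : ℕ, ∀ᵐ x ∂μ, v x < B + ((k : ℝ≥0∞) + 1)⁻¹ := by
    intro k
    rw [ae_iff]
    simp only [not_lt]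
    refine key _ (ENNReal.lt_add_right hB (ENNReal.inv_ne_zero.2 ?_)) ?_
    · exact ENNReal.add_ne_top.2 ⟨ENNReal.natCast_ne_top k, ENNReal.one_ne_top⟩
    · exact ENNReal.add_ne_top.2 ⟨hB, ENNReal.inv_ne_top.2 (by simp)⟩
  filter_upwards [ae_all_iff.2 h2] with x hx
  have hlim : Tendsto (fun k : ℕ => B + ((k : ℝ≥0∞) + 1)⁻¹) atTop (𝓝 (B + 0)) := by
    refine tendsto_const_nhds.add ?_
    have := (tendsto_add_atTop_iff_nat 1).2 ENNReal.tendsto_inv_nat_nhds_zero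
    simpa using this
  rw [add_zero] at hlim
  exact ge_of_tendsto' hlim fun k => (hx k).le

/-- Moser's iteration: a chain of reverse Hölder inequalities gives an essential bound. -/
theorem exists_moser_const {χ A B : ℝ} (hχ : 1 < χ) (hA : 1 ≤ A) (hB : 0 ≤ B) :
    ∃ E : ℝ≥0∞, E ≠ ⊤ ∧ ∀ {α : Type} [MeasurableSpace α] {μ : Measure α} {S : ℕ → Set α}
      {T : Set α} {v : α → ℝ≥0∞}, (∀ m, T ⊆ S m) → AEMeasurable v (μ.restrict T) →
      (∀ m : ℕ, ∫⁻ x in S (m + 1), v x ^ χ ^ (m + 1) ∂μ ≤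
        (ENNReal.ofReal (B * A ^ m) * ∫⁻ x in S m, v x ^ χ ^ m ∂μ) ^ χ) →
      ∀ᵐ x ∂μ.restrict T, v x ≤ E * ∫⁻ x in S 0, v x ∂μ := by
  have hA0 : 0 < A := by linarith
  have hχ0 : 0 < χ := by linarith
  have hχ1 : 0 < χ - 1 := by linarith
  -- `L` solves `L^χ = A^χ L`, and `E` below is taken large enough for `B^χ L E ≤ E^χ`. These are
  -- exactly the relations that make the induction hypothesis `hind` reproduce itself, so no
  -- infinite product of constants has to be estimated.
  set L := A ^ (χ / (χ - 1)) with hL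
  have hL1 : 1 ≤ L := Real.one_le_rpow hA (by positivity)
  have hLχ : L ^ χ = A ^ χ * L := by
    rw [hL, ← Real.rpow_mul hA0.le, ← Real.rpow_add hA0]
    congr 1
    field_simp
    ring
  set E := max 1 ((B ^ χ * L) ^ (1 / (χ - 1))) with hE
  have hE1 : 1 ≤ E := le_max_left _ _
  have hE0 : 0 < E := by linarith
  have hEχ : B ^ χ * L * E ≤ E ^ χ := by
    have h1 : B ^ χ * L ≤ E ^ (χ - 1) := by
      have h0 : 0 ≤ B ^ χ * L := by positivity
      calc B ^ χ * L = ((B ^ χ * L) ^ (1 / (χ - 1))) ^ (χ - 1) := by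
            rw [← Real.rpow_mul h0, one_div_mul_cancel hχ1.ne', Real.rpow_one]
        _ ≤ E ^ (χ - 1) := Real.rpow_le_rpow (by positivity) (le_max_right _ _) hχ1.le
    calc B ^ χ * L * E ≤ E ^ (χ - 1) * E := by gcongr
      _ = E ^ χ := by rw [Real.rpow_sub_one hE0.ne']; field_simp
  have hstep : ∀ m : ℕ, (B * A ^ m) ^ χ * (E * L ^ (m + 1)) ≤ (E * L ^ m) ^ χ := by
    intro m
    have hpow : ∀ t : ℝ, 0 ≤ t → (t ^ m) ^ χ = (t ^ χ) ^ m := fun t ht => by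
      rw [← Real.rpow_natCast, ← Real.rpow_natCast, ← Real.rpow_mul ht, ← Real.rpow_mul ht,
        mul_comm]
    have e1 : (A ^ m) ^ χ = (A ^ χ) ^ m := hpow A hA0.le
    have e2 : (L ^ m) ^ χ = (A ^ χ) ^ m * L ^ m := by
      rw [← mul_pow, ← hLχ, hpow L (by linarith)]
    rw [Real.mul_rpow hB (by positivity), Real.mul_rpow hE0.le (by positivity), e1, e2]
    calc B ^ χ * (A ^ χ) ^ m * (E * L ^ (m + 1)) = (B ^ χ * L * E) * ((A ^ χ) ^ m * L ^ m) := by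
          ring
      _ ≤ _ := by gcongr
  refine ⟨ENNReal.ofReal E, ENNReal.ofReal_ne_top, ?_⟩
  intro α _ μ S T v hT hv h
  set I : ℕ → ℝ≥0∞ := fun m => ∫⁻ x in S m, v x ^ χ ^ m ∂μ with hI
  have hI0 : ∫⁻ x in S 0, v x ∂μ = I 0 := by simp [hI]
  -- The factor `E * L ^ m ≥ 1` on the left strengthens the claim to absorb the growing constants;
  -- it is dropped at the end.
  have hind : ∀ m : ℕ, I m * ENNReal.ofReal (E * L ^ m) ≤ (ENNReal.ofReal E * I 0) ^ χ ^ m := by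
    intro m
    induction m with
    | zero => simp [mul_comm]
    | succ m ih =>
      calc I (m + 1) * ENNReal.ofReal (E * L ^ (m + 1))
          ≤ (ENNReal.ofReal (B * A ^ m) * I m) ^ χ * ENNReal.ofReal (E * L ^ (m + 1)) := by
            gcongr; exact h m
        _ = I m ^ χ * ENNReal.ofReal ((B * A ^ m) ^ χ * (E * L ^ (m + 1))) := by
            rw [ENNReal.mul_rpow_of_nonneg _ _ hχ0.le,
              ENNReal.ofReal_mul (p := (B * A ^ m) ^ χ) (by positivity),
              ENNReal.ofReal_rpow_of_nonneg (by positivity) hχ0.le]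
            ring
        _ ≤ I m ^ χ * ENNReal.ofReal ((E * L ^ m) ^ χ) := by gcongr; exact hstep m
        _ = (I m * ENNReal.ofReal (E * L ^ m)) ^ χ := by
            rw [ENNReal.mul_rpow_of_nonneg _ _ hχ0.le,
              ENNReal.ofReal_rpow_of_nonneg (by positivity) hχ0.le]
        _ ≤ ((ENNReal.ofReal E * I 0) ^ χ ^ m) ^ χ := by gcongr
        _ = _ := by rw [← ENNReal.rpow_mul, pow_succ]
  rw [hI0]
  refine ae_le_of_lintegral_rpow_le hv (t := fun m => χ ^ m) (fun m => by positivity)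
    (tendsto_pow_atTop_atTop_of_one_lt hχ) fun m => ?_
  calc ∫⁻ x in T, v x ^ χ ^ m ∂μ ≤ I m := lintegral_mono_set (hT m)
    _ ≤ I m * ENNReal.ofReal (E * L ^ m) := by
        refine le_mul_of_one_le_right zero_le ?_
        rw [← ENNReal.ofReal_one]
        exact ENNReal.ofReal_le_ofReal (one_le_mul_of_one_le_of_one_le hE1 (one_le_pow₀ hL1))
    _ ≤ _ := hind m

/-- The exponent of the right hand side of the reverse Hölder inequality. -/
noncomputable def rhExp (n : ℕ) : ℝ := 2 * n / (n - 1)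

/-- The gain of the reverse Hölder inequality. -/
noncomputable def rhGain (n : ℕ) : ℝ := (n - 1) / (n - 2)

theorem rhExp_pos (hn : 3 ≤ n) : 0 < rhExp n := by
  have : (3 : ℝ) ≤ n := by exact_mod_cast hn
  exact div_pos (by linarith) (by linarith)

theorem one_lt_rhGain (hn : 3 ≤ n) : 1 < rhGain n := by
  have : (3 : ℝ) ≤ n := by exact_mod_cast hn
  rw [rhGain, one_lt_div (by linarith)]
  linarith

/-- Placing the weight in `L^{2n}` costs an increase from `2` to `2n/(n-1)` on the right. This is
still below the Sobolev exponent, and the ratio of the two is `rhGain`. -/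
theorem holderTriple_rhExp (hn : 3 ≤ n) :
    ENNReal.HolderTriple (ENNReal.ofReal (2 * n)) (ENNReal.ofReal (rhExp n)) 2 := by
  have : (3 : ℝ) ≤ n := by exact_mod_cast hn
  constructor
  rw [← ENNReal.ofReal_inv_of_pos (by positivity), ← ENNReal.ofReal_inv_of_pos (rhExp_pos hn),
    ← ENNReal.ofReal_add (by positivity) (by have := rhExp_pos hn; positivity),
    show (2 : ℝ≥0∞) = ENNReal.ofReal 2 by simp, ← ENNReal.ofReal_inv_of_pos two_pos, rhExp]
  congr 1
  have h1 : (n : ℝ) - 1 ≠ 0 := by linarith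
  field_simp
  ring

theorem sobExp_eq (hn : 3 ≤ n) : (sobExp n : ℝ≥0∞) = ENNReal.ofReal (rhExp n * rhGain n) := by
  have : (3 : ℝ) ≤ n := by exact_mod_cast hn
  have h1 : (n : ℝ) - 1 ≠ 0 := by linarith
  have h2 : (n : ℝ) - 2 ≠ 0 := by linarith
  rw [sobExp, ENNReal.ofReal, rhExp, rhGain]
  congr 3
  field_simp

section
variable {Ω : Set (Eu n)} {lam Lam Gam : ℝ} {a b : Eu n → Matrix (Fin n) (Fin n) ℝ}
  {u : Eu n → ℝ} {Du : Eu n → Eu n} {ε γ : ℝ}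

theorem IsNonnegSolution.aestronglyMeasurable_rpow
    (hS : IsNonnegSolution Ω lam Lam Gam a b u Du) (ε γ : ℝ) :
    AEStronglyMeasurable (fun x => (u x + ε) ^ γ) (volume.restrict Ω) := by
  have huΩ : AEStronglyMeasurable u (volume.restrict Ω) := hS.mem.1.1.aestronglyMeasurable
  exact ((huΩ.aemeasurable.add_const ε).pow_const γ).aestronglyMeasurable

/-- Reverse Hölder inequality for powers of a solution. -/
theorem IsNonnegSolution.reverse_holder (hS : IsNonnegSolution Ω lam Lam Gam a b u Du)
    (hn : 3 ≤ n) (hlam : 0 < lam) (hGam : 0 ≤ Gam) {z : Eu n} {r ρ ρ' : ℝ}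
    (hQ : ccube z r ⊆ Ω) (hρ : 0 < ρ) (hρ' : ρ < ρ') (hρr : ρ' ≤ r) (hε : 0 < ε) (hγ0 : γ ≠ 0)
    (hγ2 : 2 * γ - 1 ≠ 0) :
    eLpNorm (fun x => (u x + ε) ^ γ) (sobExp n) (volume.restrict (Metric.closedBall z ρ)) ≤
      ENNReal.ofReal (sobConst n * powConst lam γ * (cutoffConst / (ρ' - ρ)) *
        weightConst n Lam Gam (2 * n)) * volume (ccube z r) ^ (1 / (2 * n : ℝ)) *
      eLpNorm (fun x => (u x + ε) ^ γ) (ENNReal.ofReal (rhExp n))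
        (volume.restrict (Metric.closedBall z ρ')) := by
  have hn3 : (3 : ℝ) ≤ n := by exact_mod_cast hn
  obtain ⟨η, hη, hηc, hηs, hη1, hηg⟩ := exists_ball_cutoff z hρ hρ'
  set B' := Metric.closedBall z ρ'
  set B := Metric.closedBall z ρ
  have hB'Q : B' ⊆ ccube z r :=
    (Metric.closedBall_subset_closedBall hρr).trans (closedBall_subset_ccube z r)
  have hB'Ω : B' ⊆ Ω := hB'Q.trans hQ
  have hBB' : B ⊆ B' := Metric.closedBall_subset_closedBall hρ'.le
  have hcd : 0 < cutoffConst / (ρ' - ρ) := div_pos cutoffConst_pos (by linarith)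
  set c := meanMat b (WithLp.toLp 2 fun i => z i - r) (2 * r) with hc
  set w : Eu n → ℝ := fun x => 1 + oscWeight Lam b c x with hw
  have w_nonneg : ∀ x, 0 ≤ w x := fun x => by
    have := oscWeight_nonneg Lam b c x
    simp only [hw]; linarith
  have hp := hS.power_estimate hn hlam hη hηc (hηs.trans hB'Ω) hε hγ0 hγ2 c
  have hl : eLpNorm (fun x => (u x + ε) ^ γ) (sobExp n) (volume.restrict B) ≤
      eLpNorm (fun x => η x * (u x + ε) ^ γ) (sobExp n) (volume.restrict Ω) := by
    refine le_trans (le_of_eq (eLpNorm_congr_ae ?_))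
      (eLpNorm_mono_measure _ (Measure.restrict_mono (hBB'.trans hB'Ω) le_rfl))
    filter_upwards [ae_restrict_mem Metric.isClosed_closedBall.measurableSet] with x hx
    rw [hη1 x hx, one_mul]
  have hr1 : eLpNorm (fun x => (1 + oscWeight Lam b c x) * ‖egrad η x‖ * (u x + ε) ^ γ) 2
      (volume.restrict Ω) ≤ ENNReal.ofReal (cutoffConst / (ρ' - ρ)) *
        eLpNorm (w • fun x => (u x + ε) ^ γ) 2 (volume.restrict B') := by
    have e : volume.restrict B' = (volume.restrict Ω).restrict B' := by
      rw [Measure.restrict_restrict Metric.isClosed_closedBall.measurableSet,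
        Set.inter_eq_left.2 hB'Ω]
    rw [e, ← eLpNorm_indicator_eq_eLpNorm_restrict Metric.isClosed_closedBall.measurableSet]
    refine eLpNorm_le_mul_eLpNorm_of_ae_le_mul (Eventually.of_forall fun x => ?_) 2
    by_cases hx : x ∈ B'
    · rw [Set.indicator_of_mem hx, Pi.smul_apply', smul_eq_mul, norm_mul, norm_mul, norm_mul,
        norm_norm, ← mul_assoc, mul_comm ‖w x‖]
      gcongr
      exact hηg x
    · rw [egrad_eq_zero_of_notMem (fun h => hx (hηs h))]
      simp only [norm_zero, mul_zero, zero_mul]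
      positivity
  have hwm : AEStronglyMeasurable w (volume.restrict B') :=
    aestronglyMeasurable_const.add
      ((hS.coeff.aestronglyMeasurable_oscWeight c).mono_measure (Measure.restrict_mono hB'Ω le_rfl))
  -- The only place in the iteration where `b` is felt: Hölder separates the weight from the power
  -- of `u + ε`.
  have hhol := @eLpNorm_smul_le_mul_eLpNorm _ _ _ _ (volume.restrict B') _ _ _ _
    (ENNReal.ofReal (2 * n)) (ENNReal.ofReal (rhExp n)) 2 (fun x => (u x + ε) ^ γ)
    ((hS.aestronglyMeasurable_rpow ε γ).mono_measure (Measure.restrict_mono hB'Ω le_rfl)) w hwm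
    (holderTriple_rhExp hn)
  have hwn : eLpNorm w (ENNReal.ofReal (2 * n)) (volume.restrict B') ≤
      ENNReal.ofReal (weightConst n Lam Gam (2 * n)) * volume (ccube z r) ^ (1 / (2 * n : ℝ)) :=
    (eLpNorm_mono_measure _ (Measure.restrict_mono hB'Q le_rfl)).trans
      (hS.coeff.eLpNorm_weight_le hGam (by linarith) hQ (by linarith))
  have hW := weightConst_pos n Lam (p := 2 * n) hGam (by linarith)
  have hP := powConst_pos hlam γ
  calc _ ≤ _ := hl
    _ ≤ _ := hp
    _ ≤ sobConst n * (ENNReal.ofReal (powConst lam γ) *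
        (ENNReal.ofReal (cutoffConst / (ρ' - ρ)) *
        ((ENNReal.ofReal (weightConst n Lam Gam (2 * n)) *
          volume (ccube z r) ^ (1 / (2 * n : ℝ))) *
        eLpNorm (fun x => (u x + ε) ^ γ) (ENNReal.ofReal (rhExp n)) (volume.restrict B')))) := by
      refine mul_le_mul' le_rfl (mul_le_mul' le_rfl (hr1.trans (mul_le_mul' le_rfl
        (hhol.trans (mul_le_mul' hwn le_rfl)))))
    _ = _ := by
      rw [ENNReal.ofReal_mul (by positivity), ENNReal.ofReal_mul (by positivity),
        ENNReal.ofReal_mul (by positivity), ENNReal.ofReal_coe_nnreal]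
      ring

end

end BMOElliptic

/-! ### Scale-invariant local boundedness of powers. -/

namespace BMOElliptic

variable {n : ℕ}

theorem volume_ccube (z : Eu n) {r : ℝ} (hr : 0 ≤ r) :
    volume (ccube z r) = ENNReal.ofReal (2 * r) ^ n := by
  rw [ccube, volume_cube _ (by positivity), ENNReal.ofReal_pow (by positivity)]

/-- Lebesgue measure, normalised on the cube with centre `z` and half-side `r`. -/
noncomputable def avgMeasure (z : Eu n) (r : ℝ) : Measure (Eu n) :=
  (volume (ccube z r))⁻¹ • volume

theorem setLIntegral_avgMeasure (z : Eu n) (r : ℝ) (S : Set (Eu n)) (f : Eu n → ℝ≥0∞) :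
    ∫⁻ x in S, f x ∂avgMeasure z r = (volume (ccube z r))⁻¹ * ∫⁻ x in S, f x := by
  rw [avgMeasure, Measure.restrict_smul, lintegral_smul_measure, smul_eq_mul]

theorem eLpNorm_rpow_eq {μ : Measure (Eu n)} {u : Eu n → ℝ} (hu : ∀ᵐ x ∂μ, 0 ≤ u x) {ε γ s : ℝ}
    (hε : 0 < ε) (hs : 0 < s) :
    eLpNorm (fun x => (u x + ε) ^ γ) (ENNReal.ofReal s) μ =
      (∫⁻ x, ENNReal.ofReal (u x + ε) ^ (γ * s) ∂μ) ^ (1 / s) := by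
  rw [eLpNorm_eq_lintegral_rpow_enorm_toReal (by simpa using hs) ENNReal.ofReal_ne_top,
    ENNReal.toReal_ofReal hs.le]
  congr 1
  refine lintegral_congr_ae ?_
  filter_upwards [hu] with x hx
  have hp : 0 < u x + ε := by positivity
  rw [Real.enorm_of_nonneg (by positivity), ← ENNReal.ofReal_rpow_of_pos hp, ENNReal.rpow_mul]

section
variable {Ω : Set (Eu n)} {lam Lam Gam : ℝ} {a b : Eu n → Matrix (Fin n) (Fin n) ℝ}
  {u : Eu n → ℝ} {Du : Eu n → Eu n} {ε γ : ℝ}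

theorem IsNonnegSolution.aemeasurable_rpow
    (hS : IsNonnegSolution Ω lam Lam Gam a b u Du) (ε γ : ℝ) :
    AEMeasurable (fun x => ENNReal.ofReal (u x + ε) ^ γ) (volume.restrict Ω) := by
  have huΩ : AEStronglyMeasurable u (volume.restrict Ω) := hS.mem.1.1.aestronglyMeasurable
  exact (huΩ.aemeasurable.add_const ε).ennreal_ofReal.pow_const γ

/-- In terms of averages the only length left in the constant is `2 r`, which the `1 / (ρ' - ρ)` of
the cutoff cancels up to a number. This is what makes the iteration constant independent of `r`. -/
theorem IsNonnegSolution.reverse_holder_avg (hS : IsNonnegSolution Ω lam Lam Gam a b u Du)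
    (hn : 3 ≤ n) (hlam : 0 < lam) (hGam : 0 ≤ Gam) {z : Eu n} {r ρ ρ' : ℝ}
    (hQ : ccube z r ⊆ Ω) (hρ : 0 < ρ) (hρ' : ρ < ρ') (hρr : ρ' ≤ r) (hε : 0 < ε) (hγ0 : γ ≠ 0)
    (hγ2 : 2 * γ - 1 ≠ 0) :
    ∫⁻ x in Metric.closedBall z ρ,
        ENNReal.ofReal (u x + ε) ^ (γ * (rhExp n * rhGain n)) ∂avgMeasure z r ≤
      (ENNReal.ofReal (sobConst n * powConst lam γ * (cutoffConst / (ρ' - ρ)) *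
        weightConst n Lam Gam (2 * n) * (2 * r)) ^ rhExp n *
      ∫⁻ x in Metric.closedBall z ρ',
        ENNReal.ofReal (u x + ε) ^ (γ * rhExp n) ∂avgMeasure z r) ^ rhGain n := by
  have hn3 : (3 : ℝ) ≤ n := by exact_mod_cast hn
  have hr : 0 < r := by linarith
  have hq := rhExp_pos hn
  have hχ : 0 < rhGain n := by linarith [one_lt_rhGain hn]
  have h := hS.reverse_holder hn hlam hGam hQ hρ hρ' hρr hε hγ0 hγ2
  have hball : ∀ s, s ≤ r → ∀ᵐ x ∂volume.restrict (Metric.closedBall z s), 0 ≤ u x := fun s hs =>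
    ae_restrict_of_ae_restrict_of_subset (((Metric.closedBall_subset_closedBall hs).trans
      (closedBall_subset_ccube z r)).trans hQ) hS.nonneg
  rw [sobExp_eq hn, eLpNorm_rpow_eq (hball ρ (by linarith)) hε (by positivity),
    eLpNorm_rpow_eq (hball ρ' hρr) hε hq] at h
  rw [setLIntegral_avgMeasure, setLIntegral_avgMeasure]
  set K := sobConst n * powConst lam γ * (cutoffConst / (ρ' - ρ)) * weightConst n Lam Gam (2 * n)
  have hK : 0 ≤ K := by
    have := weightConst_pos n Lam (p := 2 * n) hGam (by linarith)
    have := powConst_pos hlam γ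
    have : 0 < cutoffConst / (ρ' - ρ) := div_pos cutoffConst_pos (by linarith)
    positivity
  set X := ∫⁻ x in Metric.closedBall z ρ, ENNReal.ofReal (u x + ε) ^ (γ * (rhExp n * rhGain n))
  set Y := ∫⁻ x in Metric.closedBall z ρ', ENNReal.ofReal (u x + ε) ^ (γ * rhExp n)
  set q := rhExp n with hqd
  set χ := rhGain n with hχd
  rw [volume_ccube z hr.le] at h ⊢
  rw [ENNReal.ofReal_mul hK]
  set T := ENNReal.ofReal (2 * r)
  have hT0 : T ≠ 0 := by simpa [T] using hr
  have hTt : T ≠ ⊤ := ENNReal.ofReal_ne_top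
  set k := ENNReal.ofReal K
  have h1 : X ≤ (k * (T ^ n) ^ (1 / (2 * n : ℝ)) * Y ^ (1 / q)) ^ (q * χ) := by
    have := ENNReal.rpow_le_rpow h (by positivity : 0 ≤ q * χ)
    rwa [← ENNReal.rpow_mul, one_div_mul_cancel (by positivity), ENNReal.rpow_one] at this
  refine (mul_le_mul' le_rfl h1).trans (le_of_eq ?_)
  have hqχ : 0 ≤ q * χ := by positivity
  rw [ENNReal.mul_rpow_of_nonneg _ _ hqχ, ENNReal.mul_rpow_of_nonneg _ _ hqχ,
    ENNReal.mul_rpow_of_nonneg _ _ hχ.le, ENNReal.mul_rpow_of_nonneg _ _ hχ.le,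
    ENNReal.mul_rpow_of_nonneg _ _ hq.le,
    ENNReal.mul_rpow_of_nonneg _ _ hχ.le,
    ← ENNReal.rpow_natCast, ← ENNReal.rpow_neg, ← ENNReal.rpow_mul, ← ENNReal.rpow_mul,
    ← ENNReal.rpow_mul, ← ENNReal.rpow_mul, ← ENNReal.rpow_mul, ← ENNReal.rpow_mul,
    show 1 / q * (q * χ) = χ by field_simp]
  -- The count of powers of the side length `T = 2 r`; it balances because `rhExp n * rhGain n` is
  -- the Sobolev conjugate of `2`.
  have e : T ^ (-(n : ℝ)) * T ^ ((n : ℝ) * (1 / (2 * n)) * (q * χ)) =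
      T ^ (q * χ) * T ^ (-(n : ℝ) * χ) := by
    rw [← ENNReal.rpow_add _ _ hT0 hTt, ← ENNReal.rpow_add _ _ hT0 hTt]
    congr 1
    rw [hqd, hχd, rhExp, rhGain]
    have h1 : (n : ℝ) - 1 ≠ 0 := by linarith
    have h2 : (n : ℝ) - 2 ≠ 0 := by linarith
    field_simp
    ring
  calc _ = (T ^ (-(n : ℝ)) * T ^ ((n : ℝ) * (1 / (2 * n)) * (q * χ))) * (k ^ (q * χ) * Y ^ χ) := by
        ring_nf
    _ = _ := by rw [e]; ring

end

/-- Local boundedness of powers of solutions. -/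
theorem exists_local_bound (hn : 3 ≤ n) {lam : ℝ} (hlam : 0 < lam) (Lam : ℝ) {Gam : ℝ}
    (hGam : 0 ≤ Gam) {δ : ℝ} (hδ : 0 < δ) :
    ∃ E : ℝ≥0∞, E ≠ ⊤ ∧ ∀ (Ω : Set (Eu n)) (a b : Eu n → Matrix (Fin n) (Fin n) ℝ) (u : Eu n → ℝ)
      (Du : Eu n → Eu n), IsNonnegSolution Ω lam Lam Gam a b u Du → ∀ (z : Eu n) (r : ℝ), 0 < r →
      ccube z r ⊆ Ω → ∀ ε γ : ℝ, 0 < ε → γ ≠ 0 → |γ| ≤ 1 →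
      (∀ m : ℕ, δ ≤ |2 * (γ * rhGain n ^ m) - 1|) →
      ∀ᵐ x ∂volume.restrict (Metric.closedBall z (r / 2)),
        ENNReal.ofReal (u x + ε) ^ (γ * rhExp n) ≤
          E * ∫⁻ x in Metric.closedBall z r,
            ENNReal.ofReal (u x + ε) ^ (γ * rhExp n) ∂avgMeasure z r := by
  have hn3 : (3 : ℝ) ≤ n := by exact_mod_cast hn
  have hq := rhExp_pos hn
  have hχ := one_lt_rhGain hn
  set q := rhExp n
  set χ := rhGain n
  have hχ0 : 0 < χ := by linarith
  have hW := weightConst_pos n Lam (p := 2 * n) hGam (by linarith)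
  have hcc := cutoffConst_pos
  -- The `8` is `(2 r) / (r / 4)` from the first gap between radii. Step `m` brings `2 ^ m` from the
  -- shrinking gaps and `χ ^ m` from `powConst`, whence the ratio `2 * χ`. The lower bound `δ`
  -- controls the degenerate factor `1 / |2γ - 1|` at every step, for either sign of the exponent.
  set B := 8 * sobConst n * cutoffConst * weightConst n Lam Gam (2 * n) *
    ((2 / lam + 1) * 2 * (1 + 1 / δ)) with hB
  have hB0 : 0 ≤ B := by positivity
  obtain ⟨E, hE, hmoser⟩ := exists_moser_const (χ := χ) (A := (2 * χ) ^ q) (B := B ^ q) hχ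
    (Real.one_le_rpow (by linarith) hq.le) (by positivity)
  refine ⟨E, hE, fun Ω a b u Du hS z r hr hQ ε γ hε hγ0 hγ1 hγδ => ?_⟩
  -- Radii decreasing geometrically from `r` to `r / 2`.
  set ρ : ℕ → ℝ := fun m => r / 2 * (1 + (1 / 2) ^ m) with hρ
  have hρ0 : ∀ m, 0 < ρ m := fun m => by positivity
  have hρr : ∀ m, ρ m ≤ r := fun m => by
    have : ((1 : ℝ) / 2) ^ m ≤ 1 := pow_le_one₀ (by norm_num) (by norm_num)
    simp only [hρ]
    nlinarith
  have hρs : ∀ m, ρ m - ρ (m + 1) = r / 4 * (1 / 2) ^ m := fun m => by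
    simp only [hρ, pow_succ]; ring
  have hρlt : ∀ m, ρ (m + 1) < ρ m := fun m => by
    have : 0 < r / 4 * (1 / 2) ^ m := by positivity
    linarith [hρs m]
  have hsub : ∀ m, Metric.closedBall z (r / 2) ⊆ Metric.closedBall z (ρ m) := fun m =>
    Metric.closedBall_subset_closedBall (by
      have : 0 < r / 2 * ((1 : ℝ) / 2) ^ m := by positivity
      simp only [hρ]; linarith)
  have hBΩ : Metric.closedBall z (r / 2) ⊆ Ω := ((hsub 0).trans
    (Metric.closedBall_subset_closedBall (hρr 0))).trans ((closedBall_subset_ccube z r).trans hQ)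
  have hv0 : volume (ccube z r) ≠ ⊤ := volume_cube_ne_top _ _
  have hρ00 : ρ 0 = r := by simp only [hρ]; ring
  have key := hmoser (μ := avgMeasure z r) (S := fun m => Metric.closedBall z (ρ m))
    (T := Metric.closedBall z (r / 2)) (v := fun x => ENNReal.ofReal (u x + ε) ^ (γ * q)) hsub ?_ ?_
  · have e : (avgMeasure z r).restrict (Metric.closedBall z (r / 2)) =
        (volume (ccube z r))⁻¹ • volume.restrict (Metric.closedBall z (r / 2)) := by
      rw [avgMeasure, Measure.restrict_smul]
    rw [e, Measure.ae_ennreal_smul_measure_iff (ENNReal.inv_ne_zero.2 hv0)] at key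
    simpa only [hρ00] using key
  · rw [avgMeasure, Measure.restrict_smul]
    exact ((hS.aemeasurable_rpow ε (γ * q)).mono_measure
      (Measure.restrict_mono hBΩ le_rfl)).smul_measure _
  · intro m
    have hpow1 : 1 ≤ χ ^ m := one_le_pow₀ hχ.le
    have hne : 2 * (γ * χ ^ m) - 1 ≠ 0 := abs_pos.1 (hδ.trans_le (hγδ m))
    have h := hS.reverse_holder_avg hn hlam hGam hQ (hρ0 (m + 1)) (hρlt m) (hρr m) hε
      (γ := γ * χ ^ m) (by positivity) hne
    simp only [← ENNReal.rpow_mul]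
    rw [show γ * q * χ ^ (m + 1) = γ * χ ^ m * (q * χ) by ring,
      show γ * q * χ ^ m = γ * χ ^ m * q by ring]
    refine h.trans ?_
    gcongr
    rw [ENNReal.ofReal_rpow_of_nonneg ?_ hq.le]
    swap
    · have := powConst_pos hlam (γ * χ ^ m)
      have : 0 ≤ cutoffConst / (ρ m - ρ (m + 1)) := div_nonneg hcc.le (by linarith [hρlt m])
      positivity
    refine ENNReal.ofReal_le_ofReal ?_
    have hP : powConst lam (γ * χ ^ m) ≤ (2 / lam + 1) * 2 * (1 + 1 / δ) * χ ^ m := by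
      have h1 : 1 + |γ * χ ^ m| ≤ 2 * χ ^ m := by
        rw [abs_mul, abs_of_pos (by positivity : 0 < χ ^ m)]
        nlinarith
      rw [powConst]
      calc _ ≤ (2 / lam + 1) * (2 * χ ^ m) * (1 + 1 / δ) := by
            gcongr
            exact hγδ m
        _ = _ := by ring
    have e1 : (B ^ q * ((2 * χ) ^ q) ^ m) = (B * (2 * χ) ^ m) ^ q := by
      rw [Real.mul_rpow hB0 (by positivity), ← Real.rpow_natCast, ← Real.rpow_natCast,
        ← Real.rpow_mul (by positivity), ← Real.rpow_mul (by positivity), mul_comm q]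
    rw [e1, hρs m]
    have hP0 := powConst_pos hlam (γ * χ ^ m)
    refine Real.rpow_le_rpow (by positivity) ?_ hq.le
    calc _ = 8 * sobConst n * cutoffConst * weightConst n Lam Gam (2 * n) *
          powConst lam (γ * χ ^ m) * 2 ^ m := by
          rw [one_div, inv_pow]
          field_simp
          ring
      _ ≤ 8 * sobConst n * cutoffConst * weightConst n Lam Gam (2 * n) *
          ((2 / lam + 1) * 2 * (1 + 1 / δ) * χ ^ m) * 2 ^ m := by gcongr
      _ = _ := by rw [hB, mul_pow]; ring

end BMOElliptic

/-! ### The logarithm of a solution and exponential integrability. -/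

namespace BMOElliptic

variable {n : ℕ}

/-- The bound for the mean oscillation of the logarithm of a solution. -/
noncomputable def logConst (n : ℕ) (lam Lam Gam : ℝ) : ℝ :=
  2 ^ n * (4 * n) ^ n * cutoffConst * weightConst n Lam Gam 2 * (2 / lam)

theorem logConst_pos (hn : 3 ≤ n) {lam Gam : ℝ} (hlam : 0 < lam) (Lam : ℝ) (hGam : 0 ≤ Gam) :
    0 < logConst n lam Lam Gam := by
  have hn3 : (3 : ℝ) ≤ n := by exact_mod_cast hn
  have := weightConst_pos n Lam (p := 2) hGam two_pos
  have := cutoffConst_pos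
  unfold logConst
  positivity

section
variable {Ω : Set (Eu n)} {lam Lam Gam : ℝ} {a b : Eu n → Matrix (Fin n) (Fin n) ℝ}
  {u : Eu n → ℝ} {Du : Eu n → Eu n} {ε : ℝ}

/-- A function with the values `log (u + ε)` has bounded mean oscillation. -/
theorem IsNonnegSolution.exists_log (hS : IsNonnegSolution Ω lam Lam Gam a b u Du)
    (hn : 3 ≤ n) (hlam : 0 < lam) (hGam : 0 ≤ Gam) (hε : 0 < ε) :
    ∃ w : Eu n → ℝ, LocallyIntegrableOn w Ω ∧
      (∀ᵐ x ∂volume.restrict Ω, w x = Real.log (u x + ε)) ∧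
      ∀ (c : Eu n) (l : ℝ), 0 < l → ccube c (2 * n * l) ⊆ Ω →
        ∫ x in cube c l, |w x - ⨍ y in cube c l, w y| ≤ logConst n lam Lam Gam * l ^ n := by
  have hn3 : (3 : ℝ) ≤ n := by exact_mod_cast hn
  have hpos : ∀ t : ℝ, 0 < max t 0 + ε := fun t => by positivity
  -- With this `h` one may take `G = -(t + ε)⁻¹`, so that `|G| = (t + ε) h²`, and `(u + ε) h(u) =
  -- 1`: the solution disappears from the right side of Caccioppoli.
  set h : ℝ → ℝ := fun t => (max t 0 + ε)⁻¹ with hh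
  have hcont : Continuous h := Continuous.inv₀ (by fun_prop) fun t => (hpos t).ne'
  have hM : ∀ t, |h t| ≤ ε⁻¹ := by
    intro t
    rw [hh, abs_of_pos (inv_pos.2 (hpos t))]
    exact inv_anti₀ hε (by linarith [le_max_right t 0])
  have hmul : ∀ t, 0 ≤ t → (t + ε) * h t = 1 := by
    intro t ht
    simp only [hh]
    rw [max_eq_left ht, mul_inv_cancel₀ (by positivity)]
  have hHeq : ∀ t, 0 ≤ t → Real.log (0 + ε) + ∫ s in (0 : ℝ)..t, h s = Real.log (t + ε) := by
    intro t ht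
    refine const_add_integral_eq (P := fun t => Real.log (t + ε)) hcont ht fun s hs _ => ?_
    have := ((hasDerivAt_id s).add_const ε).log (by simp only [id]; positivity)
    simpa [hh, max_eq_left hs] using this
  have hGeq : ∀ t, 0 ≤ t → -(0 + ε)⁻¹ + ∫ s in (0 : ℝ)..t, h s ^ 2 = -(t + ε)⁻¹ := by
    intro t ht
    refine const_add_integral_eq (h := fun s => h s ^ 2) (P := fun t => -(t + ε)⁻¹)
      (hcont.pow 2) ht fun s hs _ => ?_
    have h1 : s + ε ≠ 0 := by positivity
    have := (((hasDerivAt_id s).add_const ε).inv (by simpa using h1)).neg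
    refine this.congr_deriv ?_
    simp only [hh, id, max_eq_left hs]
    field_simp
  have hw := hS.mem.comp hS.isOpen
    (hasDerivAt_const_add_integral hcont (Real.log (0 + ε))) hcont hM
  refine ⟨fun x => Real.log (0 + ε) + ∫ s in (0 : ℝ)..u x, h s, hw.1.1, ?_, ?_⟩
  · filter_upwards [hS.nonneg] with x hx
    exact hHeq _ hx
  intro c l hl hQ
  have hnl : 0 < n * l := by positivity
  set w : Eu n → ℝ := fun x => Real.log (0 + ε) + ∫ s in (0 : ℝ)..u x, h s
  -- The balls are centred at the corner `c`; radius `n * l` already covers the cube.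
  obtain ⟨η, hη, hηc, hηs, hη1, hηg⟩ := exists_ball_cutoff c hnl (by linarith : n * l < 2 * n * l)
  have hBQ : Metric.closedBall c (2 * n * l) ⊆ ccube c (2 * n * l) := closedBall_subset_ccube c _
  have hcB : cube c l ⊆ Metric.closedBall c (n * l) := fun x hx => by
    rw [Metric.mem_closedBall, dist_eq_norm]
    exact norm_sub_le_of_mem_cube hl.le (fun i => ⟨le_rfl, by linarith⟩) hx
  have hcΩ : cube c l ⊆ Ω := (hcB.trans (Metric.closedBall_subset_closedBall
    (by linarith))).trans (hBQ.trans hQ)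
  set m := meanMat b (WithLp.toLp 2 fun i => c i - 2 * n * l) (2 * (2 * n * l)) with hm
  have hcac := hS.coeff.caccioppoli hS.isOpen hlam hS.mem hS.tests hS.nonneg hη hηc
    (hηs.trans (hBQ.trans hQ))
    (hasDerivAt_const_add_integral (h := fun s => h s ^ 2) (hcont.pow 2) (-(0 + ε)⁻¹))
    hcont hM (K := 1) (ε := ε) zero_le_one hε.le (fun t ht => by
      have hp : 0 < t + ε := by positivity
      rw [hGeq t ht, abs_neg, abs_of_pos (inv_pos.2 hp), one_mul, pow_two, ← mul_assoc, hmul t ht]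
      simp [hh, max_eq_left ht]) m
  have hcc := cutoffConst_pos
  have hW := weightConst_pos n Lam (p := 2) hGam two_pos
  have hr : eLpNorm (fun x => oscWeight Lam b m x * ‖egrad η x‖ * ((u x + ε) * h (u x))) 2
      (volume.restrict Ω) ≤ ENNReal.ofReal (cutoffConst / (n * l)) *
        (ENNReal.ofReal (weightConst n Lam Gam 2) *
          volume (ccube c (2 * n * l)) ^ (1 / 2 : ℝ)) := by
    have hwt := hS.coeff.eLpNorm_weight_le hGam (c := WithLp.toLp 2 fun i => c i - 2 * n * l)
      (l := 2 * (2 * n * l)) (by positivity) hQ (p := 2) one_le_two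
    rw [ENNReal.ofReal_ofNat] at hwt
    refine le_trans ?_ (mul_le_mul' le_rfl hwt)
    have hmeas : MeasurableSet (ccube c (2 * n * l)) := measurableSet_cube _ _
    have e : volume.restrict (ccube c (2 * n * l)) =
        (volume.restrict Ω).restrict (ccube c (2 * n * l)) := by
      rw [Measure.restrict_restrict hmeas, Set.inter_eq_left.2 hQ]
    change _ ≤ _ * eLpNorm _ _ (volume.restrict (ccube c (2 * n * l)))
    rw [e, ← eLpNorm_indicator_eq_eLpNorm_restrict hmeas]
    refine eLpNorm_le_mul_eLpNorm_of_ae_le_mul ?_ 2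
    filter_upwards [hS.nonneg] with x hx
    rw [hmul _ hx, mul_one]
    have h0 := oscWeight_nonneg Lam b m x
    have hd : 0 ≤ cutoffConst / (n * l) := by positivity
    by_cases hxB : x ∈ Metric.closedBall c (2 * n * l)
    · rw [Set.indicator_of_mem (hBQ hxB), norm_mul, norm_norm, Real.norm_of_nonneg h0,
        Real.norm_of_nonneg (by linarith), mul_comm]
      have hg : ‖egrad η x‖ ≤ cutoffConst / (n * l) := by
        refine (hηg x).trans (le_of_eq ?_)
        congr 1
        ring
      gcongr
      linarith
    · rw [egrad_eq_zero_of_notMem (fun h => hxB (hηs h))]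
      simp only [norm_zero, mul_zero]
      positivity
  have hD : eLpNorm (fun x => h (u x) • Du x) 2 (volume.restrict (cube c l)) ≤
      eLpNorm (fun x => (η x * h (u x)) • Du x) 2 (volume.restrict Ω) := by
    refine le_trans (le_of_eq (eLpNorm_congr_ae ?_))
      (eLpNorm_mono_measure _ (Measure.restrict_mono hcΩ le_rfl))
    filter_upwards [ae_restrict_mem (measurableSet_cube c l)] with x hx
    rw [hη1 x (hcB hx), one_mul]
  have hpoin := hw.poincare hS.isOpen hl hcΩ
  have hint : IntegrableOn w (cube c l) :=
    hw.1.1.integrableOn_compact_subset hcΩ (isCompact_cube c l)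
  have hint2 : IntegrableOn (fun x => |w x - ⨍ y in cube c l, w y|) (cube c l) :=
    (Integrable.sub hint (integrableOn_const (volume_cube_ne_top c l) enorm_ne_top)).abs
  have hA := logConst_pos hn hlam Lam hGam
  rw [← ENNReal.ofReal_le_ofReal_iff (by positivity),
    ofReal_integral_eq_lintegral_ofReal hint2 (Eventually.of_forall fun x => abs_nonneg _)]
  have hvol : volume (cube c l) ^ (1 / 2 : ℝ) * volume (ccube c (2 * n * l)) ^ (1 / 2 : ℝ) ≤
      ENNReal.ofReal ((4 * n) ^ n * l ^ n) := by
    rw [volume_cube c hl.le, volume_ccube c (by positivity),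
      ← ENNReal.mul_rpow_of_nonneg _ _ (by norm_num), ← ENNReal.ofReal_pow (by positivity),
      ← ENNReal.ofReal_mul (by positivity),
      ENNReal.ofReal_rpow_of_nonneg (by positivity) (by norm_num)]
    refine ENNReal.ofReal_le_ofReal ?_
    rw [← Real.sqrt_eq_rpow]
    refine Real.sqrt_le_iff.2 ⟨by positivity, ?_⟩
    have h1 : (1 : ℝ) ≤ (4 * n) ^ n := one_le_pow₀ (by linarith)
    rw [show 2 * (2 * n * l) = 4 * n * l by ring, mul_pow (4 * (n : ℝ)) l n]
    calc l ^ n * ((4 * n) ^ n * l ^ n) = 1 * ((4 * n) ^ n * (l ^ n) ^ 2) := by ring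
      _ ≤ (4 * n) ^ n * ((4 * n) ^ n * (l ^ n) ^ 2) := by gcongr
      _ = _ := by ring
  calc ∫⁻ x in cube c l, ENNReal.ofReal |w x - ⨍ y in cube c l, w y|
      = ∫⁻ x in cube c l, ‖w x - ⨍ y in cube c l, w y‖ₑ :=
        lintegral_congr fun x => (Real.enorm_eq_ofReal_abs _).symm
    _ ≤ _ := hpoin
    _ ≤ ENNReal.ofReal (n * l) * 2 ^ n * volume (cube c l) ^ (1 / 2 : ℝ) *
        (ENNReal.ofReal (2 * 1 / lam) * (ENNReal.ofReal (cutoffConst / (n * l)) *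
        (ENNReal.ofReal (weightConst n Lam Gam 2) *
          volume (ccube c (2 * n * l)) ^ (1 / 2 : ℝ)))) :=
        mul_le_mul' le_rfl (hD.trans (hcac.trans (mul_le_mul' le_rfl hr)))
    _ = (ENNReal.ofReal (n * l) * ENNReal.ofReal (2 ^ n) * ENNReal.ofReal (2 / lam) *
        ENNReal.ofReal (cutoffConst / (n * l)) * ENNReal.ofReal (weightConst n Lam Gam 2)) *
        (volume (cube c l) ^ (1 / 2 : ℝ) * volume (ccube c (2 * n * l)) ^ (1 / 2 : ℝ)) := by
        rw [ENNReal.ofReal_pow two_pos.le, ENNReal.ofReal_ofNat, mul_one]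
        ring
    _ ≤ (ENNReal.ofReal (n * l) * ENNReal.ofReal (2 ^ n) * ENNReal.ofReal (2 / lam) *
        ENNReal.ofReal (cutoffConst / (n * l)) * ENNReal.ofReal (weightConst n Lam Gam 2)) *
        ENNReal.ofReal ((4 * n) ^ n * l ^ n) := mul_le_mul' le_rfl hvol
    _ = _ := by
        rw [← ENNReal.ofReal_mul (by positivity), ← ENNReal.ofReal_mul (by positivity),
          ← ENNReal.ofReal_mul (by positivity), ← ENNReal.ofReal_mul (by positivity),
          ← ENNReal.ofReal_mul (by positivity), logConst]
        congr 1
        field_simp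

/-- Exponential integrability of the logarithm of a solution, stated for powers. -/
theorem IsNonnegSolution.exists_lintegral_rpow_le (hS : IsNonnegSolution Ω lam Lam Gam a b u Du)
    (hn : 3 ≤ n) (hlam : 0 < lam) (hGam : 0 ≤ Gam) (hε : 0 < ε) {z : Eu n} {r : ℝ} (hr : 0 < r)
    (hΩ : Metric.closedBall z (5 * n ^ 2 * r) ⊆ Ω) :
    ∃ m : ℝ, ∀ p : ℝ, |p| ≤ jnExponent n (logConst n lam Lam Gam) →
      ∫⁻ x in ccube z r, ENNReal.ofReal (u x + ε) ^ p ∂avgMeasure z r ≤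
        ENNReal.ofReal (3 * Real.exp (p * m)) := by
  have hn3 : (3 : ℝ) ≤ n := by exact_mod_cast hn
  obtain ⟨w, hwl, hwlog, hw⟩ := hS.exists_log hn hlam hGam hε
  have hQ : ccube z r ⊆ Metric.closedBall z (n * r) := ccube_subset_closedBall z hr.le
  have hQΩ : ccube z r ⊆ Ω := hQ.trans ((Metric.closedBall_subset_closedBall
    (mul_le_mul_of_nonneg_right (by nlinarith) hr.le)).trans hΩ)
  have hA := logConst_pos hn hlam Lam hGam
  have hjn := lintegral_exp_mul_abs_sub_le (f := w) (c := WithLp.toLp 2 fun i => z i - r)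
    (l := 2 * r) (by positivity) hA (hwl.integrableOn_compact_subset hQΩ (isCompact_cube _ _)) ?_
  swap
  · intro c l hl hs
    refine hw c l hl ?_
    have hc : c ∈ ccube z r := hs fun i => ⟨le_rfl, by linarith⟩
    have hlr : l ≤ 2 * r := by
      have hc2 : (WithLp.toLp 2 fun i => c i + l : Eu n) ∈ ccube z r :=
        hs fun i => ⟨by simp only []; linarith, le_rfl⟩
      have i : Fin n := ⟨0, by omega⟩
      have h1 := (hc i).1
      have h2 := (hc2 i).2
      simp only [] at h1 h2
      linarith
    refine (ccube_subset_closedBall c (by positivity)).trans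
      ((Metric.closedBall_subset_closedBall' ?_).trans hΩ)
    have hd := hQ hc
    rw [Metric.mem_closedBall] at hd
    -- Source of `5 * n ^ 2`: a subcube has side at most `2 * r`, so the enlarged cube about its
    -- corner has radius at most `4 * n ^ 2 * r`, and the corner lies within `n * r` of `z`.
    have h3 : (n : ℝ) * (2 * n * l) ≤ n * (2 * n * (2 * r)) := by gcongr
    nlinarith [mul_pos (by linarith : (0 : ℝ) < n) hr]
  set θ := jnExponent n (logConst n lam Lam Gam)
  -- The same `m` serves every admissible `p`, in particular both signs; this is what links positive
  -- and negative powers.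
  refine ⟨⨍ y in ccube z r, w y, fun p hp => ?_⟩
  change ∫⁻ x in ccube z r, ENNReal.ofReal (Real.exp (θ * |w x - ⨍ y in ccube z r, w y|)) ≤ _ at hjn
  set m := ⨍ y in ccube z r, w y
  have hv0 : volume (ccube z r) ≠ 0 := volume_cube_ne_zero _ (by positivity)
  have hvt : volume (ccube z r) ≠ ⊤ := volume_cube_ne_top _ _
  have h1 : ∫⁻ x in ccube z r, ENNReal.ofReal (u x + ε) ^ p ≤
      ENNReal.ofReal (3 * Real.exp (p * m)) * volume (ccube z r) := by
    calc ∫⁻ x in ccube z r, ENNReal.ofReal (u x + ε) ^ p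
        ≤ ∫⁻ x in ccube z r, ENNReal.ofReal (Real.exp (p * m)) *
            ENNReal.ofReal (Real.exp (θ * |w x - m|)) := by
          refine lintegral_mono_ae ?_
          filter_upwards [ae_restrict_of_ae_restrict_of_subset hQΩ hS.nonneg,
            ae_restrict_of_ae_restrict_of_subset hQΩ hwlog] with x hx hxw
          have hpos : 0 < u x + ε := by positivity
          rw [ENNReal.ofReal_rpow_of_pos hpos, ← ENNReal.ofReal_mul (Real.exp_pos _).le,
            ← Real.exp_add, Real.rpow_def_of_pos hpos, ← hxw]
          refine ENNReal.ofReal_le_ofReal (Real.exp_le_exp.2 ?_)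
          have h2 : p * (w x - m) ≤ θ * |w x - m| := by
            refine (le_abs_self _).trans ?_
            rw [abs_mul]
            gcongr
          linarith
      _ ≤ ENNReal.ofReal (Real.exp (p * m)) * ENNReal.ofReal (3 * (2 * r) ^ n) := by
          rw [lintegral_const_mul' _ _ ENNReal.ofReal_ne_top]
          gcongr
      _ = _ := by
          rw [volume_ccube z hr.le, ← ENNReal.ofReal_pow (by positivity),
            ← ENNReal.ofReal_mul (by positivity), ← ENNReal.ofReal_mul (by positivity)]
          congr 1
          ring
  rw [setLIntegral_avgMeasure, mul_comm, ← div_eq_mul_inv]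
  exact ENNReal.div_le_of_le_mul h1

end

end BMOElliptic

/-! ### The local Harnack inequality and chaining. -/

namespace BMOElliptic

variable {n : ℕ}

/-- Powers `γ χ ^ m` that stay away from the exceptional value `1 / 2`. -/
theorem exists_exponent {χ θ : ℝ} (hχ : 1 < χ) (hθ : 0 < θ) :
    ∃ γ δ : ℝ, 0 < γ ∧ γ ≤ 1 ∧ γ ≤ θ ∧ 0 < δ ∧ (∀ m : ℕ, δ ≤ |2 * (γ * χ ^ m) - 1|) ∧
      ∀ m : ℕ, δ ≤ |2 * (-γ * χ ^ m) - 1| := by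
  -- With `γ = ½ s^{-(2M+1)}` the numbers `2 γ χ^m` are odd powers of `s = √χ`, so they stay at
  -- distance at least `1 - s⁻¹` from `1`; a large `M` makes `γ` as small as required. For `-γ` the
  -- distance exceeds `1`.
  set s := √χ with hs
  have hs1 : 1 < s := by rw [hs, Real.lt_sqrt zero_le_one]; simpa using hχ
  have hs0 : 0 < s := by linarith
  have hsχ : s ^ 2 = χ := Real.sq_sqrt (by linarith)
  obtain ⟨M, hM⟩ := exists_pow_lt_of_lt_one hθ (inv_lt_one_of_one_lt₀ hs1)
  have hinv : s⁻¹ < 1 := inv_lt_one_of_one_lt₀ hs1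
  have hpow : ∀ m : ℕ, 2 * (1 / 2 * (s⁻¹) ^ (2 * M + 1) * χ ^ m) =
      s ^ (2 * m) / s ^ (2 * M + 1) := fun m => by
    rw [← hsχ, ← pow_mul, inv_pow, div_eq_mul_inv]; ring
  have hle1 : (s⁻¹) ^ (2 * M + 1) ≤ 1 := pow_le_one₀ (by positivity) hinv.le
  refine ⟨1 / 2 * (s⁻¹) ^ (2 * M + 1), 1 - s⁻¹, by positivity, by linarith, ?_, by linarith,
    fun m => ?_, fun m => ?_⟩
  · have : (s⁻¹) ^ (2 * M + 1) ≤ (s⁻¹) ^ M := pow_le_pow_of_le_one (by positivity) hinv.le (by omega)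
    have h0 : 0 < (s⁻¹) ^ (2 * M + 1) := by positivity
    linarith
  · rw [hpow]
    rcases le_or_gt m M with hm | hm
    · have h1 : s ^ (2 * m) / s ^ (2 * M + 1) ≤ s⁻¹ := by
        rw [div_le_iff₀ (by positivity), pow_succ', inv_mul_cancel_left₀ hs0.ne']
        exact pow_le_pow_right₀ hs1.le (by omega)
      rw [abs_sub_comm]
      exact le_trans (by linarith) (le_abs_self _)
    · have h1 : s ≤ s ^ (2 * m) / s ^ (2 * M + 1) := by
        rw [le_div_iff₀ (by positivity), ← pow_succ']
        exact pow_le_pow_right₀ hs1.le (by omega)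
      have h2 : 2 ≤ s + s⁻¹ := by
        have h3 : s * s⁻¹ = 1 := mul_inv_cancel₀ hs0.ne'
        nlinarith [sq_nonneg (s - s⁻¹)]
      exact le_trans (by linarith) (le_abs_self _)
  · have h1 : 2 * (-(1 / 2 * (s⁻¹) ^ (2 * M + 1)) * χ ^ m) =
        -(s ^ (2 * m) / s ^ (2 * M + 1)) := by rw [← hpow]; ring
    have h2 : 0 < s ^ (2 * m) / s ^ (2 * M + 1) := by positivity
    have h3 : 0 < s⁻¹ := by positivity
    rw [h1, abs_sub_comm]
    exact le_trans (by linarith) (le_abs_self _)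

/-- `u ≤ C u'` for almost all values `u` of the function on `P` and `u'` on `Q`. -/
def AEComparable (u : Eu n → ℝ) (C : ℝ) (P Q : Set (Eu n)) : Prop :=
  ∀ᵐ x ∂volume.restrict P, ∀ᵐ y ∂volume.restrict Q, u x ≤ C * u y

/-- The Harnack inequality on balls that are small compared with the distance to the boundary. -/
theorem exists_local_harnack (hn : 3 ≤ n) {lam : ℝ} (hlam : 0 < lam) (Lam : ℝ) {Gam : ℝ}
    (hGam : 0 ≤ Gam) :
    ∃ C : ℝ, 0 < C ∧ ∀ (Ω : Set (Eu n)) (a b : Eu n → Matrix (Fin n) (Fin n) ℝ) (u : Eu n → ℝ)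
      (Du : Eu n → Eu n), IsNonnegSolution Ω lam Lam Gam a b u Du → ∀ (z : Eu n) (r : ℝ), 0 < r →
      Metric.closedBall z (5 * n ^ 2 * r) ⊆ Ω →
      AEComparable u C (Metric.closedBall z (r / 2)) (Metric.closedBall z (r / 2)) := by
  have hn3 : (3 : ℝ) ≤ n := by exact_mod_cast hn
  have hq := rhExp_pos hn
  have hA := logConst_pos hn hlam Lam hGam
  have hθ := jnExponent_pos n hA
  obtain ⟨γ, δ, hγ, hγ1, hγθ, hδ, h1, h2⟩ := exists_exponent (one_lt_rhGain hn)
    (div_pos hθ hq)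
  obtain ⟨E, hE, hloc⟩ := exists_local_bound hn hlam Lam hGam hδ
  set p := γ * rhExp n with hp
  have hp0 : 0 < p := by positivity
  have hpθ : p ≤ jnExponent n (logConst n lam Lam Gam) := by rwa [le_div_iff₀ hq] at hγθ
  set e := E.toReal with he
  have he0 : 0 ≤ e := ENNReal.toReal_nonneg
  -- The summand `1` only secures positivity, as `e` may vanish.
  refine ⟨(9 * e ^ 2) ^ (1 / p) + 1, by positivity, fun Ω a b u Du hS z r hr hΩ => ?_⟩
  have hQ : ccube z r ⊆ Ω := (ccube_subset_closedBall z hr.le).trans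
    ((Metric.closedBall_subset_closedBall
    (mul_le_mul_of_nonneg_right (by nlinarith) hr.le)).trans hΩ)
  have hB : Metric.closedBall z (r / 2) ⊆ ccube z r :=
    (Metric.closedBall_subset_closedBall (by linarith)).trans (closedBall_subset_ccube z r)
  have hu0 : ∀ᵐ x ∂volume.restrict (Metric.closedBall z (r / 2)), 0 ≤ u x :=
    ae_restrict_of_ae_restrict_of_subset (hB.trans hQ) hS.nonneg
  have hEe : E = ENNReal.ofReal e := (ENNReal.ofReal_toReal hE).symm
  have key : ∀ ε : ℝ, 0 < ε → ∀ᵐ x ∂volume.restrict (Metric.closedBall z (r / 2)),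
      ∀ᵐ y ∂volume.restrict (Metric.closedBall z (r / 2)),
        u x + ε ≤ (9 * e ^ 2) ^ (1 / p) * (u y + ε) := by
    intro ε hε
    obtain ⟨m, hm⟩ := hS.exists_lintegral_rpow_le hn hlam hGam hε hr hΩ
    have hbd : ∀ σ : ℝ, σ ≠ 0 → |σ| ≤ 1 → |σ * rhExp n| ≤ jnExponent n (logConst n lam Lam Gam) →
        (∀ m : ℕ, δ ≤ |2 * (σ * rhGain n ^ m) - 1|) →
        ∀ᵐ x ∂volume.restrict (Metric.closedBall z (r / 2)),
          (u x + ε) ^ (σ * rhExp n) ≤ e * (3 * Real.exp (σ * rhExp n * m)) := by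
      intro σ hσ hσ1 hσθ hσδ
      filter_upwards [hloc Ω a b u Du hS z r hr hQ ε σ hε hσ hσ1 hσδ, hu0] with x hx hx0
      have hpos : 0 < u x + ε := by positivity
      rw [← ENNReal.ofReal_le_ofReal_iff (by positivity), ← ENNReal.ofReal_rpow_of_pos hpos,
        ENNReal.ofReal_mul he0, ← hEe]
      refine hx.trans (mul_le_mul' le_rfl (le_trans ?_ (hm _ hσθ)))
      exact lintegral_mono_set (closedBall_subset_ccube z r)
    have hpos := hbd γ hγ.ne' (by rwa [abs_of_pos hγ]) (by rwa [← hp, abs_of_pos hp0]) h1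
    have hneg := hbd (-γ) (neg_ne_zero.2 hγ.ne') (by rwa [abs_neg, abs_of_pos hγ])
      (by rwa [neg_mul, abs_neg, ← hp, abs_of_pos hp0]) h2
    rw [← hp] at hpos
    rw [neg_mul, ← hp] at hneg
    filter_upwards [hpos, hu0] with x hx hx0
    filter_upwards [hneg, hu0] with y hy hy0
    have hUx : 0 < u x + ε := by positivity
    have hUy : 0 < u y + ε := by positivity
    -- The upper bound at `x` times the bound for the negative power at `y`: the factors `e^{pm}`
    -- and `e^{-pm}` cancel, and with them all dependence on the solution and on `ε`.
    have h3 : (u x + ε) ^ p * (u y + ε) ^ (-p) ≤ 9 * e ^ 2 := by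
      calc _ ≤ e * (3 * Real.exp (p * m)) * (e * (3 * Real.exp (-p * m))) :=
            mul_le_mul hx hy (by positivity) (by positivity)
        _ = 9 * e ^ 2 * (Real.exp (p * m) * Real.exp (-p * m)) := by ring
        _ = 9 * e ^ 2 := by rw [← Real.exp_add, neg_mul, add_neg_cancel, Real.exp_zero, mul_one]
    rw [Real.rpow_neg hUy.le, ← div_eq_mul_inv, div_le_iff₀ (by positivity)] at h3
    have h4 := Real.rpow_le_rpow (by positivity) h3 (by positivity : 0 ≤ 1 / p)
    rwa [Real.mul_rpow (by positivity) (by positivity), ← Real.rpow_mul hUx.le,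
      ← Real.rpow_mul hUy.le, mul_one_div_cancel hp0.ne', Real.rpow_one, Real.rpow_one] at h4
  -- The limit `ε → 0` is taken along `1 / (k + 1)`, so that only countably many null sets are
  -- discarded.
  have key2 := ae_all_iff.2 fun k : ℕ => key (1 / ((k : ℝ) + 1)) (by positivity)
  filter_upwards [key2] with x hx
  filter_upwards [ae_all_iff.2 hx, hu0] with y hy hy0
  have hlim : Tendsto (fun k : ℕ => 1 / ((k : ℝ) + 1)) atTop (𝓝 0) :=
    tendsto_one_div_add_atTop_nhds_zero_nat
  have h5 := le_of_tendsto_of_tendsto' (hlim.const_add (u x))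
    ((hlim.const_add (u y)).const_mul ((9 * e ^ 2) ^ (1 / p))) hy
  rw [add_zero, add_zero] at h5
  linarith

/-- The overlap has positive measure, so it contains a point at which both almost-everywhere
statements hold, and the comparison passes through its value. -/
theorem AEComparable.trans {u : Eu n → ℝ} {C C' : ℝ} (hC : 0 ≤ C) {P Q Q' S : Set (Eu n)}
    (h : AEComparable u C P Q) (h' : AEComparable u C' Q' S) (hQ : volume (Q ∩ Q') ≠ 0) :
    AEComparable u (C * C') P S := by
  have : NeZero (volume.restrict (Q ∩ Q')) := ⟨by simpa [Measure.restrict_eq_zero] using hQ⟩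
  filter_upwards [h] with x hx
  obtain ⟨y, hy, hy'⟩ := ((ae_restrict_of_ae_restrict_of_subset Set.inter_subset_left hx).and
    (ae_restrict_of_ae_restrict_of_subset Set.inter_subset_right h')).exists
  filter_upwards [hy'] with w hw
  refine hy.trans ?_
  rw [mul_assoc]
  gcongr

/-- Chaining the comparison along a segment. -/
theorem AEComparable.segment {u : Eu n → ℝ} {C s : ℝ} (hC : 0 ≤ C) (hs : 0 < s) {z w : Eu n}
    {N : ℕ} (hN : ‖w - z‖ ≤ N * (s / 2))
    (h : ∀ x ∈ segment ℝ z w, AEComparable u C (Metric.closedBall x s) (Metric.closedBall x s)) :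
    AEComparable u (C ^ (N + 1)) (Metric.closedBall z s) (Metric.closedBall w s) := by
  rcases Nat.eq_zero_or_pos N with rfl | hN0
  · have : w = z := by simpa [sub_eq_zero] using hN
    subst this
    simpa using h w (right_mem_segment _ _ _)
  have hN0' : (0 : ℝ) < N := by exact_mod_cast hN0
  have key : ∀ k : ℕ, k ≤ N → AEComparable u (C ^ (k + 1)) (Metric.closedBall z s)
      (Metric.closedBall (z + ((k : ℝ) / N) • (w - z)) s) := by
    intro k
    induction k with
    | zero => intro _; simpa using h z (left_mem_segment _ _ _)
    | succ k ih =>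
      intro hk
      rw [pow_succ]
      have hk' : ((k + 1 : ℕ) : ℝ) / N ≤ 1 := by
        rw [div_le_one hN0']; exact_mod_cast hk
      refine (ih (by omega)).trans (by positivity) (h (z + (((k + 1 : ℕ) : ℝ) / N) • (w - z)) ?_) ?_
      · rw [segment_eq_image']
        exact ⟨_, ⟨by positivity, hk'⟩, rfl⟩
      · have hsub : Metric.closedBall (z + ((k : ℝ) / N) • (w - z)) (s / 2) ⊆
            Metric.closedBall (z + ((k : ℝ) / N) • (w - z)) s ∩
              Metric.closedBall (z + (((k + 1 : ℕ) : ℝ) / N) • (w - z)) s := by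
          refine Set.subset_inter (Metric.closedBall_subset_closedBall (by linarith))
            (Metric.closedBall_subset_closedBall' ?_)
          rw [dist_eq_norm, add_sub_add_left_eq_sub, ← sub_smul, norm_smul, Real.norm_eq_abs,
            ← sub_div, abs_div, abs_of_pos hN0']
          push_cast
          rw [sub_add_cancel_left, abs_neg, abs_one, one_div_mul_eq_div]
          have : ‖w - z‖ / N ≤ s / 2 := by rw [div_le_iff₀ hN0']; linarith
          linarith
        exact ((Metric.measure_closedBall_pos volume _ (by linarith)).trans_le
          (measure_mono hsub)).ne'
  have := key N le_rfl
  rwa [div_self hN0'.ne', one_smul, add_sub_cancel] at this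

/-- A finite cover suffices: the constant is the same for all pairs of balls, so the number of
balls, which is not controlled, does not enter. -/
theorem AEComparable.of_cover {u : Eu n → ℝ} {C s : ℝ} {K P : Set (Eu n)} (hK : IsCompact K)
    (hs : 0 < s) (hP : P ⊆ K)
    (h : ∀ z ∈ K, ∀ w ∈ K, AEComparable u C (Metric.closedBall z s) (Metric.closedBall w s)) :
    AEComparable u C P P := by
  obtain ⟨t, htK, ht, hcov⟩ := hK.finite_cover_balls hs
  have hPt : P ⊆ ⋃ x ∈ t, Metric.closedBall x s :=
    (hP.trans hcov).trans (Set.iUnion₂_mono fun x _ => Metric.ball_subset_closedBall)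
  refine ae_restrict_of_ae_restrict_of_subset hPt
    ((ae_restrict_biUnion_iff _ ht.countable _).2 fun z hz => ?_)
  filter_upwards [(ae_ball_iff ht.countable).2 fun w hw => h z (htK hz) w (htK hw)] with x hx
  exact ae_restrict_of_ae_restrict_of_subset hPt
    ((ae_restrict_biUnion_iff _ ht.countable _).2 hx)

theorem AEComparable.essSup_le {u : Eu n → ℝ} {C : ℝ} (hC : 0 < C) {P : Set (Eu n)}
    (h : AEComparable u C P P) :
    essSup (fun x => ENNReal.ofReal (u x)) (volume.restrict P) ≤
      ENNReal.ofReal C * essInf (fun x => ENNReal.ofReal (u x)) (volume.restrict P) := by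
  refine essSup_le_of_ae_le _ ?_
  filter_upwards [h] with x hx
  have hC0 : ENNReal.ofReal C ≠ 0 := by simpa using hC
  rw [← ENNReal.div_le_iff' hC0 ENNReal.ofReal_ne_top]
  refine le_essInf_of_ae_le _ ?_
  filter_upwards [hx] with y hy
  rw [ENNReal.div_le_iff' hC0 ENNReal.ofReal_ne_top, ← ENNReal.ofReal_mul hC.le]
  exact ENNReal.ofReal_le_ofReal hy

end BMOElliptic

/-- The **Harnack inequality** for nonnegative solutions. -/
theorem mainTheorem12 (n : ℕ) (hn : 3 ≤ n) (lam Lam Gam : ℝ) (hlam : 0 < lam) (hGam : 0 ≤ Gam) :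
    ∃ C : ℝ, 0 < C ∧
      ∀ (Ω : Set (BMOElliptic.Eu n)), IsOpen Ω →
      ∀ (a b : BMOElliptic.Eu n → Matrix (Fin n) (Fin n) ℝ),
        BMOElliptic.IsCoefficient Ω lam Lam Gam a b →
      ∀ (u : BMOElliptic.Eu n → ℝ), BMOElliptic.IsWeakSolution Ω a b u →
        (∀ᵐ x ∂(volume.restrict Ω), 0 ≤ u x) →
      ∀ (x₀ : BMOElliptic.Eu n) (R : ℝ), 0 < R → Metric.closedBall x₀ (2 * R) ⊆ Ω →
        essSup (fun x => ENNReal.ofReal (u x)) (volume.restrict (Metric.ball x₀ R)) ≤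
          ENNReal.ofReal C *
            essInf (fun x => ENNReal.ofReal (u x)) (volume.restrict (Metric.ball x₀ R)) := by
  obtain ⟨C, hC, hloc⟩ := BMOElliptic.exists_local_harnack hn hlam Lam hGam
  have hn3 : (3 : ℝ) ≤ n := by exact_mod_cast hn
  -- Two centres in the closed ball are at most `2 * R` apart, the comparison balls have radius `s =
  -- R / (10 n²)`, and steps of length `s / 2` number `40 * n ^ 2`.
  refine ⟨C ^ (40 * n ^ 2 + 1), by positivity, ?_⟩
  rintro Ω hΩ a b hab u ⟨Du, hu, hsol⟩ hu0 x₀ R hR hball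
  have hS : BMOElliptic.IsNonnegSolution Ω lam Lam Gam a b u Du := ⟨hΩ, hab, hu, hsol, hu0⟩
  -- Chosen so that the ball of radius `5 n² r` required by the local inequality has radius exactly
  -- `R`, and hence stays in the closed ball of radius `2 * R` for every centre in the closed ball
  -- of radius `R`.
  set r := R / (5 * n ^ 2) with hr
  have hr0 : 0 < r := by positivity
  have hrR : 5 * (n : ℝ) ^ 2 * r = R := by rw [hr]; field_simp
  refine BMOElliptic.AEComparable.essSup_le (by positivity)
    (BMOElliptic.AEComparable.of_cover (isCompact_closedBall x₀ R) (half_pos hr0)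
      Metric.ball_subset_closedBall fun z hz w hw => ?_)
  refine BMOElliptic.AEComparable.segment hC.le (half_pos hr0) ?_ fun x hx =>
    hloc Ω a b u Du hS x r hr0 ?_
  · rw [mem_closedBall_iff_norm] at hz hw
    have h1 : ‖w - z‖ ≤ 2 * R := by
      rw [show w - z = (w - x₀) - (z - x₀) by abel]
      exact (norm_sub_le _ _).trans (by linarith)
    push_cast
    refine h1.trans (le_of_eq ?_)
    rw [← hrR]
    ring
  · have hx' := (convex_closedBall x₀ R).segment_subset hz hw hx
    rw [Metric.mem_closedBall] at hx'
    exact (Metric.closedBall_subset_closedBall' (by linarith)).trans hball
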